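/- Let $\Sigma\subset\mathbb{R}^2$ be a convex Euclidean polygon without flat vertices, that is, the convex hull of a finite set $V$ of at least three points, none of which lies in the convex hull of the others. An arc of $\Sigma$ is a line segment between two distinct points of $V$; a triangulation of $\Sigma$ is an inclusion-maximal set of pairwise non-crossing arcs, and its triangles are the triangles bounded by three of its arcs. The flip-graph $\mathcal{F}(\Sigma)$ has the triangulations of $\Sigma$ as its vertices, and two of them are adjacent when they differ by a single arc. The flip between them exchanges the two diagonals of a convex quadrilateral. Let $\pi:\mathbb{R}^3\to\mathbb{R}^2$ be the orthogonal projection on the first two coordinates, and let $(T_i)_{0\le i\le k}$ be a path in $\mathcal{F}(\Sigma)$. Let $Q_i$ be the quadrilateral whose diagonals are exchanged by the flip between $T_{i-1}$ and $T_i$. Consider topological disks $\Pi_0,\dots,\Pi_k$ in $\mathbb{R}^3$, each mapped homeomorphically onto $\Sigma$ by $\pi$, such that $\Pi_0$ has the same boundary as $\Sigma$ and, for $1\le i\le k$, $\Pi_i$ coincides with $\Pi_{i-1}$ except above the interior of $Q_i$, where $\Pi_i$ lies strictly above $\Pi_{i-1}$. A blow-up triangulation of $\Sigma$ associated with $(T_i)_{0\le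 i\le k}$ is a set $K$ obtained from such disks, made up of the portions of $\Pi_i$ that $\pi$ maps onto a vertex, an arc, or a triangle of $T_i$, for $0\le i\le k$ (the vertices, arcs, and triangles of $K$), and of the balls bounded by $\Pi_{i-1}$ and $\Pi_i$ over $Q_i$, for $1\le i\le k$ (the tetrahedra of $K$). These are the faces of $K$. **Theorem.** If $K$ is a blow-up triangulation of $\Sigma$ associated with a geodesic path in $\mathcal{F}(\Sigma)$ (a path whose length is the distance between its endpoints), then $K$ is a flag abstract simplicial complex. That is: 1. distinct faces of $K$ have distinct vertex sets, these sets are finite and nonempty, and every nonempty subset of the vertex set of a face $\sigma$ of $K$ is the vertex set of a face of $K$ contained in $\sigma$; 2. every nonempty set of vertices of $K$, any two distinct elements of which are the endpoints of an arc of $K$, is the vertex set of a face of $K$; 3. any three arcs of $K$ whose union is a topological circle bound a triangle of $K$: their union is the boundary of a triangle of $K$. -/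

import Mathlib

namespace FlipGraph

/-- The Euclidean plane `ℝ²`. -/
abbrev Plane : Type := EuclideanSpace ℝ (Fin 2)

/-- The space `ℝ³ = ℝ² × ℝ`; the orthogonal projection `π` to the plane is `Prod.fst`, and the
last coordinate is the height. -/
abbrev Space : Type := Plane × ℝ

/-- A convex Euclidean polygon without flat vertices, given by its vertices: at least three points
of the plane, none of which lies in the convex hull of the others. -/
structure ConvexPolygon where
  vertices : Set Plane
  finite_vertices : vertices.Finite
  three_le_ncard : 3 ≤ vertices.ncard
  convexIndependent : ConvexIndependent ℝ ((↑) : vertices → Plane)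

/-- Two arcs, each given by its set of endpoints, do not cross: the corresponding line segments
meet at most in a common face (a common endpoint, if the arcs are distinct). -/
def NonCrossing (e e' : Set Plane) : Prop :=
  convexHull ℝ e ∩ convexHull ℝ e' ⊆ convexHull ℝ (e ∩ e')

namespace ConvexPolygon

/-- The polygon `Σ` as a region of the plane. -/
def region (P : ConvexPolygon) : Set Plane := convexHull ℝ P.vertices

/-- The arcs of `Σ` are the line segments between two distinct vertices of `Σ`. An arc is
represented by the set of its two endpoints, and the segment itself is `convexHull ℝ e`. -/
def IsArc (P : ConvexPolygon) (e : Set Plane) : Prop := e ⊆ P.vertices ∧ e.ncard = 2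

/-- A triangulation of `Σ`: an inclusion-maximal set of pairwise non-crossing arcs of `Σ`.
The edges of `Σ` are among its arcs. -/
@[ext]
structure Triangulation (P : ConvexPolygon) where
  arcs : Set (Set Plane)
  isArc : ∀ e ∈ arcs, P.IsArc e
  nonCrossing : ∀ e ∈ arcs, ∀ e' ∈ arcs, NonCrossing e e'
  maximal : ∀ e, P.IsArc e → (∀ e' ∈ arcs, NonCrossing e e') → e ∈ arcs

variable {P : ConvexPolygon}

/-- The triangles of a triangulation `T`, each given by its three vertices. Since all the vertices
are extreme points of `Σ`, three arcs of `T` joining three vertices pairwise always bound a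
triangle of `T`. -/
def Triangulation.triangles (T : P.Triangulation) : Set (Set Plane) :=
  {t | ∃ a b c, t = {a, b, c} ∧ {a, b} ∈ T.arcs ∧ {b, c} ∈ T.arcs ∧ {c, a} ∈ T.arcs}

/-- The flip-graph `𝓕(Σ)`: two triangulations are adjacent when they differ by a single arc. -/
def flipGraph (P : ConvexPolygon) : SimpleGraph P.Triangulation where
  Adj T T' := ∃ e e', T.arcs \ T'.arcs = {e} ∧ T'.arcs \ T.arcs = {e'}
  symm := ⟨fun _ _ ⟨e, e', h, h'⟩ => ⟨e', e, h', h⟩⟩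
  loopless := ⟨fun T ⟨e, _, h, _⟩ => by
    have he : e ∈ T.arcs \ T.arcs := h ▸ Set.mem_singleton e
    exact he.2 he.1⟩

/-- A geodesic path: its length is the distance of its endpoints in the flip-graph. -/
def IsGeodesic {T T' : P.Triangulation} (p : P.flipGraph.Walk T T') : Prop :=
  p.length = P.flipGraph.dist T T'

/-- The quadrilateral whose diagonals are exchanged by the flip between `T` and `T'`: the convex
hull of the endpoints of the two exchanged arcs. -/
def flipQuad (T T' : P.Triangulation) : Set Plane :=
  convexHull ℝ (⋃₀ ((T.arcs \ T'.arcs) ∪ (T'.arcs \ T.arcs)))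

/-- A disk `Π` of `Space` such that `π` induces a homeomorphism `Π → Σ` is the graph of a
continuous function on `Σ`. The disks `Π₀, …, Πₖ` built from the path `T₀, …, Tₖ` are given here by
such functions `f 0, …, f k`: the boundary of `Π₀` is that of `Σ`, and `Πᵢ₊₁` is obtained from `Πᵢ`
by replacing the part of `Πᵢ` that projects to the quadrilateral of the flip between `Tᵢ` and `Tᵢ₊₁`
by a disk with the same boundary, whose interior is above `Πᵢ`. -/
structure IsDiskSequence {T T' : P.Triangulation} (p : P.flipGraph.Walk T T')
    (f : ℕ → Plane → ℝ) : Prop where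
  continuousOn : ∀ i ≤ p.length, ContinuousOn (f i) P.region
  boundary : ∀ x ∈ frontier P.region, f 0 x = 0
  eq_outside : ∀ i < p.length,
    ∀ x ∈ P.region \ interior (flipQuad (p.getVert i) (p.getVert (i + 1))), f (i + 1) x = f i x
  lt_inside : ∀ i < p.length,
    ∀ x ∈ interior (flipQuad (p.getVert i) (p.getVert (i + 1))), f i x < f (i + 1) x

end ConvexPolygon

/-- The portion of the graph of `f` that projects to `A`. -/
def lift (f : Plane → ℝ) (A : Set Plane) : Set Space := {x | x.1 ∈ A ∧ x.2 = f x.1}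

/-- The points that project to `A` and lie between the graphs of `f` and `g`. -/
def between (f g : Plane → ℝ) (A : Set Plane) : Set Space :=
  {x | x.1 ∈ A ∧ f x.1 ≤ x.2 ∧ x.2 ≤ g x.1}

/-- A set of vertices, arcs, triangles and tetrahedra, which are subsets of `Space`. A vertex is
a singleton. -/
@[ext]
structure Complex3 where
  vertices : Set (Set Space)
  arcs : Set (Set Space)
  triangles : Set (Set Space)
  tetrahedra : Set (Set Space)

open ConvexPolygon in
/-- The complex `K` built from a path `T₀, …, Tₖ` and the disks `Π₀, …, Πₖ`, which are the graphs
of `f 0, …, f k`. Its vertices, arcs and triangles are the portions of `Πᵢ` that project to a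
vertex, an arc, or a triangle of `Tᵢ`. It has one tetrahedron for each flip: the ball between `Πᵢ`
and `Πᵢ₊₁` above the quadrilateral of that flip. -/
def blowUp {P : ConvexPolygon} {T T' : P.Triangulation} (p : P.flipGraph.Walk T T')
    (f : ℕ → Plane → ℝ) : Complex3 where
  vertices := {σ | ∃ i ≤ p.length, ∃ v ∈ P.vertices, σ = lift (f i) {v}}
  arcs := {σ | ∃ i ≤ p.length, ∃ e ∈ (p.getVert i).arcs, σ = lift (f i) (convexHull ℝ e)}
  triangles := {σ | ∃ i ≤ p.length, ∃ t ∈ (p.getVert i).triangles,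
    σ = lift (f i) (convexHull ℝ t)}
  tetrahedra := {σ | ∃ i < p.length,
    σ = between (f i) (f (i + 1)) (flipQuad (p.getVert i) (p.getVert (i + 1)))}

namespace Complex3

/-- `K` is a blow-up triangulation associated with the path `p` of the flip-graph. -/
def IsAssociatedWith (K : Complex3) {P : ConvexPolygon} {T T' : P.Triangulation}
    (p : P.flipGraph.Walk T T') : Prop :=
  ∃ f : ℕ → Plane → ℝ, ConvexPolygon.IsDiskSequence p f ∧ K = blowUp p f

/-- The faces of `K`, of any dimension. -/
def faces (K : Complex3) : Set (Set Space) :=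
  K.vertices ∪ K.arcs ∪ K.triangles ∪ K.tetrahedra

/-- The vertices of a face `σ` of `K`: the vertices of `K` contained in `σ`. -/
def vertexSet (K : Complex3) (σ : Set Space) : Set (Set Space) := {v ∈ K.vertices | v ⊆ σ}

/-- `K` is an abstract simplicial complex: its faces are determined by their vertex sets, and every
nonempty subset of the vertex set of a face is the vertex set of a face of that face. -/
def IsAbstractSimplicialComplex (K : Complex3) : Prop :=
  Set.InjOn K.vertexSet K.faces ∧
    ∀ σ ∈ K.faces, (K.vertexSet σ).Nonempty ∧ (K.vertexSet σ).Finite ∧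
      ∀ s ⊆ K.vertexSet σ, s.Nonempty → ∃ τ ∈ K.faces, τ ⊆ σ ∧ K.vertexSet τ = s

/-- `K` is flag: a nonempty set of vertices that induces a complete graph in the `1`-skeleton of
`K` is always the vertex set of a face of `K`. -/
def IsFlag (K : Complex3) : Prop :=
  ∀ s ⊆ K.vertices, s.Nonempty →
    (∀ v ∈ s, ∀ w ∈ s, v ≠ w → ∃ α ∈ K.arcs, v ⊆ α ∧ w ⊆ α) →
      ∃ σ ∈ K.faces, K.vertexSet σ = s

end Complex3

/-- The set `C` is a topological circle. -/
def IsTopologicalCircle (C : Set Space) : Prop := Nonempty (C ≃ₜ Circle)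

/-- The boundary of a disk `τ` which `π` maps homeomorphically onto a disk of the plane. -/
def diskBoundary (τ : Set Space) : Set Space := {x ∈ τ | x.1 ∈ frontier (Prod.fst '' τ)}

end FlipGraph

/-! Two properties of geodesic paths in the flip-graph carry the theorem.

Convexity (`IsGeoSeq.convex`): an arc that lies in two triangulations of a geodesic lies in all
those in between. Collapsing a cyclic run of consecutive vertices to one vertex sends triangulations
to triangulations (`IsCollapse.isTri_push`), and sends a flip to a change of at most one arc, to no
change at all if two vertices of its quadrilateral are merged (`IsFlip.push_eq`). Collapsing the two
sides of `0b` in turn and taking the union gives a retraction `split b` onto the triangulations that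
contain `0b`. It does not lengthen paths, since no quadrilateral survives both collapses, and it
turns a flip that removes `0b` into a stationary step. A path that leaves `0b` and comes back to it
is therefore not geodesic.

Triangles (`IsGeoSeq.exists_triangle`): if `ab`, `bc` and `ca` all occur along a geodesic, they
occur simultaneously. Let `ab`, `ac`, `bc` occur at times `t₁ ≤ t₂ ≤ t₃`, and consider at time `t₂`
the triangle on `ac` on the side of `b`. If its apex is not `b`, then up to reversal of the path it
has an edge `ax` that crosses `bc`. A second pair of collapses, recombined by gluing
(`IsGeo.reach_of_fan`), shows that applying `split b` at that time costs nothing on the way to a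
triangulation that contains `bc`. Hence `ab` is already present at `t₂`, and neither `ab` nor `ac`
can be flipped out while such an `ax` exists. They stay until `abc` is a triangle.

The complex inherits this. By convexity the disks agree above a common simplex, and a flipped-out
diagonal never returns, so vertex sets determine faces. For flagness, cliques of at most three
vertices are covered by the triangle property. In a clique of four, crossing diagonals occur in
disjoint ranges of times, and when the first diagonal leaves all four sides are present, so that
flip produces the tetrahedron. Five vertices would impose contradictory orders on the diagonals of a
pentagon. Finally, arcs with different endpoint sets meet only above common endpoints, since an arc
flipped out stays strictly below all later disks away from its endpoints. A circle has no free end,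
so three arcs that form a circle join three vertices pairwise. -/

namespace FlipGraph

/-! ### Triangulations of a labelled polygon and their images by collapses -/

/-- The chords `xy` and `zw` of a convex polygon cross, where the vertices of the polygon are
labelled by natural numbers along its boundary. -/
def Crosses (x y z w : ℕ) : Prop :=
  (x < z ∧ z < y ∧ (w < x ∨ y < w)) ∨ (x < w ∧ w < y ∧ (z < x ∨ y < z)) ∨
    (y < z ∧ z < x ∧ (w < y ∨ x < w)) ∨ (y < w ∧ w < x ∧ (z < y ∨ x < z))

theorem Crosses.swap {x y z w : ℕ} (h : Crosses x y z w) : Crosses z w x y := by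
  unfold Crosses at *; omega

theorem Crosses.comm_left {x y z w : ℕ} (h : Crosses x y z w) : Crosses y x z w := by
  unfold Crosses at *; omega

theorem Crosses.comm_right {x y z w : ℕ} (h : Crosses x y z w) : Crosses x y w z := by
  unfold Crosses at *; omega

/-- The symmetric relation `R` is the set of arcs of a triangulation of the convex polygon whose
vertices are labelled by `W`. -/
structure IsTri (W : Set ℕ) (R : ℕ → ℕ → Prop) : Prop where
  symm : ∀ {x y}, R x y → R y x
  ne : ∀ {x y}, R x y → x ≠ y
  mem : ∀ {x y}, R x y → x ∈ W
  noncross : ∀ {x y z w}, R x y → R z w → ¬Crosses x y z w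
  maximal : ∀ {x y}, x ∈ W → y ∈ W → x ≠ y → (∀ z w, R z w → ¬Crosses x y z w) → R x y

namespace IsTri

variable {W : Set ℕ} {R S : ℕ → ℕ → Prop} {n : ℕ}

theorem mem' (h : IsTri W R) {x y : ℕ} (hxy : R x y) : y ∈ W := h.mem (h.symm hxy)

/-- Inclusion suffices by maximality: an arc of `S` crosses no arc of `R ⊆ S`. -/
theorem eq_of_le (hR : IsTri W R) (hS : IsTri W S) (hle : ∀ x y, R x y → S x y) : R = S := by
  funext x y
  refine propext ⟨hle x y, fun h => hR.maximal (hS.mem h) (hS.mem' h) (hS.ne h) fun z w hzw => ?_⟩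
  exact hS.noncross h (hle _ _ hzw)

theorem succ (h : IsTri (Set.Iio n) R) {i : ℕ} (hi : i + 1 < n) : R i (i + 1) := by
  refine h.maximal (by simp; omega) (by simpa using hi) (by omega) fun z w _ hc => ?_
  unfold Crosses at hc; omega

theorem zero_last (h : IsTri (Set.Iio n) R) (hn : 1 < n) : R 0 (n - 1) := by
  refine h.maximal (by simp; omega) (by simp; omega) (by omega) fun z w hzw hc => ?_
  have h1 := h.mem hzw
  have h2 := h.mem' hzw
  simp only [Set.mem_Iio] at h1 h2
  unfold Crosses at hc; omega

/-- An arc of a triangulation bounds a triangle on each of its sides. -/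
theorem exists_triangle_of_lt (h : IsTri (Set.Iio n) R) {u v y : ℕ} (huv : R u v) (hlt : u < v)
    (hy : y < n) (hyu : y ≠ u) (hyv : y ≠ v) :
    ∃ w, w ≠ u ∧ w ≠ v ∧ ¬Crosses u v w y ∧ R u w ∧ R v w := by
  have hv : v < n := h.mem' huv
  by_cases hin : u < y ∧ y < v
  · have hfin : {w | u < w ∧ w < v ∧ R u w}.Finite :=
      (Set.finite_Iio n).subset fun w hw => h.mem' hw.2.2
    -- The apex is the neighbour of `u` closest to `v` on this side: an arc crossing `wv` but
    -- neither `uv` nor `uw` must end at `u`, against this choice.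
    obtain ⟨w, ⟨hw1, hw2, hw3⟩, hmax⟩ := Set.exists_max_image _ (fun w => w) hfin
      ⟨u + 1, by omega, by omega, h.succ (by omega)⟩
    refine ⟨w, by omega, by omega, by unfold Crosses; omega, hw3, h.symm ?_⟩
    refine h.maximal (h.mem' hw3) hv (by omega) fun z t hzt hc => ?_
    have key : ∀ z t, R z t → ¬(w < z ∧ z < v ∧ (t < w ∨ v < t)) := by
      rintro z t hzt ⟨h1, h2, h3⟩
      have hc1 := h.noncross huv hzt
      have hc2 := h.noncross hw3 hzt
      have : t = u := by unfold Crosses at hc1 hc2; omega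
      subst this
      have := hmax z ⟨by omega, h2, h.symm hzt⟩
      omega
    have := key z t hzt
    have := key t z (h.symm hzt)
    unfold Crosses at hc; omega
  · have hfin : {w | (w < u ∨ v < w) ∧ R u w}.Finite :=
      (Set.finite_Iio n).subset fun w hw => h.mem' hw.2
    have hne : ({w | (w < u ∨ v < w) ∧ R u w} : Set ℕ).Nonempty := by
      rcases Nat.eq_zero_or_pos u with rfl | hu
      · exact ⟨n - 1, by omega, h.zero_last (by omega)⟩
      · refine ⟨u - 1, by omega, h.symm ?_⟩
        have := h.succ (i := u - 1) (by omega)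
        rwa [Nat.sub_add_cancel hu] at this
    -- On the other side, the cyclic order starting after `v` passes through `n - 1` and then `0`;
    -- the shift by `n` puts the labels below `u` after those above `v`.
    obtain ⟨w, ⟨hw1, hw3⟩, hmin⟩ := Set.exists_min_image _
      (fun w => if v < w then w else w + n) hfin hne
    have hwn : w < n := h.mem' hw3
    refine ⟨w, by omega, by omega, by unfold Crosses; omega, hw3, h.symm ?_⟩
    refine h.maximal hwn hv (by omega) fun z t hzt hc => ?_
    have key : ∀ z t, R z t →
        ¬(((v < z ∧ z < w) ∨ (w < u ∧ (v < z ∨ z < w))) ∧ Crosses w v z t) := by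
      rintro z t hzt ⟨h1, h2⟩
      have hc1 := h.noncross huv hzt
      have hc2 := h.noncross hw3 hzt
      have hz := h.mem hzt
      simp only [Set.mem_Iio] at hz
      have : t = u := by unfold Crosses at hc1 hc2 h2; omega
      subst this
      have := hmin z ⟨by omega, h.symm hzt⟩
      split_ifs at this <;> omega
    have h1 := key z t hzt
    have h2 := key t z (h.symm hzt)
    have h3 := hc.comm_right
    simp only [hc, h3, and_true] at h1 h2
    unfold Crosses at hc; omega

theorem exists_triangle (h : IsTri (Set.Iio n) R) {u v y : ℕ} (huv : R u v)
    (hy : y < n) (hyu : y ≠ u) (hyv : y ≠ v) :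
    ∃ w, w ≠ u ∧ w ≠ v ∧ ¬Crosses u v w y ∧ R u w ∧ R v w := by
  rcases lt_or_gt_of_ne (h.ne huv) with hlt | hlt
  · exact h.exists_triangle_of_lt huv hlt hy hyu hyv
  · obtain ⟨w, h1, h2, h3, h4, h5⟩ := h.exists_triangle_of_lt (h.symm huv) hlt hy hyv hyu
    exact ⟨w, h2, h1, fun hc => h3 hc.comm_left, h5, h4⟩

end IsTri

/-- The map `φ` collapses the boundary of a polygon to the boundary of a polygon whose vertices are
among those of the first: it is the identity on the image, it preserves the cyclic order weakly, and
its fibers are intervals. -/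
structure IsCollapse (n : ℕ) (φ : ℕ → ℕ) : Prop where
  lt : ∀ x < n, φ x < n
  idem : ∀ x, φ (φ x) = φ x
  crosses : ∀ {x y z w}, Crosses (φ x) (φ y) (φ z) (φ w) → Crosses x y z w
  fiber : ∀ {x y z w}, Crosses x y z w → φ x = φ y → φ z = φ x ∨ φ w = φ x

/-- The image of a set of arcs by a collapse. -/
def push (φ : ℕ → ℕ) (R : ℕ → ℕ → Prop) (x y : ℕ) : Prop :=
  x ≠ y ∧ ∃ p q, R p q ∧ φ p = x ∧ φ q = y

theorem push_of {φ : ℕ → ℕ} {R : ℕ → ℕ → Prop} {p q : ℕ} (h : R p q) (hne : φ p ≠ φ q) :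
    push φ R (φ p) (φ q) := ⟨hne, p, q, h, rfl, rfl⟩

/-- Four distinct points on a circle are split into two pairs in three ways, and one of these is a
crossing. -/
theorem crosses_of_not {u v w y : ℕ} (huv : u ≠ v) (huw : u ≠ w) (huy : u ≠ y) (hvw : v ≠ w)
    (hvy : v ≠ y) (hwy : w ≠ y) (h1 : ¬Crosses u v w y) (h2 : ¬Crosses u w v y) :
    Crosses v w y u := by
  unfold Crosses at *
  rcases lt_or_gt_of_ne huv with a | a <;> rcases lt_or_gt_of_ne huw with b | b <;>
    rcases lt_or_gt_of_ne huy with c | c <;> rcases lt_or_gt_of_ne hvw with d | d <;>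
    simp only [a, b, c, d, a.not_gt, b.not_gt, c.not_gt, d.not_gt, true_and, and_true, false_and,
      and_false, or_true, true_or, or_false, false_or, not_true] at h1 h2 ⊢ <;>
    omega

/-- The chord `vw` cuts the `y`-side of `uv`, so the `y`-side of `vw` is contained in it. -/
theorem not_crosses_of_crosses {u v w y z : ℕ} (h : Crosses v w y u) (hz1 : z ≠ w) (hz2 : z ≠ v)
    (hz : ¬Crosses w v z y) : z ≠ u ∧ ¬Crosses u v z y := by
  unfold Crosses at *
  omega

open Classical in
/-- The number of vertices on the same side of `uv` as `y`. -/
noncomputable def sideCount (n y u v : ℕ) : ℕ :=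
  ((Finset.range n).filter fun z => z ≠ u ∧ z ≠ v ∧ ¬Crosses u v z y).card

/-- The vertex `w` itself is lost. This is the decreasing measure of the descent in `push_aux`. -/
theorem sideCount_lt {n u v w y : ℕ} (hw : w < n) (hwu : w ≠ u) (hwv : w ≠ v)
    (huv : ¬Crosses u v w y) (h : Crosses v w y u) : sideCount n y w v < sideCount n y u v := by
  classical
  refine Finset.card_lt_card ?_
  rw [Finset.ssubset_iff_of_subset]
  · exact ⟨w, by simp [hw, hwu, hwv, huv], by simp⟩
  · intro z hz
    simp only [Finset.mem_filter] at hz ⊢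
    have := not_crosses_of_crosses h hz.2.1 hz.2.2.1 hz.2.2.2
    exact ⟨hz.1, this.1, hz.2.2.1, this.2⟩

theorem sideCount_comm (n y u v : ℕ) : sideCount n y u v = sideCount n y v u := by
  classical
  unfold sideCount
  congr 1
  ext z
  simp only [Finset.mem_filter]
  have : Crosses u v z y ↔ Crosses v u z y := ⟨Crosses.comm_left, Crosses.comm_left⟩
  rw [this]
  tauto

namespace IsCollapse

variable {n : ℕ} {φ : ℕ → ℕ} {R : ℕ → ℕ → Prop}

/-- Descent towards `y`. An arc whose image joins `x` to a point strictly between `x` and `y` has a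
triangle on its `y`-side, and one of the two other edges of that triangle has the same property with
fewer vertices on its `y`-side. -/
theorem push_aux (hφ : IsCollapse n φ) (h : IsTri (Set.Iio n) R) {x y : ℕ} (hxy : x < y)
    (hy : y < n) (hx' : φ x = x) (hy' : φ y = y)
    (hnc : ∀ z w, push φ R z w → ¬Crosses x y z w) (hno : ¬push φ R x y) :
    ∀ N u v, R u v → φ u = x → x < φ v → φ v < y → sideCount n y u v < N → False := by
  intro N
  induction N with
  | zero => intro u v _ _ _ _ h; omega
  | succ N ih =>
    intro u v huv hu hv1 hv2 hN
    have huy : y ≠ u := by rintro rfl; omega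
    have hvy : y ≠ v := by rintro rfl; omega
    obtain ⟨w, hwu, hwv, hc, huw, hvw⟩ := h.exists_triangle huv hy huy hvy
    have hwn : w < n := h.mem' huw
    have hwy : φ w ≠ y := by
      intro hwy
      exact hno ⟨by omega, u, w, huw, hu, hwy⟩
    have hwy' : w ≠ y := by rintro rfl; exact hwy hy'
    -- Otherwise the image of `vw` would cross `xy`.
    have hout : x ≤ φ w ∧ φ w < y := by
      by_contra hcon
      exact hnc _ _ (push_of hvw (by omega)) (by unfold Crosses; omega)
    have huv' : u ≠ v := by rintro rfl; omega
    rcases hout.1.eq_or_lt with hwx | hwx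
    · have hcr : Crosses v w y u := by
        refine crosses_of_not huv' hwu.symm huy.symm hwv.symm hvy.symm hwy' hc fun hcr => ?_
        have := hφ.fiber hcr (by omega)
        omega
      exact ih w v (h.symm hvw) hwx.symm hv1 hv2
        (by have := sideCount_lt hwn hwu hwv hc hcr; omega)
    · have hcr : Crosses u w y v := by
        refine crosses_of_not huv'.symm hwv.symm hvy.symm hwu.symm huy.symm hwy'
          (fun hcr => hc hcr.comm_left) fun hcr => ?_
        rcases lt_trichotomy (φ v) (φ w) with hlt | heq | hlt
        · have := hφ.crosses (x := u) (y := w) (z := v) (w := y) (by unfold Crosses; omega)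
          unfold Crosses at this hcr; omega
        · have := hφ.fiber hcr heq
          omega
        · exact hc (hφ.crosses (by unfold Crosses; omega))
      refine ih u w huw hu hwx hout.2 ?_
      have := sideCount_lt hwn hwv hwu (fun hcr => hc hcr.comm_left) hcr
      rw [sideCount_comm n y w u, sideCount_comm n y v u] at this
      omega

/-- Follow the edges of the polygon from `x` to `y`. The first one whose image leaves `x` either
maps onto `xy` or starts the descent of `push_aux`; if none leaves, then `φ y = x`. -/
theorem push_maximal (hφ : IsCollapse n φ) (h : IsTri (Set.Iio n) R) {x y : ℕ} (hxy : x < y)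
    (hy : y < n) (hx' : φ x = x) (hy' : φ y = y)
    (hnc : ∀ z w, push φ R z w → ¬Crosses x y z w) : push φ R x y := by
  by_contra hno
  have key : ∀ i, x + i ≤ y → φ (x + i) = x := by
    intro i
    induction i with
    | zero => intro _; exact hx'
    | succ i ih =>
      intro hi
      have hi' := ih (by omega)
      have hR : R (x + i) (x + (i + 1)) := h.succ (by omega)
      by_contra hne
      have h1 : φ (x + (i + 1)) ≠ y := fun h1 => hno ⟨by omega, _, _, hR, hi', h1⟩
      have h2 : x + (i + 1) ≠ y := by intro h2; rw [h2] at h1; exact h1 hy'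
      -- If the image were outside, the chord from `x + (i + 1)` to its image would separate `x`
      -- from `y`, and its endpoints lie in one fiber, which would then contain `x` or `y`.
      have h3 : x < φ (x + (i + 1)) ∧ φ (x + (i + 1)) < y := by
        by_contra h3
        have := hφ.fiber (x := x + (i + 1)) (y := φ (x + (i + 1))) (z := x) (w := y)
          (by unfold Crosses; omega) (hφ.idem _).symm
        omega
      exact hφ.push_aux h hxy hy hx' hy' hnc hno _ _ _ hR hi' h3.1 h3.2 (Nat.lt_succ_self _)
  have := key (y - x) (by omega)
  rw [show x + (y - x) = y by omega] at this
  omega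

theorem push_symm (h : IsTri (Set.Iio n) R) {x y : ℕ} (hxy : push φ R x y) : push φ R y x := by
  obtain ⟨hne, p, q, hpq, hp, hq⟩ := hxy
  exact ⟨hne.symm, q, p, h.symm hpq, hq, hp⟩

/-- A collapse sends a triangulation to a triangulation. -/
theorem isTri_push (hφ : IsCollapse n φ) (h : IsTri (Set.Iio n) R) :
    IsTri (φ '' Set.Iio n) (push φ R) where
  symm := push_symm h
  ne hxy := hxy.1
  mem := by
    rintro x y ⟨_, p, q, hpq, rfl, _⟩
    exact ⟨p, h.mem hpq, rfl⟩
  noncross := by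
    rintro x y z w ⟨_, p, q, hpq, rfl, rfl⟩ ⟨_, p', q', hpq', rfl, rfl⟩ hc
    exact h.noncross hpq hpq' (hφ.crosses hc)
  maximal := by
    rintro _ _ ⟨x, hx, rfl⟩ ⟨y, hy, rfl⟩ hne hnc
    rcases lt_or_gt_of_ne hne with hlt | hlt
    · exact hφ.push_maximal h hlt (hφ.lt _ hy) (hφ.idem _) (hφ.idem _) hnc
    · exact push_symm h (hφ.push_maximal h hlt (hφ.lt _ hx) (hφ.idem _) (hφ.idem _)
        fun z w hzw hc => hnc z w hzw hc.comm_left)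

end IsCollapse
end FlipGraph

/-! ### Flips, paths with stationary steps, and the collapses in use -/

namespace FlipGraph

/-- The flip that exchanges the diagonals `pr` and `qs` of the quadrilateral `pqrs` transforms `R`
into `S`. -/
structure IsFlip (R S : ℕ → ℕ → Prop) (p q r s : ℕ) : Prop where
  crosses : Crosses p r q s
  diag : R p r
  diag_not : ¬S p r
  diag' : S q s
  diag_not' : ¬R q s
  side₁ : R p q ∧ S p q
  side₂ : R q r ∧ S q r
  side₃ : R r s ∧ S r s
  side₄ : R s p ∧ S s p
  left : ∀ x y, R x y → S x y ∨ (x = p ∧ y = r) ∨ (x = r ∧ y = p)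
  right : ∀ x y, S x y → R x y ∨ (x = q ∧ y = s) ∨ (x = s ∧ y = q)

/-- At most one arc of `R` does not belong to `S`. -/
def SubsetButOne (R S : ℕ → ℕ → Prop) : Prop :=
  ∃ p r, ∀ x y, R x y → S x y ∨ (x = p ∧ y = r) ∨ (x = r ∧ y = p)

/-- `R` and `S` coincide or differ by a single arc. -/
def Near (R S : ℕ → ℕ → Prop) : Prop := SubsetButOne R S ∧ SubsetButOne S R

variable {n : ℕ} {R S : ℕ → ℕ → Prop} {φ : ℕ → ℕ} {p q r s : ℕ}

theorem Near.or {R S : ℕ → ℕ → Prop} (h : Near R S) (Z : ℕ → ℕ → Prop) :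
    Near (fun x y => R x y ∨ Z x y) (fun x y => S x y ∨ Z x y) := by
  obtain ⟨⟨p, r, h1⟩, ⟨p', r', h2⟩⟩ := h
  refine ⟨⟨p, r, fun x y hxy => ?_⟩, ⟨p', r', fun x y hxy => ?_⟩⟩
  · rcases hxy with hxy | hxy
    · have := h1 x y hxy; tauto
    · tauto
  · rcases hxy with hxy | hxy
    · have := h2 x y hxy; tauto
    · tauto

theorem IsFlip.symm (hR : IsTri (Set.Iio n) R) (hS : IsTri (Set.Iio n) S)
    (h : IsFlip R S p q r s) : IsFlip S R q r s p where
  crosses := h.crosses.swap.comm_right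
  diag := h.diag'
  diag_not := h.diag_not'
  diag' := hR.symm h.diag
  diag_not' := fun h' => h.diag_not (hS.symm h')
  side₁ := h.side₂.symm
  side₂ := h.side₃.symm
  side₃ := h.side₄.symm
  side₄ := h.side₁.symm
  left := h.right
  right x y hxy := by have := h.left x y hxy; tauto

/-- A chord that crosses the side `pq` enters the quadrilateral and must cross a diagonal to leave
it or to end at `r` or `s`. -/
theorem crosses_side {p q r s z w : ℕ} (hc : Crosses p r q s) (h : Crosses p q z w) :
    Crosses p r z w ∨ Crosses q s z w := by
  unfold Crosses at *
  grind

/-- The sides of the quadrilateral of a flip belong to both triangulations. -/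
theorem IsTri.side_of_flip (hR : IsTri (Set.Iio n) R) (hS : IsTri (Set.Iio n) S)
    (hc : Crosses p r q s) (hpr : R p r) (hqs : S q s)
    (hleft : ∀ x y, R x y → S x y ∨ (x = p ∧ y = r) ∨ (x = r ∧ y = p)) : R p q := by
  refine hR.maximal (hR.mem hpr) (hS.mem hqs) (by unfold Crosses at hc; omega) fun z w hzw hcr => ?_
  rcases hleft z w hzw with h | ⟨rfl, rfl⟩ | ⟨rfl, rfl⟩
  · rcases crosses_side hc hcr with h' | h'
    · exact hR.noncross hpr hzw h'
    · exact hS.noncross hqs h h'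
  · unfold Crosses at hcr; omega
  · unfold Crosses at hcr; omega

/-- The two exchanged arcs cross, since otherwise maximality would put `pr` in `S`. The sides are
then supplied by `side_of_flip`, applied to the four choices of orientation of the diagonals. -/
theorem isFlip_of_diff (hR : IsTri (Set.Iio n) R) (hS : IsTri (Set.Iio n) S)
    (hpr : R p r) (hpr' : ¬S p r) (hqs : S q s) (hqs' : ¬R q s)
    (hleft : ∀ x y, R x y → S x y ∨ (x = p ∧ y = r) ∨ (x = r ∧ y = p))
    (hright : ∀ x y, S x y → R x y ∨ (x = q ∧ y = s) ∨ (x = s ∧ y = q)) :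
    IsFlip R S p q r s := by
  have hc : Crosses p r q s := by
    by_contra hc
    refine hpr' (hS.maximal (hR.mem hpr) (hR.mem' hpr) (hR.ne hpr) fun z w hzw => ?_)
    rcases hright z w hzw with h | ⟨rfl, rfl⟩ | ⟨rfl, rfl⟩
    · exact hR.noncross hpr h
    · exact hc
    · exact fun h => hc h.comm_right
  have hleft' : ∀ x y, R x y → S x y ∨ (x = r ∧ y = p) ∨ (x = p ∧ y = r) := fun x y hxy => by
    have := hleft x y hxy; tauto
  have key : ∀ x y, R x y → ¬(x = p ∧ y = r) → ¬(x = r ∧ y = p) → S x y := fun x y hxy => by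
    have := hleft x y hxy; tauto
  have h1 := hR.side_of_flip hS hc hpr hqs hleft
  have h2 := hR.side_of_flip hS hc.comm_left (hR.symm hpr) hqs hleft'
  have h3 := hR.side_of_flip hS hc.comm_left.comm_right (hR.symm hpr) (hS.symm hqs) hleft'
  have h4 := hR.side_of_flip hS hc.comm_right hpr (hS.symm hqs) hleft
  have hne : q ≠ p ∧ q ≠ r ∧ s ≠ p ∧ s ≠ r := by unfold Crosses at hc; omega
  exact ⟨hc, hpr, hpr', hqs, hqs', ⟨h1, key _ _ h1 (by tauto) (by tauto)⟩,
    ⟨hR.symm h2, key _ _ (hR.symm h2) (by tauto) (by tauto)⟩,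
    ⟨h3, key _ _ h3 (by tauto) (by tauto)⟩,
    ⟨hR.symm h4, key _ _ (hR.symm h4) (by tauto) (by tauto)⟩, hleft, hright⟩

namespace IsFlip

theorem subsetButOne_push (h : IsFlip R S p q r s) (φ : ℕ → ℕ) :
    SubsetButOne (push φ R) (push φ S) := by
  refine ⟨φ p, φ r, ?_⟩
  rintro _ _ ⟨hne, x, y, hxy, rfl, rfl⟩
  rcases h.left x y hxy with h | ⟨rfl, rfl⟩ | ⟨rfl, rfl⟩
  · exact .inl (push_of h hne)
  · exact .inr (.inl ⟨rfl, rfl⟩)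
  · exact .inr (.inr ⟨rfl, rfl⟩)

theorem near_push (hR : IsTri (Set.Iio n) R) (hS : IsTri (Set.Iio n) S)
    (h : IsFlip R S p q r s) (φ : ℕ → ℕ) : Near (push φ R) (push φ S) :=
  ⟨h.subsetButOne_push φ, (h.symm hR hS).subsetButOne_push φ⟩

/-- A flip does not change the image of a triangulation by a collapse that identifies two
vertices of its quadrilateral. -/
theorem push_eq (hφ : IsCollapse n φ) (hR : IsTri (Set.Iio n) R) (hS : IsTri (Set.Iio n) S)
    (h : IsFlip R S p q r s) (hd : φ p = φ q ∨ φ p = φ r ∨ φ p = φ s ∨ φ q = φ r ∨ φ q = φ s ∨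
      φ r = φ s) : push φ R = push φ S := by
  refine (hφ.isTri_push hR).eq_of_le (hφ.isTri_push hS) ?_
  have hdiag : φ p ≠ φ r → push φ S (φ p) (φ r) := by
    intro hne
    -- If `q` and `s` are merged, the fiber condition merges `p` or `r` with them. So two
    -- consecutive vertices always have the same image, and the image of `pr` is that of a side.
    have hqs : φ q = φ s → φ p = φ q ∨ φ r = φ q := fun he => hφ.fiber h.crosses.swap he
    have h1 := push_of (φ := φ) h.side₁.2
    have h2 := push_of (φ := φ) h.side₂.2
    have h3 := push_of (φ := φ) h.side₃.2
    have h4 := push_of (φ := φ) h.side₄.2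
    have key : φ p = φ q ∨ φ p = φ s ∨ φ r = φ q ∨ φ r = φ s := by omega
    rcases key with he | he | he | he
    · rw [he] at hne ⊢
      exact h2 hne
    · rw [he] at hne ⊢
      exact IsCollapse.push_symm hS (h3 hne.symm)
    · rw [he] at hne ⊢
      exact h1 hne
    · rw [he] at hne ⊢
      exact IsCollapse.push_symm hS (h4 hne.symm)
  rintro _ _ ⟨hne, x, y, hxy, rfl, rfl⟩
  rcases h.left x y hxy with h | ⟨rfl, rfl⟩ | ⟨rfl, rfl⟩
  · exact push_of h hne
  · exact hdiag hne
  · exact IsCollapse.push_symm hS (hdiag hne.symm)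

end IsFlip

/-- There is a path of length at most `l` between two triangulations. -/
inductive Reach (n : ℕ) : ℕ → (ℕ → ℕ → Prop) → (ℕ → ℕ → Prop) → Prop
  | refl (l : ℕ) (R : ℕ → ℕ → Prop) : Reach n l R R
  | step {l : ℕ} {R S S' : ℕ → ℕ → Prop} : Reach n l R S → IsTri (Set.Iio n) S →
      IsTri (Set.Iio n) S' → Near S S' → Reach n (l + 1) R S'

namespace Reach

theorem mono {l l' : ℕ} (h : Reach n l R S) (hl : l ≤ l') : Reach n l' R S := by
  induction h generalizing l' with
  | refl l R => exact .refl _ _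
  | step h hS hS' hn ih =>
    obtain ⟨m, rfl⟩ : ∃ m, l' = m + 1 := ⟨l' - 1, by omega⟩
    exact .step (ih (by omega)) hS hS' hn

theorem trans {l l' : ℕ} {T : ℕ → ℕ → Prop} (h : Reach n l R S) (h' : Reach n l' S T) :
    Reach n (l + l') R T := by
  induction h' with
  | refl l' S => exact h.mono (by omega)
  | step _ hS hS' hn ih => exact .step (ih h) hS hS' hn

theorem of_seq {f : ℕ → ℕ → ℕ → Prop} {i j : ℕ} (hij : i ≤ j)
    (htri : ∀ t, i ≤ t → t ≤ j → IsTri (Set.Iio n) (f t))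
    (hnear : ∀ t, i ≤ t → t < j → Near (f t) (f (t + 1))) : Reach n (j - i) (f i) (f j) := by
  induction j, hij using Nat.le_induction with
  | base => exact .refl _ _
  | succ j hij ih =>
    rw [Nat.succ_sub hij]
    exact .step (ih (fun t h1 h2 => htri t h1 (by omega)) fun t h1 h2 => hnear t h1 (by omega))
      (htri j hij (by omega)) (htri _ (by omega) le_rfl) (hnear j hij (by omega))

end Reach

/-- A monotone map reflects strict inequalities, hence crossings, and a label between two labels of
a fiber is in that fiber. -/
theorem IsCollapse.of_monotone (hm : Monotone φ) (hlt : ∀ x < n, φ x < n)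
    (hid : ∀ x, φ (φ x) = φ x) : IsCollapse n φ where
  lt := hlt
  idem := hid
  crosses {x y z w} h := by
    have key : ∀ {a b}, φ a < φ b → a < b := fun h => hm.reflect_lt h
    rcases h with ⟨h1, h2, h3 | h3⟩ | ⟨h1, h2, h3 | h3⟩ | ⟨h1, h2, h3 | h3⟩ | ⟨h1, h2, h3 | h3⟩ <;>
    · have := key h1
      have := key h2
      have := key h3
      unfold Crosses
      omega
  fiber {x y z w} h he := by
    have key : ∀ {a b}, a < b → φ a ≤ φ b := fun h => hm h.le
    rcases h with ⟨h1, h2, h3⟩ | ⟨h1, h2, h3⟩ | ⟨h1, h2, h3⟩ | ⟨h1, h2, h3⟩ <;>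
    · have := key h1
      have := key h2
      omega

/-- Collapse the vertices between `0` and `b` to `0`. -/
def collapseLow (b x : ℕ) : ℕ := if x < b then 0 else x

/-- Collapse the vertices after `b` to `b`. -/
def collapseHigh (b x : ℕ) : ℕ := if b < x then b else x

/-- Collapse the vertices before `b` or after `c` to `0`. -/
def collapseOut (b c x : ℕ) : ℕ := if x < b ∨ c < x then 0 else x

/-- Collapse the vertices between `b` and `c` to `b`. -/
def collapseIn (b c x : ℕ) : ℕ := if b < x ∧ x < c then b else x

theorem isCollapse_collapseLow (b : ℕ) : IsCollapse n (collapseLow b) := by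
  refine .of_monotone (fun x y h => ?_) (fun x h => ?_) fun x => ?_ <;> unfold collapseLow <;>
    split_ifs <;> omega

theorem isCollapse_collapseHigh (b : ℕ) : IsCollapse n (collapseHigh b) := by
  refine .of_monotone (fun x y h => ?_) (fun x h => ?_) fun x => ?_ <;> unfold collapseHigh <;>
    split_ifs <;> omega

theorem isCollapse_collapseIn (b c : ℕ) : IsCollapse n (collapseIn b c) := by
  refine .of_monotone (fun x y h => ?_) (fun x h => ?_) fun x => ?_ <;> unfold collapseIn <;>
    split_ifs <;> omega

/-- The collapsed run wraps around `0`, so the map need not be monotone and the axioms are checked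
by cases. -/
theorem isCollapse_collapseOut {b c : ℕ} (hb : 0 < b) : IsCollapse n (collapseOut b c) where
  lt x h := by unfold collapseOut; split_ifs <;> omega
  idem x := by unfold collapseOut; split_ifs <;> omega
  crosses {x y z w} h := by
    unfold Crosses collapseOut at h
    unfold Crosses
    split_ifs at h <;> omega
  fiber {x y z w} h he := by
    unfold Crosses at h
    unfold collapseOut at *
    split_ifs at * <;> omega

theorem IsCollapse.mem_image (hφ : IsCollapse n φ) {x : ℕ} :
    x ∈ φ '' Set.Iio n ↔ x < n ∧ φ x = x := by
  constructor
  · rintro ⟨y, hy, rfl⟩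
    exact ⟨hφ.lt _ hy, hφ.idem _⟩
  · rintro ⟨h1, h2⟩
    exact ⟨x, h1, h2⟩

end FlipGraph

/-! ### Retraction onto the triangulations containing an arc, and convexity of geodesics -/

namespace FlipGraph

variable {n : ℕ} {R S : ℕ → ℕ → Prop} {b c : ℕ}

theorem Near.or' {R S : ℕ → ℕ → Prop} (h : Near R S) (Z : ℕ → ℕ → Prop) :
    Near (fun x y => Z x y ∨ R x y) (fun x y => Z x y ∨ S x y) := by
  simpa only [or_comm] using h.or Z

/-- The retraction of the flip-graph on the triangulations that contain the arc `0b`. -/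
def split (b : ℕ) (R : ℕ → ℕ → Prop) (x y : ℕ) : Prop :=
  push (collapseLow b) R x y ∨ push (collapseHigh b) R x y

theorem IsTri.mem_collapseLow (h : IsTri (collapseLow b '' Set.Iio n) R) {x y : ℕ} (hxy : R x y) :
    x < n ∧ (x = 0 ∨ b ≤ x) := by
  obtain ⟨h1, h2⟩ := (isCollapse_collapseLow b).mem_image.1 (h.mem hxy)
  refine ⟨h1, ?_⟩
  unfold collapseLow at h2; split_ifs at h2 <;> omega

theorem IsTri.mem_collapseHigh (h : IsTri (collapseHigh b '' Set.Iio n) R) {x y : ℕ}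
    (hxy : R x y) : x < n ∧ x ≤ b := by
  obtain ⟨h1, h2⟩ := (isCollapse_collapseHigh b).mem_image.1 (h.mem hxy)
  refine ⟨h1, ?_⟩
  unfold collapseHigh at h2; split_ifs at h2 <;> omega

theorem IsTri.mem_collapseOut (h : IsTri (collapseOut b c '' Set.Iio n) R) {x y : ℕ}
    (hxy : R x y) : x < n ∧ (x = 0 ∨ (b ≤ x ∧ x ≤ c)) := by
  by_cases hb : 0 < b
  · obtain ⟨h1, h2⟩ := (isCollapse_collapseOut hb).mem_image.1 (h.mem hxy)
    refine ⟨h1, ?_⟩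
    unfold collapseOut at h2; split_ifs at h2 <;> omega
  · obtain ⟨z, hz, he⟩ := h.mem hxy
    simp only [Set.mem_Iio] at hz
    unfold collapseOut at he; split_ifs at he <;> omega

theorem IsTri.mem_collapseIn (h : IsTri (collapseIn b c '' Set.Iio n) R) {x y : ℕ}
    (hxy : R x y) : x < n ∧ (x ≤ b ∨ c ≤ x) := by
  obtain ⟨h1, h2⟩ := (isCollapse_collapseIn b c).mem_image.1 (h.mem hxy)
  refine ⟨h1, ?_⟩
  unfold collapseIn at h2; split_ifs at h2 <;> omega

theorem collapseLow_mem {x : ℕ} (hx : x < n) (h : x = 0 ∨ b ≤ x) :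
    x ∈ collapseLow b '' Set.Iio n :=
  ⟨x, hx, by unfold collapseLow; split_ifs <;> omega⟩

theorem collapseHigh_mem {x : ℕ} (hx : x < n) (h : x ≤ b) : x ∈ collapseHigh b '' Set.Iio n :=
  ⟨x, hx, by unfold collapseHigh; split_ifs <;> omega⟩

theorem collapseOut_mem {x : ℕ} (hx : x < n) (h : x = 0 ∨ (b ≤ x ∧ x ≤ c)) :
    x ∈ collapseOut b c '' Set.Iio n :=
  ⟨x, hx, by unfold collapseOut; split_ifs <;> omega⟩

theorem collapseIn_mem {x : ℕ} (hx : x < n) (h : x ≤ b ∨ c ≤ x) :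
    x ∈ collapseIn b c '' Set.Iio n :=
  ⟨x, hx, by unfold collapseIn; split_ifs <;> omega⟩

section Split

variable {X Y : ℕ → ℕ → Prop}

/-- The chord `0b` is an edge of the collapsed polygon. -/
theorem IsTri.low_arc (h : IsTri (collapseLow b '' Set.Iio n) R) (hb : 0 < b) (hn : b < n) :
    R 0 b := by
  refine h.maximal (collapseLow_mem (by omega) (.inl rfl)) (collapseLow_mem hn (.inr le_rfl))
    hb.ne fun z w hzw hc => ?_
  have h1 := h.mem_collapseLow hzw
  have h2 := h.mem_collapseLow (h.symm hzw)
  unfold Crosses at hc; omega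

theorem IsTri.glue_split (hX : IsTri (collapseLow b '' Set.Iio n) X)
    (hY : IsTri (collapseHigh b '' Set.Iio n) Y) (hb : 0 < b) (hn : b < n) :
    IsTri (Set.Iio n) (fun x y => X x y ∨ Y x y) where
  symm h := h.imp hX.symm hY.symm
  ne h := h.elim hX.ne hY.ne
  mem h := h.elim (fun h => (hX.mem_collapseLow h).1) (fun h => (hY.mem_collapseHigh h).1)
  noncross {x y z w} h h' hc := by
    have key : ∀ {x y z w}, X x y → Y z w → ¬Crosses x y z w := by
      intro x y z w h h' hc
      have h1 := hX.mem_collapseLow h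
      have h2 := hX.mem_collapseLow (hX.symm h)
      have h3 := hY.mem_collapseHigh h'
      have h4 := hY.mem_collapseHigh (hY.symm h')
      unfold Crosses at hc; omega
    rcases h with h | h <;> rcases h' with h' | h'
    · exact hX.noncross h h' hc
    · exact key h h' hc
    · exact key h' h hc.swap
    · exact hY.noncross h h' hc
  maximal {x y} hx hy hne h := by
    have h0 := h _ _ (.inl (hX.low_arc hb hn))
    simp only [Set.mem_Iio] at hx hy
    have : ((x = 0 ∨ b ≤ x) ∧ (y = 0 ∨ b ≤ y)) ∨ (x ≤ b ∧ y ≤ b) := by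
      unfold Crosses at h0; omega
    rcases this with ⟨h1, h2⟩ | ⟨h1, h2⟩
    · exact .inl (hX.maximal (collapseLow_mem hx h1) (collapseLow_mem hy h2) hne
        fun z w hzw => h z w (.inl hzw))
    · exact .inr (hY.maximal (collapseHigh_mem hx h1) (collapseHigh_mem hy h2) hne
        fun z w hzw => h z w (.inr hzw))

end Split

theorem IsTri.isTri_split (h : IsTri (Set.Iio n) R) (hb : 0 < b) (hn : b < n) :
    IsTri (Set.Iio n) (split b R) :=
  ((isCollapse_collapseLow b).isTri_push h).glue_split ((isCollapse_collapseHigh b).isTri_push h)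
    hb hn

/-- The arcs of `R` that do not cross `0b` are arcs of `split b R`. -/
theorem split_of_not_crosses (h : IsTri (Set.Iio n) R) {x y : ℕ} (hxy : R x y)
    (hc : ¬Crosses 0 b x y) : split b R x y := by
  have hne := h.ne hxy
  have : ((x = 0 ∨ b ≤ x) ∧ (y = 0 ∨ b ≤ y)) ∨ (x ≤ b ∧ y ≤ b) := by
    unfold Crosses at hc; omega
  rcases this with ⟨h1, h2⟩ | ⟨h1, h2⟩
  · refine .inl ⟨hne, x, y, hxy, ?_, ?_⟩ <;> unfold collapseLow <;> split_ifs <;> omega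
  · refine .inr ⟨hne, x, y, hxy, ?_, ?_⟩ <;> unfold collapseHigh <;> split_ifs <;> omega

theorem split_eq_self (h : IsTri (Set.Iio n) R) (hb : 0 < b) (h0 : R 0 b) : split b R = R :=
  (h.eq_of_le (h.isTri_split hb (h.mem' h0)) fun _ _ hxy =>
    split_of_not_crosses h hxy (h.noncross h0 hxy)).symm

/-- All the arcs of `R` other than `0b` are in `S` and do not cross `0b`, so the retraction keeps
them and adds `0b`: it undoes the flip. -/
theorem split_eq_of_remove (hR : IsTri (Set.Iio n) R) (hS : IsTri (Set.Iio n) S) (hb : 0 < b)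
    {p q r s : ℕ} (hf : IsFlip R S p q r s) (h0 : R 0 b) (h0' : ¬S 0 b) : split b S = R := by
  have hn : b < n := hR.mem' h0
  refine (hR.eq_of_le (hS.isTri_split hb hn) fun x y hxy => ?_).symm
  have hpr : (p = 0 ∧ r = b) ∨ (p = b ∧ r = 0) := by
    have := hf.left 0 b h0; tauto
  have hsplit := (hS.isTri_split hb hn)
  have h1 : split b S 0 b := .inl (((isCollapse_collapseLow b).isTri_push hS).low_arc hb hn)
  rcases hf.left x y hxy with h | ⟨rfl, rfl⟩ | ⟨rfl, rfl⟩
  · exact split_of_not_crosses hS h (hR.noncross h0 hxy)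
  · rcases hpr with ⟨rfl, rfl⟩ | ⟨rfl, rfl⟩
    · exact h1
    · exact hsplit.symm h1
  · rcases hpr with ⟨rfl, rfl⟩ | ⟨rfl, rfl⟩
    · exact hsplit.symm h1
    · exact h1

/-- If neither image were constant, both collapses would be injective on the quadrilateral, which
would have at most one vertex below `b` and at most one vertex at or above `b`. -/
theorem near_split (hR : IsTri (Set.Iio n) R) (hS : IsTri (Set.Iio n) S)
    {p q r s : ℕ} (hf : IsFlip R S p q r s) : Near (split b R) (split b S) := by
  have key : push (collapseLow b) R = push (collapseLow b) S ∨
      push (collapseHigh b) R = push (collapseHigh b) S := by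
    by_contra! hcon
    have h1 := mt (hf.push_eq (isCollapse_collapseLow b) hR hS) hcon.1
    have h2 := mt (hf.push_eq (isCollapse_collapseHigh b) hR hS) hcon.2
    unfold collapseLow at h1
    unfold collapseHigh at h2
    split_ifs at h1 h2 <;> omega
  unfold split
  rcases key with h | h
  · rw [h]; exact (hf.near_push hR hS _).or' _
  · rw [h]; exact (hf.near_push hR hS _).or _

/-- A geodesic path in the flip-graph of a convex polygon with `n` vertices. -/
structure IsGeo (n k : ℕ) (R : ℕ → ℕ → ℕ → Prop) : Prop where
  tri : ∀ t ≤ k, IsTri (Set.Iio n) (R t)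
  flip : ∀ t < k, ∃ p q r s, IsFlip (R t) (R (t + 1)) p q r s
  le : ∀ i j l, i ≤ j → j ≤ k → Reach n l (R i) (R j) → j ≤ i + l

theorem exists_last {Q : ℕ → Prop} {i m : ℕ} (him : i ≤ m) (hi : Q i) (hm : ¬Q m) :
    ∃ t, i ≤ t ∧ t < m ∧ Q t ∧ ¬Q (t + 1) := by
  induction m, him using Nat.le_induction with
  | base => exact absurd hi hm
  | succ m him ih =>
    by_cases h : Q m
    · exact ⟨m, him, Nat.lt_succ_self m, h, hm⟩
    · obtain ⟨t, h1, h2, h3⟩ := ih h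
      exact ⟨t, h1, by omega, h3⟩

namespace IsGeo

variable {k : ℕ} {R : ℕ → ℕ → ℕ → Prop}

/-- The retracted path is stationary at the last flip before `m` that removes `0b`, which saves one
step. -/
theorem reach_split (h : IsGeo n k R) {i m j : ℕ} (him : i ≤ m) (hmj : m ≤ j) (hj : j ≤ k)
    (hb : 0 < b) (hi : R i 0 b) (hm : ¬R m 0 b) : Reach n (j - i - 1) (R i) (split b (R j)) := by
  obtain ⟨t, hit, htm, ht, ht'⟩ := exists_last (Q := fun t => R t 0 b) him hi hm
  have hn : b < n := (h.tri i (by omega)).mem' hi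
  have htri : ∀ t ≤ k, IsTri (Set.Iio n) (split b (R t)) := fun t ht =>
    (h.tri t ht).isTri_split hb hn
  have hnear : ∀ t < k, Near (split b (R t)) (split b (R (t + 1))) := fun t ht => by
    obtain ⟨p, q, r, s, hf⟩ := h.flip t ht
    exact near_split (h.tri t (by omega)) (h.tri (t + 1) (by omega)) hf
  have h1 := Reach.of_seq (n := n) (f := fun t => split b (R t)) hit
    (fun s _ hs => htri s (by omega)) fun s _ hs => hnear s (by omega)
  have h2 := Reach.of_seq (n := n) (f := fun t => split b (R t)) (i := t + 1) (j := j) (by omega)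
    (fun s _ hs => htri s (by omega)) fun s _ hs => hnear s (by omega)
  obtain ⟨p, q, r, s, hf⟩ := h.flip t (by omega)
  have he := split_eq_of_remove (h.tri t (by omega)) (h.tri (t + 1) (by omega)) hb hf ht ht'
  have he' := split_eq_self (h.tri t (by omega)) hb ht
  have he'' := split_eq_self (h.tri i (by omega)) hb hi
  simp only [he, he', he''] at h1 h2
  exact (h1.trans h2).mono (by omega)

/-- An arc common to two triangulations of a geodesic path belongs to all the triangulations in
between. -/
theorem convex (h : IsGeo n k R) {i m j : ℕ} (him : i ≤ m) (hmj : m ≤ j) (hj : j ≤ k)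
    (hb : 0 < b) (hi : R i 0 b) (hj' : R j 0 b) : R m 0 b := by
  by_contra hm
  have h1 := h.reach_split him hmj hj hb hi hm
  rw [split_eq_self (h.tri j hj) hb hj'] at h1
  have := h.le i j _ (him.trans hmj) hj h1
  have : m ≠ i := by rintro rfl; exact hm hi
  omega

end IsGeo

/-! ### Gluing along the triangle `0bc`, and fans crossing `bc` -/

section Glue

variable {X Y : ℕ → ℕ → Prop}

theorem IsTri.out_arc_left (h : IsTri (collapseOut b c '' Set.Iio n) R) (hb : 0 < b) (hbc : b < c)
    (hn : c < n) : R 0 b := by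
  refine h.maximal (collapseOut_mem (by omega) (.inl rfl)) (collapseOut_mem (by omega) (by omega))
    hb.ne fun z w hzw hcr => ?_
  have h1 := h.mem_collapseOut hzw
  have h2 := h.mem_collapseOut (h.symm hzw)
  unfold Crosses at hcr; omega

theorem IsTri.out_arc_right (h : IsTri (collapseOut b c '' Set.Iio n) R) (hb : 0 < b) (hbc : b < c)
    (hn : c < n) : R 0 c := by
  refine h.maximal (collapseOut_mem (by omega) (.inl rfl)) (collapseOut_mem (by omega) (by omega))
    (by omega) fun z w hzw hcr => ?_
  have h1 := h.mem_collapseOut hzw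
  have h2 := h.mem_collapseOut (h.symm hzw)
  unfold Crosses at hcr; omega

theorem IsTri.in_arc (h : IsTri (collapseIn b c '' Set.Iio n) R) (hbc : b < c)
    (hn : c < n) : R b c := by
  refine h.maximal (collapseIn_mem (by omega) (by omega)) (collapseIn_mem (by omega) (by omega))
    hbc.ne fun z w hzw hcr => ?_
  have h1 := h.mem_collapseIn hzw
  have h2 := h.mem_collapseIn (h.symm hzw)
  unfold Crosses at hcr; omega

/-- The triangulation that coincides with `X` in the polygon with vertices `0, b, …, c` and
with `Y` outside of this polygon. -/
def glueIn (b c : ℕ) (X Y : ℕ → ℕ → Prop) (x y : ℕ) : Prop :=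
  X x y ∨ (Y x y ∧ ¬(x = b ∧ y = c) ∧ ¬(x = c ∧ y = b))

/-- The triangulation that coincides with `X` in the polygon with vertices `b, …, c` and
with `Y` outside of this polygon. -/
def glueOut (b c : ℕ) (X Y : ℕ → ℕ → Prop) (x y : ℕ) : Prop :=
  Y x y ∨ (X x y ∧ (b ≤ x ∧ x ≤ c) ∧ b ≤ y ∧ y ≤ c)

/-- The edges of the triangle `0bc` separate the polygon of `Y`, of which `bc` is an edge. -/
theorem IsTri.sides_of_triangle (hY : IsTri (collapseIn b c '' Set.Iio n) Y) (hYb : Y 0 b)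
    (hYc : Y 0 c) {x y : ℕ} (hxy : Y x y) : (x ≤ b ∧ y ≤ b) ∨
      ((x = 0 ∨ c ≤ x) ∧ (y = 0 ∨ c ≤ y)) ∨ (x = b ∧ y = c) ∨ (x = c ∧ y = b) := by
  have h1 := hY.mem_collapseIn hxy
  have h2 := hY.mem_collapseIn (hY.symm hxy)
  have h3 := hY.noncross hYb hxy
  have h4 := hY.noncross hYc hxy
  unfold Crosses at h3 h4; omega

/-- The arc `bc` of `Y` is dropped because arcs of `X` from `0` may cross it. The remaining arcs of
`Y` lie outside the polygon `0, b, …, c`, since `Y` contains `0b` and `0c`. -/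
theorem IsTri.glueIn (hX : IsTri (collapseOut b c '' Set.Iio n) X)
    (hY : IsTri (collapseIn b c '' Set.Iio n) Y) (hb : 0 < b) (hbc : b < c) (hn : c < n)
    (hYb : Y 0 b) (hYc : Y 0 c) : IsTri (Set.Iio n) (glueIn b c X Y) where
  symm h := h.imp hX.symm fun h => ⟨hY.symm h.1, by tauto, by tauto⟩
  ne h := h.elim hX.ne fun h => hY.ne h.1
  mem h := h.elim (fun h => (hX.mem_collapseOut h).1) (fun h => (hY.mem_collapseIn h.1).1)
  noncross {x y z w} h h' hcr := by
    have key : ∀ {x y z w}, X x y → Y z w → ¬(z = b ∧ w = c) → ¬(z = c ∧ w = b) →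
        ¬Crosses x y z w := by
      intro x y z w h h' hn1 hn2 hcr
      have h1 := hX.mem_collapseOut h
      have h2 := hX.mem_collapseOut (hX.symm h)
      have h3 := hY.sides_of_triangle hYb hYc h'
      unfold Crosses at hcr; omega
    rcases h with h | h <;> rcases h' with h' | h'
    · exact hX.noncross h h' hcr
    · exact key h h'.1 h'.2.1 h'.2.2 hcr
    · exact key h' h.1 h.2.1 h.2.2 hcr.swap
    · exact hY.noncross h.1 h'.1 hcr
  maximal {x y} hx hy hne h := by
    have h1 := h _ _ (.inl (hX.out_arc_left hb hbc hn))
    have h2 := h _ _ (.inl (hX.out_arc_right hb hbc hn))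
    simp only [Set.mem_Iio] at hx hy
    by_cases hin : (x = 0 ∨ (b ≤ x ∧ x ≤ c)) ∧ (y = 0 ∨ (b ≤ y ∧ y ≤ c))
    · exact .inl (hX.maximal (collapseOut_mem hx hin.1) (collapseOut_mem hy hin.2) hne
        fun z w hzw => h z w (.inl hzw))
    · have h3 : (x ≤ b ∧ y ≤ b) ∨ ((x = 0 ∨ c ≤ x) ∧ (y = 0 ∨ c ≤ y)) := by
        unfold Crosses at h1 h2; omega
      refine .inr ⟨hY.maximal (collapseIn_mem hx (by omega)) (collapseIn_mem hy (by omega)) hne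
        fun z w hzw hcr => ?_, by omega, by omega⟩
      by_cases hzw' : (z = b ∧ w = c) ∨ (z = c ∧ w = b)
      · unfold Crosses at hcr; omega
      · exact h z w (.inr ⟨hzw, by tauto, by tauto⟩) hcr

/-- Both pieces contain `bc`, which separates their polygons once the arcs of `X` at `0` are
discarded. -/
theorem IsTri.glueOut (hX : IsTri (collapseOut b c '' Set.Iio n) X)
    (hY : IsTri (collapseIn b c '' Set.Iio n) Y) (hb : 0 < b) (hbc : b < c) (hn : c < n)
    (hXbc : X b c) : IsTri (Set.Iio n) (glueOut b c X Y) where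
  symm h := h.imp hY.symm fun h => ⟨hX.symm h.1, h.2.2, h.2.1⟩
  ne h := h.elim hY.ne fun h => hX.ne h.1
  mem h := h.elim (fun h => (hY.mem_collapseIn h).1) (fun h => (hX.mem_collapseOut h.1).1)
  noncross {x y z w} h h' hcr := by
    have key : ∀ {x y z w}, Y x y → (b ≤ z ∧ z ≤ c) ∧ b ≤ w ∧ w ≤ c → ¬Crosses x y z w := by
      intro x y z w h h' hcr
      have h1 := hY.mem_collapseIn h
      have h2 := hY.mem_collapseIn (hY.symm h)
      unfold Crosses at hcr; omega
    rcases h with h | h <;> rcases h' with h' | h'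
    · exact hY.noncross h h' hcr
    · exact key h h'.2 hcr
    · exact key h' h.2 hcr.swap
    · exact hX.noncross h.1 h'.1 hcr
  maximal {x y} hx hy hne h := by
    have h1 := h _ _ (.inl (hY.in_arc hbc hn))
    simp only [Set.mem_Iio] at hx hy
    by_cases hin : (x ≤ b ∨ c ≤ x) ∧ (y ≤ b ∨ c ≤ y)
    · exact .inl (hY.maximal (collapseIn_mem hx hin.1) (collapseIn_mem hy hin.2) hne
        fun z w hzw => h z w (.inl hzw))
    · have h3 : (b ≤ x ∧ x ≤ c) ∧ b ≤ y ∧ y ≤ c := by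
        unfold Crosses at h1; omega
      refine .inr ⟨hX.maximal (collapseOut_mem hx (by omega)) (collapseOut_mem hy (by omega)) hne
        fun z w hzw hcr => ?_, h3⟩
      have h4 := hX.mem_collapseOut hzw
      have h5 := hX.mem_collapseOut (hX.symm hzw)
      have h6 := hX.noncross hXbc hzw
      exact h z w (.inr ⟨hzw, by unfold Crosses at hcr h6; omega⟩) hcr

end Glue

theorem glueIn_eq_glueOut {X Y : ℕ → ℕ → Prop} (hX : IsTri (collapseOut b c '' Set.Iio n) X)
    (hY : IsTri (collapseIn b c '' Set.Iio n) Y) (hb : 0 < b) (hbc : b < c) (hn : c < n)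
    (hYb : Y 0 b) (hYc : Y 0 c) (hXbc : X b c) : glueIn b c X Y = glueOut b c X Y := by
  refine ((hX.glueOut hY hb hbc hn hXbc).eq_of_le (hX.glueIn hY hb hbc hn hYb hYc) ?_).symm
  rintro x y (h | h)
  · by_cases h' : (x = b ∧ y = c) ∨ (x = c ∧ y = b)
    · rcases h' with ⟨rfl, rfl⟩ | ⟨rfl, rfl⟩
      · exact .inl hXbc
      · exact .inl (hX.symm hXbc)
    · exact .inr ⟨h, by tauto, by tauto⟩
  · exact .inl h.1

/-- If `S` contains `bc`, it is obtained by gluing its images by the two collapses along `bc`. -/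
theorem glueOut_push (hS : IsTri (Set.Iio n) S) (hb : 0 < b) (hbc : b < c) (h : S b c) :
    glueOut b c (push (collapseOut b c) S) (push (collapseIn b c) S) = S := by
  have hn : c < n := hS.mem' h
  have hX := (isCollapse_collapseOut (n := n) (b := b) (c := c) hb).isTri_push hS
  have hY := (isCollapse_collapseIn (n := n) b c).isTri_push hS
  have hXbc : push (collapseOut b c) S b c := by
    refine ⟨hbc.ne, b, c, h, ?_, ?_⟩ <;> unfold collapseOut <;> split_ifs <;> omega
  refine (hS.eq_of_le (hX.glueOut hY hb hbc hn hXbc) fun x y hxy => ?_).symm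
  have h1 := hS.noncross h hxy
  have hne := hS.ne hxy
  by_cases hin : (x ≤ b ∨ c ≤ x) ∧ (y ≤ b ∨ c ≤ y)
  · refine .inl ⟨hne, x, y, hxy, ?_, ?_⟩ <;> unfold collapseIn <;> split_ifs <;> omega
  · have h3 : (b ≤ x ∧ x ≤ c) ∧ b ≤ y ∧ y ≤ c := by
      unfold Crosses at h1; omega
    refine .inr ⟨⟨hne, x, y, hxy, ?_, ?_⟩, h3⟩ <;> unfold collapseOut <;> split_ifs <;> omega

theorem push_collapseIn_left {x : ℕ} (hb : 0 < b) (hbx : b ≤ x) (hxc : x < c) (h : R 0 x) :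
    push (collapseIn b c) R 0 b := by
  refine ⟨hb.ne, 0, x, h, ?_, ?_⟩ <;> unfold collapseIn <;> split_ifs <;> omega

theorem push_collapseIn_right (hc : 0 < c) (h : R 0 c) : push (collapseIn b c) R 0 c := by
  refine ⟨hc.ne, 0, c, h, ?_, ?_⟩ <;> unfold collapseIn <;> split_ifs <;> omega

/-- If `R` contains `0c` and an arc from `0` that crosses `bc`, then its retraction on the
triangulations that contain `0b` is obtained by gluing. -/
theorem glueIn_push (hR : IsTri (Set.Iio n) R) (hb : 0 < b) (hbc : b < c) (h : R 0 c) {x : ℕ}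
    (hbx : b < x) (hxc : x < c) (hx : R 0 x) :
    glueIn b c (push (collapseOut b c) R) (push (collapseIn b c) R) = split b R := by
  have hn : c < n := hR.mem' h
  have hX := (isCollapse_collapseOut (n := n) (b := b) (c := c) hb).isTri_push hR
  have hY := (isCollapse_collapseIn (n := n) b c).isTri_push hR
  have hYb := push_collapseIn_left hb hbx.le hxc hx
  have hYc := push_collapseIn_right (b := b) (by omega) h
  have hG := hX.glueIn hY hb hbc hn hYb hYc
  refine ((hR.isTri_split hb (by omega)).eq_of_le hG fun u v huv => ?_).symm
  have hXb := hX.out_arc_left hb hbc hn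
  -- On labels up to `c`, `collapseLow b` agrees with `collapseOut b c`. An arc reaching beyond `c`
  -- cannot cross `0c`; its other end is `0` or at least `c`, where `collapseLow b` agrees with
  -- `collapseIn b c`.
  have keyLow : ∀ z w, R z w → z < w → collapseLow b z ≠ collapseLow b w →
      glueIn b c (push (collapseOut b c) R) (push (collapseIn b c) R)
        (collapseLow b z) (collapseLow b w) := by
    intro z w hzw hlt hne
    have h1 := hR.noncross h hzw
    have h2 := hR.noncross hx hzw
    by_cases hwc : w ≤ c
    · have := push_of (φ := collapseOut b c) hzw
      have e1 : collapseOut b c z = collapseLow b z := by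
        unfold collapseOut collapseLow; split_ifs <;> omega
      have e2 : collapseOut b c w = collapseLow b w := by
        unfold collapseOut collapseLow; split_ifs <;> omega
      rw [e1, e2] at this
      exact .inl (this hne)
    · have h3 : z = 0 ∨ c ≤ z := by unfold Crosses at h1; omega
      have := push_of (φ := collapseIn b c) hzw
      have e1 : collapseIn b c z = collapseLow b z := by
        unfold collapseIn collapseLow; split_ifs <;> omega
      have e2 : collapseIn b c w = collapseLow b w := by
        unfold collapseIn collapseLow; split_ifs <;> omega
      have e3 : collapseLow b w = w := by
        unfold collapseLow; split_ifs <;> omega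
      have e4 : collapseLow b z ≠ b := by unfold collapseLow; split_ifs <;> omega
      rw [e1, e2] at this
      exact .inr ⟨this hne, by omega, by omega⟩
  have keyHigh : ∀ z w, R z w → z < w → collapseHigh b z ≠ collapseHigh b w →
      glueIn b c (push (collapseOut b c) R) (push (collapseIn b c) R)
        (collapseHigh b z) (collapseHigh b w) := by
    intro z w hzw hlt hne
    have h1 := hR.noncross h hzw
    have h2 := hR.noncross hx hzw
    have hzb : z < b := by
      by_contra hcon
      apply hne
      unfold collapseHigh; split_ifs <;> omega
    have e1 : collapseHigh b z = z := by unfold collapseHigh; split_ifs <;> omega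
    by_cases hwc : w < c
    · have := push_of (φ := collapseIn b c) hzw
      have e1 : collapseIn b c z = collapseHigh b z := by
        unfold collapseIn collapseHigh; split_ifs <;> omega
      have e2 : collapseIn b c w = collapseHigh b w := by
        unfold collapseIn collapseHigh; split_ifs <;> omega
      rw [e1, e2] at this
      exact .inr ⟨this hne, by omega, by omega⟩
    -- An arc from below `b` to `c` or beyond must start at `0` to avoid crossing `0x`, so it
    -- collapses to `0b`.
    · have h3 : z = 0 := by unfold Crosses at h2; omega
      have e2 : collapseHigh b w = b := by unfold collapseHigh; split_ifs <;> omega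
      rw [e1, e2, h3]
      exact .inl hXb
  rcases huv with ⟨hne, z, w, hzw, rfl, rfl⟩ | ⟨hne, z, w, hzw, rfl, rfl⟩
  · rcases lt_or_gt_of_ne (hR.ne hzw) with hlt | hlt
    · exact keyLow z w hzw hlt hne
    · exact hG.symm (keyLow w z (hR.symm hzw) hlt hne.symm)
  · rcases lt_or_gt_of_ne (hR.ne hzw) with hlt | hlt
    · exact keyHigh z w hzw hlt hne
    · exact hG.symm (keyHigh w z (hR.symm hzw) hlt hne.symm)

/-- A quadrilateral that survives `collapseOut` has three vertices in `[b, c]`, hence two in `[b,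
c)`, and these are merged by `collapseIn`. -/
theorem push_out_eq_or_push_in_eq (hb : 0 < b) (hR : IsTri (Set.Iio n) R)
    (hS : IsTri (Set.Iio n) S) {p q r s : ℕ} (hf : IsFlip R S p q r s) :
    push (collapseOut b c) R = push (collapseOut b c) S ∨
      push (collapseIn b c) R = push (collapseIn b c) S := by
  by_contra! hcon
  have h1 := mt (hf.push_eq (isCollapse_collapseOut hb) hR hS) hcon.1
  have h2 := mt (hf.push_eq (isCollapse_collapseIn b c) hR hS) hcon.2
  unfold collapseOut at h1
  unfold collapseIn at h2
  split_ifs at h1 h2 <;> omega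

namespace IsGeo

variable {k : ℕ} {R : ℕ → ℕ → ℕ → Prop}

/-- Each flip is charged to the only one of the two collapsed sequences that it can change; the
other half of each gluing is the fixed `X` or `Y`. -/
theorem reach_glue (h : IsGeo n k R) (hb : 0 < b) (hbc : b < c) (hn : c < n) {X Y : ℕ → ℕ → Prop}
    (hX : IsTri (collapseOut b c '' Set.Iio n) X) (hY : IsTri (collapseIn b c '' Set.Iio n) Y)
    (hYb : Y 0 b) (hYc : Y 0 c) (hXbc : X b c) {i j : ℕ} (hij : i ≤ j) (hj : j ≤ k) :
    ∃ q l, q + l ≤ j - i ∧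
      Reach n q (glueIn b c (push (collapseOut b c) (R i)) Y)
        (glueIn b c (push (collapseOut b c) (R j)) Y) ∧
      Reach n l (glueOut b c X (push (collapseIn b c) (R i)))
        (glueOut b c X (push (collapseIn b c) (R j))) := by
  induction j, hij using Nat.le_induction with
  | base => exact ⟨0, 0, by omega, .refl _ _, .refl _ _⟩
  | succ j hij ih =>
    obtain ⟨q, l, hql, hq, hl⟩ := ih (by omega)
    obtain ⟨p', q', r', s', hf⟩ := h.flip j (by omega)
    have h1 := h.tri j (by omega)
    have h2 := h.tri (j + 1) (by omega)
    rcases push_out_eq_or_push_in_eq (c := c) hb h1 h2 hf with he | he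
    · refine ⟨q, l + 1, by omega, he ▸ hq, .step hl ?_ ?_ ?_⟩
      · exact hX.glueOut ((isCollapse_collapseIn b c).isTri_push h1) hb hbc hn hXbc
      · exact hX.glueOut ((isCollapse_collapseIn b c).isTri_push h2) hb hbc hn hXbc
      · exact (hf.near_push h1 h2 _).or _
    · refine ⟨q + 1, l, by omega, .step hq ?_ ?_ ?_, he ▸ hl⟩
      · exact ((isCollapse_collapseOut hb).isTri_push h1).glueIn hY hb hbc hn hYb hYc
      · exact ((isCollapse_collapseOut hb).isTri_push h2).glueIn hY hb hbc hn hYb hYc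
      · exact (hf.near_push h1 h2 _).or _

/-- Take `X` from time `j` and `Y` from time `i`. The first glued path then starts at `split b (R
i)` and ends where the second starts, because the two gluings of `X` and `Y` coincide; the second
ends at `R j`. -/
theorem reach_of_fan (h : IsGeo n k R) (hb : 0 < b) (hbc : b < c) {x i j : ℕ} (hij : i ≤ j)
    (hj : j ≤ k) (hc : R i 0 c) (hx : R i 0 x) (hbx : b < x) (hxc : x < c) (hj' : R j b c) :
    Reach n (j - i) (split b (R i)) (R j) := by
  have hi := h.tri i (by omega)
  have hn : c < n := hi.mem' hc
  have hX := (isCollapse_collapseOut (n := n) (b := b) (c := c) hb).isTri_push (h.tri j hj)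
  have hY := (isCollapse_collapseIn (n := n) b c).isTri_push hi
  have hYb := push_collapseIn_left hb hbx.le hxc hx
  have hYc := push_collapseIn_right (b := b) (by omega) hc
  have hXbc : push (collapseOut b c) (R j) b c := by
    refine ⟨hbc.ne, b, c, hj', ?_, ?_⟩ <;> unfold collapseOut <;> split_ifs <;> omega
  obtain ⟨q, l, hql, hq, hl⟩ := h.reach_glue hb hbc hn hX hY hYb hYc hXbc hij hj
  rw [glueIn_push hi hb hbc hc hbx hxc hx, glueIn_eq_glueOut hX hY hb hbc hn hYb hYc hXbc] at hq
  rw [glueOut_push (h.tri j hj) hb hbc hj'] at hl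
  exact (hq.trans hl).mono hql

/-- If a triangulation in a geodesic path contains `0c` and an arc from `0` that crosses `bc`, then
it contains `0b` when a triangulation before it contains `0b` and one after it contains `bc`. -/
theorem left_of_fan (h : IsGeo n k R) (hb : 0 < b) (hbc : b < c) {x m i j : ℕ} (hmi : m ≤ i)
    (hij : i ≤ j) (hj : j ≤ k) (hm : R m 0 b) (hc : R i 0 c) (hx : R i 0 x) (hbx : b < x)
    (hxc : x < c) (hj' : R j b c) : R i 0 b := by
  by_contra hno
  -- Going through `split b (R i)` reaches `R j` from `R m` in fewer than `j - m` steps.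
  have h1 := h.reach_split hmi le_rfl (by omega) hb hm hno
  have h2 := h.reach_of_fan hb hbc hij hj hc hx hbx hxc hj'
  have := h.le m j _ (by omega) hj (h1.trans h2)
  have : m ≠ i := by rintro rfl; exact hno hm
  omega

/-- If a triangulation in a geodesic path contains `0b`, `0c` and an arc from `0` that crosses `bc`,
then a flip that removes `0b` is not followed by a triangulation that contains `bc`. -/
theorem left_succ_of_fan (h : IsGeo n k R) (hb : 0 < b) (hbc : b < c) {x i j : ℕ} (hij : i < j)
    (hj : j ≤ k) (hb' : R i 0 b) (hc : R i 0 c) (hx : R i 0 x) (hbx : b < x) (hxc : x < c)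
    (hj' : R j b c) : R (i + 1) 0 b := by
  by_contra hno
  have hi := h.tri i (by omega)
  have hi' := h.tri (i + 1) (by omega)
  obtain ⟨p, q, r, s, hf⟩ := h.flip i (by omega)
  have hpr : (p = 0 ∧ r = b) ∨ (p = b ∧ r = 0) := by
    have := hf.left 0 b hb'; tauto
  have hc' : R (i + 1) 0 c := by
    rcases hf.left 0 c hc with h | h | h
    · exact h
    · omega
    · omega
  have hx' : R (i + 1) 0 x := by
    rcases hf.left 0 x hx with h | h | h
    · exact h
    · omega
    · omega
  have hn : c < n := hi.mem' hc
  have hX := (isCollapse_collapseOut (n := n) (b := b) (c := c) hb).isTri_push hi'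
  have hY := (isCollapse_collapseIn (n := n) b c).isTri_push hi'
  have hYb := push_collapseIn_left hb hbx.le hxc hx'
  have hYc := push_collapseIn_right (b := b) (by omega) hc'
  -- The retraction sends `R (i + 1)` back to `R i`, so `R j` would be at distance at most `j - i -
  -- 1` from `R i`.
  have he : split b (R (i + 1)) = split b (R i) := by
    rw [split_eq_of_remove hi hi' hb hf hb' hno, split_eq_self hi hb hb']
  have h1 := h.reach_of_fan hb hbc (i := i + 1) hij hj hc' hx' hbx hxc hj'
  rw [he, split_eq_self hi hb hb'] at h1
  have := h.le i j _ (by omega) hj h1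
  omega

end IsGeo
end FlipGraph

/-! ### Signed areas and convex hulls in the plane -/

namespace FlipGraph

/-- Twice the signed area of the triangle `pqr`, multiplied by `ε`. -/
def area (ε : ℝ) (p q r : Plane) : ℝ :=
  ε * ((q 0 - p 0) * (r 1 - p 1) - (q 1 - p 1) * (r 0 - p 0))

theorem area_rotate (ε : ℝ) (p q r : Plane) : area ε q r p = area ε p q r := by
  unfold area; ring

theorem area_swap (ε : ℝ) (p q r : Plane) : area ε p r q = -area ε p q r := by
  unfold area; ring

theorem area_swap' (ε : ℝ) (p q r : Plane) : area ε q p r = -area ε p q r := by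
  unfold area; ring

@[simp] theorem area_self_left (ε : ℝ) (p q : Plane) : area ε p q p = 0 := by
  unfold area; ring

@[simp] theorem area_self_right (ε : ℝ) (p q : Plane) : area ε p q q = 0 := by
  unfold area; ring

@[simp] theorem area_self (ε : ℝ) (p q : Plane) : area ε p p q = 0 := by
  unfold area; ring

theorem area_combo (ε : ℝ) (p q x y : Plane) {s t : ℝ} (hst : s + t = 1) :
    area ε p q (s • x + t • y) = s * area ε p q x + t * area ε p q y := by
  obtain rfl : s = 1 - t := by linarith
  simp only [area, PiLp.add_apply, PiLp.smul_apply, smul_eq_mul]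
  ring

theorem area_add (ε : ℝ) (p q r x : Plane) :
    area ε q r x + area ε r p x + area ε p q x = area ε p q r := by
  unfold area; ring

theorem convex_area_nonneg (ε : ℝ) (p q : Plane) : Convex ℝ {x | 0 ≤ area ε p q x} := by
  intro x hx y hy s t hs ht hst
  simp only [Set.mem_ofPred_eq] at *
  rw [area_combo ε p q x y hst]
  positivity

theorem continuous_area (ε : ℝ) (p q : Plane) : Continuous (area ε p q) := by
  unfold area; fun_prop

theorem mem_convexHull_triple {p q r x : Plane} {α β γ : ℝ} (hα : 0 ≤ α) (hβ : 0 ≤ β) (hγ : 0 ≤ γ)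
    (hpos : 0 < α + β + γ) (h : ∀ i, α * p i + β * q i + γ * r i = (α + β + γ) * x i) :
    x ∈ convexHull ℝ {p, q, r} := by
  have hx : x = (α / (α + β + γ)) • p + (β / (α + β + γ)) • q + (γ / (α + β + γ)) • r := by
    ext i
    have := h i
    simp only [PiLp.add_apply, PiLp.smul_apply, smul_eq_mul]
    field_simp
    linarith
  rw [hx, add_assoc]
  have hc := convex_convexHull ℝ ({p, q, r} : Set Plane)
  have hm : ∀ z ∈ ({p, q, r} : Set Plane), z ∈ convexHull ℝ ({p, q, r} : Set Plane) :=
    fun z hz => subset_convexHull ℝ _ hz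
  have := hc.sum_mem (t := Finset.univ) (w := ![α / (α + β + γ), β / (α + β + γ), γ / (α + β + γ)])
    (z := ![p, q, r]) (by intro i _; fin_cases i <;> simp <;> positivity)
    (by simp [Fin.sum_univ_three]; field_simp) (by intro i _; fin_cases i <;> exact hm _ (by simp))
  simpa [Fin.sum_univ_three, add_assoc] using this

/-- A point with nonnegative barycentric coordinates belongs to the triangle. -/
theorem mem_convexHull_of_area {ε : ℝ} {p q r x : Plane} (h1 : 0 ≤ area ε p q x)
    (h2 : 0 ≤ area ε q r x) (h3 : 0 ≤ area ε r p x) (h : 0 < area ε p q r) :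
    x ∈ convexHull ℝ {p, q, r} := by
  have := area_add ε p q r x
  refine mem_convexHull_triple (α := area ε q r x) (β := area ε r p x) (γ := area ε p q x) h2 h3 h1
    (by linarith) fun i => ?_
  rw [this]
  unfold area
  fin_cases i <;> simp <;> ring

/-- The convex hull of a set on one side of a line does not meet the interior of the convex hull of a
set on the other side. -/
theorem disjoint_interior_of_area {ε : ℝ} (hε : ε ≠ 0) {p q : Plane} (hpq : p ≠ q)
    {A B : Set Plane} (hA : ∀ x ∈ A, area ε p q x ≤ 0) (hB : ∀ x ∈ B, 0 ≤ area ε p q x) :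
    Disjoint (convexHull ℝ A) (interior (convexHull ℝ B)) := by
  rw [Set.disjoint_left]
  intro x hxA hxB
  have h1 : area ε p q x ≤ 0 := by
    have : convexHull ℝ A ⊆ {x | 0 ≤ area ε q p x} :=
      convexHull_min (fun y hy => by
        have := hA y hy
        have := area_swap' ε p q y
        simp only [Set.mem_ofPred_eq]; linarith) (convex_area_nonneg ε q p)
    have := this hxA
    have := area_swap' ε p q x
    simp only [Set.mem_ofPred_eq] at *; linarith
  have h2 : convexHull ℝ B ⊆ {x | 0 ≤ area ε p q x} := convexHull_min hB (convex_area_nonneg ε p q)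
  obtain ⟨U, hU, hUo, hxU⟩ := mem_interior.1 hxB
  -- The vector `d` is normal to `pq` and points to the negative side; a small move along it stays
  -- in the interior and makes the area negative.
  obtain ⟨d, hd⟩ : ∃ d : Plane, ε * ((q 0 - p 0) * d 1 - (q 1 - p 1) * d 0) < 0 := by
    refine ⟨!₂[ε * (q 1 - p 1), -(ε * (q 0 - p 0))], ?_⟩
    simp only [Matrix.cons_val_zero, Matrix.cons_val_one]
    have hne : q 0 - p 0 ≠ 0 ∨ q 1 - p 1 ≠ 0 := by
      by_contra! hcon
      apply hpq
      ext i
      fin_cases i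
      · simpa using (sub_eq_zero.1 hcon.1).symm
      · simpa using (sub_eq_zero.1 hcon.2).symm
    have hpos : 0 < (q 0 - p 0) ^ 2 + (q 1 - p 1) ^ 2 := by
      rcases hne with h | h <;> positivity
    have : 0 < ε ^ 2 := by positivity
    nlinarith [mul_pos this hpos]
  have hcont : Continuous fun t : ℝ => x + t • d := by fun_prop
  have hev : ∀ᶠ t in nhds (0 : ℝ), x + t • d ∈ U :=
    hcont.continuousAt.eventually_mem (by simpa using hUo.mem_nhds hxU)
  obtain ⟨δ, hδ, hball⟩ := Metric.eventually_nhds_iff.1 hev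
  have hmem := h2 (hU (hball (y := δ / 2) (by
    rw [Real.dist_eq, sub_zero, abs_of_pos (by positivity)]; linarith)))
  have e : area ε p q (x + (δ / 2) • d) =
      area ε p q x + δ / 2 * (ε * ((q 0 - p 0) * d 1 - (q 1 - p 1) * d 0)) := by
    simp only [area, PiLp.add_apply, PiLp.smul_apply, smul_eq_mul]; ring
  simp only [Set.mem_ofPred_eq, e] at hmem
  nlinarith

/-- The relative interior of a diagonal of a convex quadrilateral is contained in the interior of
the quadrilateral. -/
theorem mem_interior_of_area {ε : ℝ} {p q r s x : Plane} (hq : 0 < area ε p q r)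
    (hs : 0 < area ε r s p) (hx : x ∈ convexHull ℝ {p, r}) (hxp : x ≠ p) (hxr : x ≠ r) :
    x ∈ interior (convexHull ℝ {p, q, r, s}) := by
  rw [convexHull_pair] at hx
  obtain ⟨α, β, hα, hβ, hαβ, rfl⟩ := hx
  have hα' : 0 < α := hα.lt_of_ne' fun h => hxr (by
    obtain rfl : β = 1 := by linarith
    simp [h])
  have hβ' : 0 < β := hβ.lt_of_ne' fun h => hxp (by
    obtain rfl : α = 1 := by linarith
    simp [h])
  rw [mem_interior]
  -- The open half-planes of the four sides: a point in all of them is in one of the two triangles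
  -- cut by `pr`, according to the sign of its area with respect to `pr`.
  refine ⟨{y | 0 < area ε p q y} ∩ {y | 0 < area ε q r y} ∩ {y | 0 < area ε r s y} ∩
    {y | 0 < area ε s p y}, ?_, ?_, ?_⟩
  · rintro y ⟨⟨⟨h1, h2⟩, h3⟩, h4⟩
    simp only [Set.mem_ofPred_eq] at h1 h2 h3 h4
    rcases le_total 0 (area ε p r y) with h | h
    · have := mem_convexHull_of_area h h3.le h4.le (by rwa [area_rotate] at hs)
      refine convexHull_mono ?_ this
      rintro z (rfl | rfl | rfl) <;> simp
    · have h' : 0 ≤ area ε r p y := by rw [area_swap']; linarith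
      have := mem_convexHull_of_area h1.le h2.le h' hq
      refine convexHull_mono ?_ this
      rintro z (rfl | rfl | rfl) <;> simp
  · have ho : ∀ p q, IsOpen {y | 0 < area ε p q y} := fun p q =>
      isOpen_lt continuous_const (continuous_area ε p q)
    exact (((ho _ _).inter (ho _ _)).inter (ho _ _)).inter (ho _ _)
  · simp only [Set.mem_inter_iff, Set.mem_ofPred_eq, area_combo ε _ _ p r hαβ, area_self_left,
      area_self_right, mul_zero, zero_add, add_zero]
    have h1 : area ε q r p = area ε p q r := area_rotate ..
    have h2 : area ε s p r = area ε r s p := area_rotate ..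
    rw [h1, h2]
    refine ⟨⟨⟨?_, ?_⟩, ?_⟩, ?_⟩ <;> positivity

/-! ### Labelling the vertices in cyclic order -/

/-- The vertices of a convex polygon are labelled by `0, …, n - 1` along its boundary. -/
structure IsLabelling (P : ConvexPolygon) (n : ℕ) (ε : ℝ) (v : ℕ → Plane) : Prop where
  ne_zero : ε ≠ 0
  mem : ∀ i < n, v i ∈ P.vertices
  surj : ∀ x ∈ P.vertices, ∃ i < n, v i = x
  inj : ∀ i < n, ∀ j < n, v i = v j → i = j
  pos : ∀ {i j k}, i < j → j < k → k < n → 0 < area ε (v i) (v j) (v k)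

namespace ConvexPolygon

variable {P : ConvexPolygon}

theorem mem_of_mem_convexHull {x : Plane} {t : Set Plane} (hx : x ∈ P.vertices)
    (ht : t ⊆ P.vertices) (h : x ∈ convexHull ℝ t) : x ∈ t :=
  convexIndependent_set_iff_inter_convexHull_subset.1 P.convexIndependent t ht ⟨hx, h⟩

theorem area_ne_zero {ε : ℝ} (hε : ε ≠ 0) {p q r : Plane} (hp : p ∈ P.vertices)
    (hq : q ∈ P.vertices) (hr : r ∈ P.vertices) (hpq : p ≠ q) (hpr : p ≠ r) (hqr : q ≠ r) :
    area ε p q r ≠ 0 := by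
  intro h
  have hno : ∀ x y z, x ∈ P.vertices → y ∈ P.vertices → z ∈ P.vertices → y ≠ x → y ≠ z →
      ¬Wbtw ℝ x y z := by
    intro x y z hx hy hz hyx hyz hw
    have : y ∈ convexHull ℝ {x, z} := by
      rw [convexHull_pair]; exact hw.mem_segment
    have := mem_of_mem_convexHull hy (by rintro w (rfl | rfl) <;> assumption) this
    rcases this with rfl | rfl
    · exact hyx rfl
    · exact hyz rfl
  have h' : (q 0 - p 0) * (r 1 - p 1) - (q 1 - p 1) * (r 0 - p 0) = 0 := by
    unfold area at h; exact (mul_eq_zero.1 h).resolve_left hε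
  have hcol : Collinear ℝ {p, q, r} := by
    rw [collinear_iff_of_mem (p₀ := p) (by simp)]
    refine ⟨q - p, ?_⟩
    have hr : ∃ t : ℝ, r = t • (q - p) + p := by
      by_cases h0 : q 0 - p 0 = 0
      · have h1 : q 1 - p 1 ≠ 0 := by
          intro h1
          apply hpq
          ext i
          fin_cases i
          · simpa using (sub_eq_zero.1 h0).symm
          · simpa using (sub_eq_zero.1 h1).symm
        refine ⟨(r 1 - p 1) / (q 1 - p 1), ?_⟩
        ext i
        fin_cases i <;> simp <;> field_simp <;> linarith
      · refine ⟨(r 0 - p 0) / (q 0 - p 0), ?_⟩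
        ext i
        fin_cases i <;> simp <;> field_simp <;> linarith
    rintro x (rfl | rfl | rfl)
    · exact ⟨0, by simp⟩
    · exact ⟨1, by simp⟩
    · exact hr
  rcases hcol.wbtw_or_wbtw_or_wbtw with hw | hw | hw
  · exact hno _ _ _ hp hq hr hpq.symm hqr hw
  · exact hno _ _ _ hq hr hp hqr.symm hpr.symm hw
  · exact hno _ _ _ hr hp hq hpr hpq hw

/-- Positive barycentric coordinates would put a vertex of the polygon in the hull of three others.
-/
theorem not_mem_triangle {ε : ℝ} {p q r x : Plane} (hp : p ∈ P.vertices)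
    (hq : q ∈ P.vertices) (hr : r ∈ P.vertices) (hx : x ∈ P.vertices) (hxp : x ≠ p) (hxq : x ≠ q)
    (hxr : x ≠ r) (h1 : 0 < area ε p q x) (h2 : 0 < area ε q r x) (h3 : 0 < area ε r p x) :
    False := by
  have := area_add ε p q r x
  have := mem_convexHull_of_area h1.le h2.le h3.le (by linarith)
  have := mem_of_mem_convexHull hx (by rintro w (rfl | rfl | rfl) <;> assumption) this
  simp [hxp, hxq, hxr] at this

end ConvexPolygon

open Classical in
/-- The elements of a finite set with a strict total order can be enumerated in order. -/
theorem exists_enumeration {α : Type*} [Nonempty α] (V : Finset α) (lt : α → α → Prop)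
    (hirr : ∀ x ∈ V, ¬lt x x) (htot : ∀ x ∈ V, ∀ y ∈ V, x ≠ y → lt x y ∨ lt y x)
    (htrans : ∀ x ∈ V, ∀ y ∈ V, ∀ z ∈ V, lt x y → lt y z → lt x z) :
    ∃ v : ℕ → α, (∀ i < V.card, v i ∈ V) ∧ (∀ x ∈ V, ∃ i < V.card, v i = x) ∧
      ∀ i j, i < j → j < V.card → lt (v i) (v j) := by
  let rk : α → ℕ := fun x => (V.filter fun y => lt y x).card
  have hmono : ∀ x ∈ V, ∀ y ∈ V, lt x y → rk x < rk y := by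
    intro x hx y hy hxy
    refine Finset.card_lt_card ?_
    rw [Finset.ssubset_iff_of_subset]
    · exact ⟨x, by simp [hx, hxy], by simp [hirr x hx]⟩
    · intro z hz
      simp only [Finset.mem_filter] at hz ⊢
      exact ⟨hz.1, htrans z hz.1 x hx y hy hz.2 hxy⟩
  have hinj : Set.InjOn rk V := by
    intro x hx y hy hxy
    by_contra hne
    rcases htot x hx y hy hne with h | h
    · exact (hmono x hx y hy h).ne hxy
    · exact (hmono y hy x hx h).ne' hxy
  have hlt : ∀ x ∈ V, rk x < V.card := by
    intro x hx
    refine Finset.card_lt_card ?_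
    rw [Finset.ssubset_iff_of_subset (Finset.filter_subset _ _)]
    exact ⟨x, hx, by simp [hirr x hx]⟩
  have himg : V.image rk = Finset.range V.card := by
    refine Finset.eq_of_subset_of_card_le ?_ ?_
    · intro i hi
      obtain ⟨x, hx, rfl⟩ := Finset.mem_image.1 hi
      exact Finset.mem_range.2 (hlt x hx)
    · rw [Finset.card_range, Finset.card_image_of_injOn hinj]
  have hsurj : ∀ i < V.card, ∃ x ∈ V, rk x = i := by
    intro i hi
    have : i ∈ V.image rk := by rw [himg]; exact Finset.mem_range.2 hi
    simpa using this
  choose! v hv hrk using hsurj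
  refine ⟨v, hv, fun x hx => ⟨rk x, hlt x hx, hinj (hv _ (hlt x hx)) hx (hrk _ (hlt x hx))⟩, ?_⟩
  intro i j hij hj
  have hi : i < V.card := by omega
  rcases htot _ (hv i hi) _ (hv j hj) (fun he => by
    have := hrk i hi; rw [he, hrk j hj] at this; omega) with h | h
  · exact h
  · have := hmono _ (hv j hj) _ (hv i hi) h
    rw [hrk j hj, hrk i hi] at this
    omega

namespace ConvexPolygon

variable (P : ConvexPolygon)

/-- The vertices are sorted by angle around `a`, which comes first. If transitivity failed, `a`
would be in the triangle of three other vertices; if a triple `i < j < k` were negatively oriented,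
`v j` would be in the triangle of `a`, `v i` and `v k`. -/
theorem exists_labelling {ε : ℝ} (hε : ε ≠ 0) {a : Plane} (ha : a ∈ P.vertices) :
    ∃ v n, IsLabelling P n ε v ∧ 0 < n ∧ v 0 = a := by
  have hne : ∀ {p q r}, p ∈ P.vertices → q ∈ P.vertices → r ∈ P.vertices → p ≠ q → p ≠ r → q ≠ r →
    area ε p q r ≠ 0 := area_ne_zero hε
  let V := P.finite_vertices.toFinset
  have hV : ∀ x, x ∈ V ↔ x ∈ P.vertices := fun x => P.finite_vertices.mem_toFinset
  let lt : Plane → Plane → Prop := fun x y => (x = a ∧ y ≠ a) ∨ (x ≠ a ∧ y ≠ a ∧ 0 < area ε a x y)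
  have htrans : ∀ x ∈ P.vertices, ∀ y ∈ P.vertices, ∀ z ∈ P.vertices, lt x y → lt y z → lt x z := by
    rintro x hx y hy z hz (⟨rfl, h1⟩ | ⟨h1, h2, h3⟩) (⟨rfl, h4⟩ | ⟨h4, h5, h6⟩)
    · exact absurd rfl h1
    · exact .inl ⟨rfl, h5⟩
    · exact absurd rfl h2
    · refine .inr ⟨h1, h5, ?_⟩
      by_contra hcon
      have hxz : x ≠ z := by
        rintro rfl
        rw [area_swap] at h6; linarith
      have hne' := hne ha hx hz h1.symm h5.symm hxz
      have hlt : 0 < area ε a z x := by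
        rw [area_swap]; have := lt_of_le_of_ne (not_lt.1 hcon) hne'; linarith
      rw [← area_rotate] at h3 h6 hlt
      exact not_mem_triangle hx hy hz ha h1.symm h2.symm h5.symm h3 h6 hlt
  obtain ⟨v, hv1, hv2, hv3⟩ := exists_enumeration V lt (by
      rintro x hx (⟨rfl, h⟩ | ⟨h1, h2, h3⟩)
      · exact h rfl
      · simp at h3)
    (by
      intro x hx y hy hxy
      rw [hV] at hx hy
      by_cases hxa : x = a
      · exact .inl (.inl ⟨hxa, by rintro rfl; exact hxy hxa⟩)
      by_cases hya : y = a
      · exact .inr (.inl ⟨hya, hxa⟩)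
      rcases lt_or_gt_of_ne (hne ha hx hy (Ne.symm hxa) (Ne.symm hya) hxy) with h | h
      · exact .inr (.inr ⟨hya, hxa, by rw [area_swap]; linarith⟩)
      · exact .inl (.inr ⟨hxa, hya, h⟩))
    (fun x hx y hy z hz => htrans x ((hV _).1 hx) y ((hV _).1 hy) z ((hV _).1 hz))
  have hltne : ∀ x y, lt x y → x ≠ y := by
    rintro x y (⟨rfl, h⟩ | ⟨h1, h2, h3⟩) rfl
    · exact h rfl
    · simp at h3
  have hcard : 0 < V.card := Finset.card_pos.2 ⟨a, (hV a).2 ha⟩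
  have h0 : v 0 = a := by
    obtain ⟨i, hi, hia⟩ := hv2 a ((hV a).2 ha)
    rcases Nat.eq_zero_or_pos i with rfl | hi0
    · exact hia
    · rcases hv3 0 i hi0 hi with h | h
      · exact h.1
      · exact absurd hia h.2.1
  refine ⟨v, V.card, ⟨hε, fun i hi => (hV _).1 (hv1 i hi), fun x hx => hv2 x ((hV x).2 hx), ?_, ?_⟩,
    hcard, h0⟩
  · intro i hi j hj hij
    by_contra hne
    rcases lt_or_gt_of_ne hne with h | h
    · exact hltne _ _ (hv3 i j h hj) hij
    · exact hltne _ _ (hv3 j i h hi) hij.symm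
  · intro i j k hij hjk hk
    have hj : j < V.card := by omega
    have hi : i < V.card := by omega
    have hva : ∀ i, 0 < i → i < V.card → v i ≠ a := fun i h0' hi => by
      rw [← h0]; exact (hltne _ _ (hv3 0 i h0' hi)).symm
    have hapos : ∀ i j, 0 < i → i < j → j < V.card → 0 < area ε a (v i) (v j) := by
      intro i j h0' hij hj
      rcases hv3 i j hij hj with h | h
      · exact absurd h.1 (hva i h0' (by omega))
      · exact h.2.2
    rcases Nat.eq_zero_or_pos i with rfl | hi0
    · rw [h0]
      exact hapos j k hij hjk hk
    · have hm : ∀ i < V.card, v i ∈ P.vertices := fun i hi => (hV _).1 (hv1 i hi)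
      have n1 := hltne _ _ (hv3 i j hij hj)
      have n2 := hltne _ _ (hv3 j k hjk hk)
      have n3 := hltne _ _ (hv3 i k (by omega) hk)
      by_contra hcon
      have hlt := lt_of_le_of_ne (not_lt.1 hcon) (hne (hm i hi) (hm j hj) (hm k hk) n1 n3 n2)
      have h1 := hapos i j hi0 hij hj
      have h2 := hapos j k (by omega) hjk hk
      have h3 : 0 < area ε (v i) (v k) (v j) := by rw [area_swap]; linarith
      have h4 : 0 < area ε (v k) a (v j) := by rwa [area_rotate, area_rotate]
      exact not_mem_triangle ha (hm i hi) (hm k hk) (hm j hj) (hva j (by omega) hj) n1.symm n2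
        h1 h3 h4

/-- A labelling can be chosen to start from a given vertex, and to meet two other vertices in a
given order. -/
theorem exists_labelling_of_ne {a b c : Plane} (ha : a ∈ P.vertices) (hb : b ∈ P.vertices)
    (hc : c ∈ P.vertices) (hab : a ≠ b) (hac : a ≠ c) (hbc : b ≠ c) :
    ∃ ε v n i j, IsLabelling P n ε v ∧ v 0 = a ∧ v i = b ∧ v j = c ∧ 0 < i ∧ i < j ∧ j < n := by
  have hne := area_ne_zero (P := P) one_ne_zero ha hb hc hab hac hbc
  -- Scaling by the signed area of `abc` orients `abc` positively, which forces `b` to come before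
  -- `c`.
  have hpos : 0 < area (area 1 a b c) a b c := by
    have : area (area 1 a b c) a b c = area 1 a b c ^ 2 := by unfold area; ring
    rw [this]; positivity
  obtain ⟨v, n, hv, hn, h0⟩ := P.exists_labelling hne ha
  obtain ⟨i, hi, rfl⟩ := hv.surj b hb
  obtain ⟨j, hj, rfl⟩ := hv.surj c hc
  have hi0 : i ≠ 0 := by rintro rfl; exact hab h0.symm
  have hj0 : j ≠ 0 := by rintro rfl; exact hac h0.symm
  have hij : i ≠ j := by rintro rfl; exact hbc rfl
  refine ⟨_, v, n, i, j, hv, h0, rfl, rfl, by omega, ?_, hj⟩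
  by_contra hcon
  have h1 := hv.pos (i := 0) (j := j) (k := i) (by omega) (by omega) hi
  rw [h0, area_swap] at h1
  linarith

end ConvexPolygon

namespace IsLabelling

variable {P : ConvexPolygon} {n : ℕ} {ε : ℝ} {v : ℕ → Plane}

theorem pos_of_out (hv : IsLabelling P n ε v) {i j m : ℕ} (hij : i < j) (hj : j < n) (hm : m < n)
    (h : m < i ∨ j < m) : 0 < area ε (v i) (v j) (v m) := by
  rcases h with h | h
  · rw [area_rotate]; exact hv.pos h hij hj
  · exact hv.pos hij h hm

theorem neg_of_in (hv : IsLabelling P n ε v) {i j m : ℕ} (hj : j < n)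
    (him : i < m) (hmj : m < j) : area ε (v i) (v j) (v m) < 0 := by
  have := hv.pos him hmj hj
  rw [area_swap] at this; linarith

/-- The barycentric weights of the intersection point are ratios of areas; the denominators agree
because each diagonal cuts the quadrilateral into two triangles of the same total area. -/
theorem inter_nonempty (hv : IsLabelling P n ε v) {i j k l : ℕ} (hik : i < k) (hkj : k < j)
    (hjl : j < l) (hl : l < n) :
    (convexHull ℝ {v i, v j} ∩ convexHull ℝ {v k, v l}).Nonempty := by
  have h1 := hv.pos hik (by omega : k < l) hl
  have h2 := hv.pos hkj hjl hl
  have h3 := hv.pos hik hkj (by omega)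
  have h4 := hv.pos (by omega : i < j) hjl hl
  set α := area ε (v i) (v k) (v l) with hα
  set β := area ε (v k) (v j) (v l) with hβ
  set γ := area ε (v i) (v k) (v j) with hγ
  set δ := area ε (v i) (v j) (v l) with hδ
  have hsum : α + β = γ + δ := by rw [hα, hβ, hγ, hδ]; unfold area; ring
  rw [convexHull_pair, convexHull_pair]
  refine ⟨(β / (α + β)) • v i + (α / (α + β)) • v j, ⟨_, _, by positivity, by positivity, ?_, rfl⟩,
    ⟨δ / (γ + δ), γ / (γ + δ), by positivity, by positivity, ?_, ?_⟩⟩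
  · field_simp; ring
  · field_simp; ring
  · rw [← hsum]
    ext m
    have hp : (0 : ℝ) < α + β := by positivity
    have key : δ * v k m + γ * v l m = β * v i m + α * v j m := by
      rw [hα, hβ, hγ, hδ]; unfold area
      fin_cases m <;> simp <;> ring
    simp only [PiLp.add_apply, PiLp.smul_apply, smul_eq_mul]
    field_simp
    linarith

theorem not_nonCrossing (hv : IsLabelling P n ε v) {i j k l : ℕ} (hi : i < n) (hj : j < n)
    (hk : k < n) (hl : l < n) (h : Crosses i j k l) : ¬NonCrossing {v i, v j} {v k, v l} := by
  intro hnc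
  have hne : (convexHull ℝ {v i, v j} ∩ convexHull ℝ {v k, v l}).Nonempty := by
    rcases h with ⟨h1, h2, h3 | h3⟩ | ⟨h1, h2, h3 | h3⟩ | ⟨h1, h2, h3 | h3⟩ | ⟨h1, h2, h3 | h3⟩
    · have := hv.inter_nonempty h3 h1 h2 hj
      rwa [Set.pair_comm (v l), Set.inter_comm] at this
    · exact hv.inter_nonempty h1 h2 h3 hl
    · have := hv.inter_nonempty h3 h1 h2 hj
      rwa [Set.inter_comm] at this
    · have := hv.inter_nonempty h1 h2 h3 hk
      rwa [Set.pair_comm (v l)] at this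
    · have := hv.inter_nonempty h3 h1 h2 hi
      rwa [Set.pair_comm (v l), Set.pair_comm (v j), Set.inter_comm] at this
    · have := hv.inter_nonempty h1 h2 h3 hl
      rwa [Set.pair_comm (v j)] at this
    · have := hv.inter_nonempty h3 h1 h2 hi
      rwa [Set.pair_comm (v j), Set.inter_comm] at this
    · have := hv.inter_nonempty h1 h2 h3 hk
      rwa [Set.pair_comm (v l), Set.pair_comm (v j)] at this
  obtain ⟨x, hx⟩ := hne
  have hem : ({v i, v j} ∩ {v k, v l} : Set Plane) = ∅ := by
    ext z
    simp only [Set.mem_inter_iff, Set.mem_insert_iff, Set.mem_singleton_iff, Set.mem_empty_iff_false,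
      iff_false, not_and]
    have e1 := hv.inj i hi k hk
    have e2 := hv.inj i hi l hl
    have e3 := hv.inj j hj k hk
    have e4 := hv.inj j hj l hl
    unfold Crosses at h
    rintro (rfl | rfl) (h' | h')
    · have := e1 h'; omega
    · have := e2 h'; omega
    · have := e3 h'; omega
    · have := e4 h'; omega
  have := hnc hx
  rw [hem, convexHull_empty] at this
  exact this

theorem nonCrossing_of_lt (hv : IsLabelling P n ε v) {i j k l : ℕ} (hij : i < j) (hj : j < n)
    (hk : k < n) (hl : l < n) (h : ¬Crosses i j k l) :
    NonCrossing {v i, v j} {v k, v l} := by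
  rintro x ⟨hx, hx'⟩
  rw [convexHull_pair] at hx hx'
  obtain ⟨a, b, ha, hb, hab, hxa⟩ := hx
  obtain ⟨s, t, hs, ht, hst, hxs⟩ := hx'
  -- The area with respect to `v i` and `v j` vanishes at the common point. Unless `k` and `l` lie
  -- strictly on opposite sides, each endpoint with positive weight must be `v i` or `v j`.
  have h0 : s * area ε (v i) (v j) (v k) + t * area ε (v i) (v j) (v l) = 0 := by
    rw [← area_combo _ _ _ _ _ hst, hxs, ← hxa, area_combo _ _ _ _ _ hab]; simp
  have hzero : ∀ m < n, m = i ∨ m = j ∨ (m < i ∨ j < m) ∧ 0 < area ε (v i) (v j) (v m) ∨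
      (i < m ∧ m < j) ∧ area ε (v i) (v j) (v m) < 0 := by
    intro m hm
    rcases lt_trichotomy m i with h | h | h
    · exact .inr (.inr (.inl ⟨.inl h, hv.pos_of_out hij hj hm (.inl h)⟩))
    · exact .inl h
    rcases lt_trichotomy m j with h' | h' | h'
    · exact .inr (.inr (.inr ⟨⟨h, h'⟩, hv.neg_of_in hj h h'⟩))
    · exact .inr (.inl h')
    · exact .inr (.inr (.inl ⟨.inr h', hv.pos_of_out hij hj hm (.inr h')⟩))
  have hmem : ∀ m, m = i ∨ m = j → v m ∈ ({v i, v j} : Set Plane) := by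
    rintro m (rfl | rfl) <;> simp
  have hkl : (k = i ∨ k = j) ∧ (l = i ∨ l = j) ∨ (k = i ∨ k = j) ∧ t = 0 ∨
      (l = i ∨ l = j) ∧ s = 0 := by
    have zk := hzero k hk
    have zl := hzero l hl
    by_cases ck : k = i ∨ k = j
    · by_cases cl : l = i ∨ l = j
      · exact .inl ⟨ck, cl⟩
      · refine .inr (.inl ⟨ck, ?_⟩)
        have hk0 : area ε (v i) (v j) (v k) = 0 := by rcases ck with rfl | rfl <;> simp
        rw [hk0, mul_zero, zero_add] at h0
        refine (mul_eq_zero.1 h0).resolve_right ?_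
        rcases zl with zl | zl | zl | zl
        · exact absurd (.inl zl) cl
        · exact absurd (.inr zl) cl
        · exact zl.2.ne'
        · exact zl.2.ne
    · by_cases cl : l = i ∨ l = j
      · refine .inr (.inr ⟨cl, ?_⟩)
        have hl0 : area ε (v i) (v j) (v l) = 0 := by rcases cl with rfl | rfl <;> simp
        rw [hl0, mul_zero, add_zero] at h0
        refine (mul_eq_zero.1 h0).resolve_right ?_
        rcases zk with zk | zk | zk | zk
        · exact absurd (.inl zk) ck
        · exact absurd (.inr zk) ck
        · exact zk.2.ne'
        · exact zk.2.ne
      · exfalso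
        rcases zk with zk | zk | zk | zk
        · exact ck (.inl zk)
        · exact ck (.inr zk)
        · rcases zl with zl | zl | zl | zl
          · exact cl (.inl zl)
          · exact cl (.inr zl)
          · have := mul_nonneg hs zk.2.le
            have := mul_nonneg ht zl.2.le
            rcases hs.eq_or_lt with h | h
            · have : t = 1 := by linarith
              rw [← h, this] at h0; linarith [zl.2]
            · have := mul_pos h zk.2
              linarith
          · refine h ?_
            have h1 := zk.1; have h2 := zl.1
            unfold Crosses; omega
        · rcases zl with zl | zl | zl | zl
          · exact cl (.inl zl)
          · exact cl (.inr zl)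
          · refine h ?_
            have h1 := zk.1; have h2 := zl.1
            unfold Crosses; omega
          · have := mul_nonneg hs (neg_pos.2 zk.2).le
            have := mul_nonneg ht (neg_pos.2 zl.2).le
            rcases hs.eq_or_lt with h | h
            · have : t = 1 := by linarith
              rw [← h, this] at h0; linarith [zl.2]
            · have := mul_pos h (neg_pos.2 zk.2)
              linarith
  rcases hkl with ⟨h1, h2⟩ | ⟨h1, h2⟩ | ⟨h1, h2⟩
  · refine convexHull_mono (s := {v k, v l}) ?_ ?_
    · rintro z (rfl | rfl)
      · exact ⟨hmem k h1, by simp⟩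
      · exact ⟨hmem l h2, by simp⟩
    · rw [convexHull_pair]; exact ⟨s, t, hs, ht, hst, hxs⟩
  · refine subset_convexHull ℝ _ ?_
    have : x = v k := by
      rw [← hxs, h2, show s = 1 by linarith]; simp
    rw [this]
    exact ⟨hmem k h1, by simp⟩
  · refine subset_convexHull ℝ _ ?_
    have : x = v l := by
      rw [← hxs, h2, show t = 1 by linarith]; simp
    rw [this]
    exact ⟨hmem l h1, by simp⟩

theorem nonCrossing_iff (hv : IsLabelling P n ε v) {i j k l : ℕ} (hi : i < n) (hj : j < n)
    (hk : k < n) (hl : l < n) (hij : i ≠ j) :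
    NonCrossing {v i, v j} {v k, v l} ↔ ¬Crosses i j k l := by
  refine ⟨fun h hc => hv.not_nonCrossing hi hj hk hl hc h, fun h => ?_⟩
  rcases lt_or_gt_of_ne hij with hlt | hlt
  · exact hv.nonCrossing_of_lt hlt hj hk hl h
  · rw [Set.pair_comm]
    exact hv.nonCrossing_of_lt hlt hi hk hl fun hc => h hc.comm_left

theorem pair_eq_iff (hv : IsLabelling P n ε v) {i j k l : ℕ} (hi : i < n) (hj : j < n)
    (hk : k < n) (hl : l < n) :
    ({v i, v j} : Set Plane) = {v k, v l} ↔ (i = k ∧ j = l) ∨ (i = l ∧ j = k) := by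
  rw [Set.pair_eq_pair_iff]
  constructor
  · rintro (⟨h1, h2⟩ | ⟨h1, h2⟩)
    · exact .inl ⟨hv.inj _ hi _ hk h1, hv.inj _ hj _ hl h2⟩
    · exact .inr ⟨hv.inj _ hi _ hl h1, hv.inj _ hj _ hk h2⟩
  · rintro (⟨rfl, rfl⟩ | ⟨rfl, rfl⟩) <;> simp

/-- The convex hulls of two sets of vertices separated by a chord have disjoint interiors. -/
theorem disjoint_interior (hv : IsLabelling P n ε v) {u w : ℕ} (huw : u < w) (hw : w < n)
    {A B : Set ℕ} (hA : ∀ x ∈ A, x < n) (hB : ∀ x ∈ B, x < n)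
    (h : ((∀ x ∈ A, u ≤ x ∧ x ≤ w) ∧ ∀ x ∈ B, x ≤ u ∨ w ≤ x) ∨
      ((∀ x ∈ B, u ≤ x ∧ x ≤ w) ∧ ∀ x ∈ A, x ≤ u ∨ w ≤ x)) :
    Disjoint (convexHull ℝ (v '' A)) (interior (convexHull ℝ (v '' B))) := by
  have hne : v u ≠ v w := fun he => huw.ne (hv.inj u (by omega) w hw he)
  have hin : ∀ x < n, u ≤ x ∧ x ≤ w → area ε (v u) (v w) (v x) ≤ 0 := by
    intro x hx ⟨h1, h2⟩
    rcases h1.eq_or_lt with rfl | h1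
    · simp
    rcases h2.eq_or_lt with rfl | h2
    · simp
    exact (hv.neg_of_in hw h1 h2).le
  have hout : ∀ x < n, x ≤ u ∨ w ≤ x → 0 ≤ area ε (v u) (v w) (v x) := by
    intro x hx h
    by_cases h1 : x = u
    · simp [h1]
    by_cases h2 : x = w
    · simp [h2]
    exact (hv.pos_of_out huw hw hx (by omega)).le
  rcases h with ⟨h1, h2⟩ | ⟨h1, h2⟩
  · refine disjoint_interior_of_area hv.ne_zero hne ?_ ?_
    · rintro _ ⟨x, hx, rfl⟩
      exact hin x (hA x hx) (h1 x hx)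
    · rintro _ ⟨x, hx, rfl⟩
      exact hout x (hB x hx) (h2 x hx)
  · refine disjoint_interior_of_area hv.ne_zero hne.symm ?_ ?_
    · rintro _ ⟨x, hx, rfl⟩
      rw [area_swap']
      linarith [hout x (hA x hx) (h2 x hx)]
    · rintro _ ⟨x, hx, rfl⟩
      rw [area_swap']
      linarith [hin x (hB x hx) (h1 x hx)]

theorem mem_interior_quad (hv : IsLabelling P n ε v) {p q r s : ℕ} (hp : p < n) (hq : q < n)
    (hr : r < n) (hs : s < n) (hc : Crosses p r q s) {x : Plane} (hx : x ∈ convexHull ℝ {v p, v r})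
    (hxp : x ≠ v p) (hxr : x ≠ v r) :
    x ∈ interior (convexHull ℝ {v p, v q, v r, v s}) := by
  have key : (0 < area ε (v p) (v q) (v r) ∧ 0 < area ε (v r) (v s) (v p)) ∨
      (0 < area ε (v p) (v s) (v r) ∧ 0 < area ε (v r) (v q) (v p)) := by
    have e : ∀ a b c, area ε (v c) (v b) (v a) = - area ε (v a) (v b) (v c) := fun a b c => by
      unfold area; ring
    rcases hc with ⟨h1, h2, h3⟩ | ⟨h1, h2, h3⟩ | ⟨h1, h2, h3⟩ | ⟨h1, h2, h3⟩
    · have a1 := hv.neg_of_in hr h1 h2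
      have a2 := hv.pos_of_out (by omega) hr hs h3
      refine .inl ⟨by rw [area_swap]; linarith, by rwa [area_rotate]⟩
    · have a1 := hv.neg_of_in hr h1 h2
      have a2 := hv.pos_of_out (by omega) hr hq h3
      refine .inr ⟨by rw [area_swap]; linarith, by rwa [area_rotate]⟩
    · have a1 := hv.neg_of_in hp h1 h2
      have a2 := hv.pos_of_out (by omega) hp hs h3
      refine .inr ⟨by rwa [area_rotate], by rw [area_swap]; linarith⟩
    · have a1 := hv.neg_of_in hp h1 h2
      have a2 := hv.pos_of_out (by omega) hp hq h3
      refine .inl ⟨by rwa [area_rotate], by rw [area_swap]; linarith⟩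
  rcases key with ⟨h1, h2⟩ | ⟨h1, h2⟩
  · exact mem_interior_of_area h1 h2 hx hxp hxr
  · have := mem_interior_of_area h1 h2 hx hxp hxr
    convert this using 3
    ext z
    simp only [Set.mem_insert_iff, Set.mem_singleton_iff]
    tauto

end IsLabelling
end FlipGraph

/-! ### Translation between triangulations and relations on labels -/

namespace FlipGraph

open ConvexPolygon

variable {P : ConvexPolygon} {n : ℕ} {ε : ℝ} {v : ℕ → Plane}

/-- The arcs of a triangulation, in terms of a labelling of the vertices. -/
def labelRel (n : ℕ) (v : ℕ → Plane) (T : P.Triangulation) (i j : ℕ) : Prop :=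
  i < n ∧ j < n ∧ {v i, v j} ∈ T.arcs

theorem ConvexPolygon.Triangulation.ne_of_mem (T : P.Triangulation) {x y : Plane}
    (h : {x, y} ∈ T.arcs) : x ≠ y := by
  rintro rfl
  have := (T.isArc _ h).2
  simp at this

theorem ConvexPolygon.Triangulation.left_mem (T : P.Triangulation) {x y : Plane}
    (h : {x, y} ∈ T.arcs) : x ∈ P.vertices := (T.isArc _ h).1 (by simp)

theorem ConvexPolygon.Triangulation.right_mem (T : P.Triangulation) {x y : Plane}
    (h : {x, y} ∈ T.arcs) : y ∈ P.vertices := (T.isArc _ h).1 (by simp)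

namespace IsLabelling

theorem isArc_iff (hv : IsLabelling P n ε v) {e : Set Plane} :
    P.IsArc e ↔ ∃ i < n, ∃ j < n, i ≠ j ∧ e = {v i, v j} := by
  constructor
  · rintro ⟨h1, h2⟩
    obtain ⟨x, y, hxy, rfl⟩ := Set.ncard_eq_two.1 h2
    obtain ⟨i, hi, rfl⟩ := hv.surj x (h1 (by simp))
    obtain ⟨j, hj, rfl⟩ := hv.surj y (h1 (by simp))
    exact ⟨i, hi, j, hj, by rintro rfl; exact hxy rfl, rfl⟩
  · rintro ⟨i, hi, j, hj, hij, rfl⟩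
    refine ⟨?_, Set.ncard_pair fun h => hij (hv.inj i hi j hj h)⟩
    rintro x (rfl | rfl)
    · exact hv.mem i hi
    · exact hv.mem j hj

theorem exists_label (hv : IsLabelling P n ε v) (T : P.Triangulation) {e : Set Plane}
    (he : e ∈ T.arcs) : ∃ i j, labelRel n v T i j ∧ e = {v i, v j} := by
  obtain ⟨i, hi, j, hj, _, rfl⟩ := hv.isArc_iff.1 (T.isArc e he)
  exact ⟨i, j, ⟨hi, hj, he⟩, rfl⟩

theorem isTri_labelRel (hv : IsLabelling P n ε v) (T : P.Triangulation) :
    IsTri (Set.Iio n) (labelRel n v T) where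
  symm := fun ⟨h1, h2, h3⟩ => ⟨h2, h1, by rwa [Set.pair_comm]⟩
  ne := by
    rintro x y ⟨h1, h2, h3⟩ rfl
    exact T.ne_of_mem h3 rfl
  mem h := h.1
  noncross := fun ⟨h1, h2, h3⟩ ⟨h4, h5, h6⟩ hc =>
    hv.not_nonCrossing h1 h2 h4 h5 hc (T.nonCrossing _ h3 _ h6)
  maximal {x y} hx hy hne h := by
    refine ⟨hx, hy, T.maximal _ (hv.isArc_iff.2 ⟨x, hx, y, hy, hne, rfl⟩) fun e' he' => ?_⟩
    obtain ⟨z, w, hzw, rfl⟩ := hv.exists_label T he'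
    exact (hv.nonCrossing_iff hx hy hzw.1 hzw.2.1 hne).2 (h z w hzw)

/-- The triangulation of a polygon described by a relation between labels. -/
def toTriangulation (hv : IsLabelling P n ε v) {R : ℕ → ℕ → Prop} (h : IsTri (Set.Iio n) R) :
    P.Triangulation where
  arcs := {e | ∃ i j, R i j ∧ e = {v i, v j}}
  isArc := by
    rintro e ⟨i, j, hij, rfl⟩
    exact hv.isArc_iff.2 ⟨i, h.mem hij, j, h.mem' hij, h.ne hij, rfl⟩
  nonCrossing := by
    rintro _ ⟨i, j, hij, rfl⟩ _ ⟨k, l, hkl, rfl⟩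
    exact (hv.nonCrossing_iff (h.mem hij) (h.mem' hij) (h.mem hkl) (h.mem' hkl) (h.ne hij)).2
      (h.noncross hij hkl)
  maximal := by
    intro e he hnc
    obtain ⟨i, hi, j, hj, hij, rfl⟩ := hv.isArc_iff.1 he
    refine ⟨i, j, h.maximal hi hj hij fun z w hzw => ?_, rfl⟩
    exact (hv.nonCrossing_iff hi hj (h.mem hzw) (h.mem' hzw) hij).1 (hnc _ ⟨z, w, hzw, rfl⟩)

theorem labelRel_toTriangulation (hv : IsLabelling P n ε v) {R : ℕ → ℕ → Prop}
    (h : IsTri (Set.Iio n) R) : labelRel n v (hv.toTriangulation h) = R := by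
  funext i j
  refine propext ⟨?_, fun hij => ⟨h.mem hij, h.mem' hij, i, j, hij, rfl⟩⟩
  rintro ⟨hi, hj, k, l, hkl, he⟩
  rcases (hv.pair_eq_iff hi hj (h.mem hkl) (h.mem' hkl)).1 he with ⟨rfl, rfl⟩ | ⟨rfl, rfl⟩
  · exact hkl
  · exact h.symm hkl

theorem mem_arcs_of_labelRel (hv : IsLabelling P n ε v) {T T' : P.Triangulation}
    (h : ∀ i j, labelRel n v T i j → labelRel n v T' i j) : T.arcs ⊆ T'.arcs := by
  intro e he
  obtain ⟨i, j, hij, rfl⟩ := hv.exists_label T he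
  exact (h i j hij).2.2

theorem arcs_diff (hv : IsLabelling P n ε v) {T T' : P.Triangulation}
    (h : SubsetButOne (labelRel n v T) (labelRel n v T')) (hne : T ≠ T') :
    ∃ e, T.arcs \ T'.arcs = {e} := by
  obtain ⟨p, r, hpr⟩ := h
  have hsub : ∀ e ∈ T.arcs \ T'.arcs, e = {v p, v r} := by
    rintro e ⟨he, he'⟩
    obtain ⟨i, j, hij, rfl⟩ := hv.exists_label T he
    rcases hpr i j hij with h | ⟨rfl, rfl⟩ | ⟨rfl, rfl⟩
    · exact absurd h.2.2 he'
    · rfl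
    · exact Set.pair_comm _ _
  -- A triangulation contained in another one equals it, by maximality.
  have hex : (T.arcs \ T'.arcs).Nonempty := by
    by_contra hcon
    rw [Set.not_nonempty_iff_eq_empty, Set.sdiff_eq_empty] at hcon
    apply hne
    ext e
    refine ⟨fun he => hcon he, fun he => T.maximal e (T'.isArc e he) fun e' he' => ?_⟩
    exact T'.nonCrossing e he e' (hcon he')
  obtain ⟨e, he⟩ := hex
  refine ⟨e, Set.eq_singleton_iff_unique_mem.2 ⟨he, fun e' he' => ?_⟩⟩
  rw [hsub e he, hsub e' he']

theorem eq_or_adj (hv : IsLabelling P n ε v) {T T' : P.Triangulation}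
    (h : Near (labelRel n v T) (labelRel n v T')) : T = T' ∨ P.flipGraph.Adj T T' := by
  by_cases hne : T = T'
  · exact .inl hne
  · obtain ⟨e, he⟩ := hv.arcs_diff h.1 hne
    obtain ⟨e', he'⟩ := hv.arcs_diff h.2 (Ne.symm hne)
    exact .inr ⟨e, e', he, he'⟩

/-- Stationary steps are dropped, hence the inequality. This turns shortcuts between relations into
walks that contradict geodesicity. -/
theorem exists_walk (hv : IsLabelling P n ε v) {l : ℕ} {R S : ℕ → ℕ → Prop} (h : Reach n l R S)
    {T : P.Triangulation} (hT : labelRel n v T = R) :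
    ∃ (T' : P.Triangulation) (q : P.flipGraph.Walk T T'), labelRel n v T' = S ∧ q.length ≤ l := by
  induction h with
  | refl l R => exact ⟨T, .nil, hT, by simp⟩
  | step h hS hS' hn ih =>
    obtain ⟨T', q, rfl, hq⟩ := ih hT
    have he := hv.labelRel_toTriangulation hS'
    rw [← he] at hn
    rcases hv.eq_or_adj hn with heq | hadj
    · exact ⟨T', q, by rw [heq, he], by omega⟩
    · refine ⟨_, q.concat hadj, he, ?_⟩
      rw [SimpleGraph.Walk.length_concat]; omega

theorem triangulation_ext (hv : IsLabelling P n ε v) {T T' : P.Triangulation}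
    (h : labelRel n v T = labelRel n v T') : T = T' := by
  ext e
  exact ⟨fun he => hv.mem_arcs_of_labelRel (fun i j hij => h ▸ hij) he,
    fun he => hv.mem_arcs_of_labelRel (fun i j hij => h ▸ hij) he⟩

theorem exists_isFlip (hv : IsLabelling P n ε v) {T T' : P.Triangulation}
    (h : P.flipGraph.Adj T T') :
    ∃ p q r s, IsFlip (labelRel n v T) (labelRel n v T') p q r s ∧
      T.arcs \ T'.arcs = {{v p, v r}} ∧ T'.arcs \ T.arcs = {{v q, v s}} := by
  obtain ⟨e, e', he, he'⟩ := h
  have hmem : e ∈ T.arcs \ T'.arcs := by rw [he]; rfl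
  have hmem' : e' ∈ T'.arcs \ T.arcs := by rw [he']; rfl
  obtain ⟨p, r, hpr, rfl⟩ := hv.exists_label T hmem.1
  obtain ⟨q, s, hqs, rfl⟩ := hv.exists_label T' hmem'.1
  refine ⟨p, q, r, s, isFlip_of_diff (hv.isTri_labelRel T) (hv.isTri_labelRel T') hpr
    (fun h => hmem.2 h.2.2) hqs (fun h => hmem'.2 h.2.2) ?_ ?_, he, he'⟩
  · intro x y hxy
    by_cases h : {v x, v y} ∈ T'.arcs
    · exact .inl ⟨hxy.1, hxy.2.1, h⟩
    · have : ({v x, v y} : Set Plane) ∈ T.arcs \ T'.arcs := ⟨hxy.2.2, h⟩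
      rw [he] at this
      exact .inr ((hv.pair_eq_iff hxy.1 hxy.2.1 hpr.1 hpr.2.1).1 this)
  · intro x y hxy
    by_cases h : {v x, v y} ∈ T.arcs
    · exact .inl ⟨hxy.1, hxy.2.1, h⟩
    · have : ({v x, v y} : Set Plane) ∈ T'.arcs \ T.arcs := ⟨hxy.2.2, h⟩
      rw [he'] at this
      exact .inr ((hv.pair_eq_iff hxy.1 hxy.2.1 hqs.1 hqs.2.1).1 this)

end IsLabelling

/-! ### Geodesic sequences: convexity and the triangle property -/

/-- A geodesic path in the flip-graph, given as a sequence of triangulations. -/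
structure IsGeoSeq (k : ℕ) (U : ℕ → P.Triangulation) : Prop where
  adj : ∀ t < k, P.flipGraph.Adj (U t) (U (t + 1))
  le : ∀ i j, i ≤ j → j ≤ k → ∀ q : P.flipGraph.Walk (U i) (U j), j ≤ i + q.length

/-- A shorter walk between two terms, spliced into `p`, would shorten `p`. -/
theorem ConvexPolygon.IsGeodesic.isGeoSeq {T T' : P.Triangulation} {p : P.flipGraph.Walk T T'}
    (hp : IsGeodesic p) : IsGeoSeq p.length p.getVert where
  adj t ht := p.adj_getVert_succ ht
  le i j hij hj q := by
    have hle := SimpleGraph.dist_le (((p.take i).append q).append (p.drop j))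
    rw [← hp] at hle
    simp only [SimpleGraph.Walk.length_append, SimpleGraph.Walk.take_length,
      SimpleGraph.Walk.drop_length] at hle
    omega

namespace IsGeoSeq

variable {k : ℕ} {U : ℕ → P.Triangulation}

theorem reverse (h : IsGeoSeq k U) : IsGeoSeq k fun t => U (k - t) where
  adj t ht := by
    have := h.adj (k - (t + 1)) (by omega)
    rw [show k - (t + 1) + 1 = k - t by omega] at this
    exact this.symm
  le i j hij hj q := by
    have := h.le (k - j) (k - i) (by omega) (by omega) q.reverse
    rw [SimpleGraph.Walk.length_reverse] at this
    omega

theorem isGeo (h : IsGeoSeq k U) (hv : IsLabelling P n ε v) :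
    IsGeo n k fun t => labelRel n v (U t) where
  tri t _ := hv.isTri_labelRel (U t)
  flip t ht := by
    obtain ⟨p, q, r, s, hf, _⟩ := hv.exists_isFlip (h.adj t ht)
    exact ⟨p, q, r, s, hf⟩
  le i j l hij hj hr := by
    obtain ⟨T', q, hT', hq⟩ := hv.exists_walk hr rfl
    obtain rfl := hv.triangulation_ext hT'
    have := h.le i j hij hj q
    omega

/-- An arc common to two triangulations of a geodesic path belongs to all the triangulations in
between. -/
theorem convex (h : IsGeoSeq k U) {i m j : ℕ} (him : i ≤ m) (hmj : m ≤ j) (hj : j ≤ k)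
    {e : Set Plane} (hi : e ∈ (U i).arcs) (hj' : e ∈ (U j).arcs) : e ∈ (U m).arcs := by
  obtain ⟨a, b, hab, rfl⟩ := Set.ncard_eq_two.1 ((U i).isArc e hi).2
  obtain ⟨v, n, hv, hn, rfl⟩ := P.exists_labelling one_ne_zero ((U i).left_mem hi)
  obtain ⟨b, hb, rfl⟩ := hv.surj b ((U i).right_mem hi)
  have hb0 : 0 < b := Nat.pos_of_ne_zero fun h0 => hab (by rw [h0])
  exact ((h.isGeo hv).convex him hmj hj hb0 ⟨hn, hb, hi⟩ ⟨hn, hb, hj'⟩).2.2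

section Fan

variable {a b c x : Plane} {m i j : ℕ}

/-- In a labelling from `a` with `b` before `c`, the arc `ax` crosses `bc` exactly when `x` is
between `b` and `c`; the labelled statement then applies. -/
theorem left_of_fan (h : IsGeoSeq k U) (hmi : m ≤ i) (hij : i ≤ j) (hj : j ≤ k)
    (hm : {a, b} ∈ (U m).arcs) (hc : {a, c} ∈ (U i).arcs) (hx : {a, x} ∈ (U i).arcs)
    (hcr : ¬NonCrossing {a, x} {b, c}) (hj' : {b, c} ∈ (U j).arcs) : {a, b} ∈ (U i).arcs := by
  obtain ⟨ε, v, n, b, c, hv, rfl, rfl, rfl, hb, hbc, hn⟩ :=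
    P.exists_labelling_of_ne ((U m).left_mem hm) ((U m).right_mem hm)
      ((U i).right_mem hc) ((U m).ne_of_mem hm) ((U i).ne_of_mem hc) ((U j).ne_of_mem hj')
  obtain ⟨x, hxn, rfl⟩ := hv.surj x ((U i).right_mem hx)
  have hx0 : 0 ≠ x := fun h0 => (U i).ne_of_mem hx (by rw [← h0])
  rw [hv.nonCrossing_iff (by omega) hxn (by omega) hn hx0, not_not] at hcr
  have : b < x ∧ x < c := by unfold Crosses at hcr; omega
  exact ((h.isGeo hv).left_of_fan hb hbc hmi hij hj ⟨by omega, by omega, hm⟩ ⟨by omega, hn, hc⟩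
    ⟨by omega, hxn, hx⟩ this.1 this.2 ⟨by omega, hn, hj'⟩).2.2

theorem left_succ_of_fan (h : IsGeoSeq k U) (hij : i < j) (hj : j ≤ k)
    (hb : {a, b} ∈ (U i).arcs) (hc : {a, c} ∈ (U i).arcs) (hx : {a, x} ∈ (U i).arcs)
    (hcr : ¬NonCrossing {a, x} {b, c}) (hj' : {b, c} ∈ (U j).arcs) :
    {a, b} ∈ (U (i + 1)).arcs := by
  by_contra hcon
  obtain ⟨ε, v, n, b, c, hv, rfl, rfl, rfl, hb0, hbc, hn⟩ :=
    P.exists_labelling_of_ne ((U i).left_mem hb) ((U i).right_mem hb)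
      ((U i).right_mem hc) ((U i).ne_of_mem hb) ((U i).ne_of_mem hc) ((U j).ne_of_mem hj')
  obtain ⟨x, hxn, rfl⟩ := hv.surj x ((U i).right_mem hx)
  have hx0 : 0 ≠ x := fun h0 => (U i).ne_of_mem hx (by rw [← h0])
  rw [hv.nonCrossing_iff (by omega) hxn (by omega) hn hx0, not_not] at hcr
  have : b < x ∧ x < c := by unfold Crosses at hcr; omega
  exact hcon ((h.isGeo hv).left_succ_of_fan hb0 hbc hij hj ⟨by omega, by omega, hb⟩
    ⟨by omega, hn, hc⟩ ⟨by omega, hxn, hx⟩ this.1 this.2 ⟨by omega, hn, hj'⟩).2.2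

end Fan

end IsGeoSeq

/-- If `b` is not an endpoint of the arc `ac`, then either `abc` is a triangle, or the triangle
incident to `ac` on the same side as `b` has an edge that crosses `bc` or `ab`. -/
theorem ConvexPolygon.Triangulation.exists_apex (T : P.Triangulation) {a b c : Plane}
    (hac : {a, c} ∈ T.arcs) (hb : b ∈ P.vertices) (hab : a ≠ b) (hbc : b ≠ c) :
    ({a, b} ∈ T.arcs ∧ {b, c} ∈ T.arcs) ∨
      (∃ x, {a, x} ∈ T.arcs ∧ ¬NonCrossing {a, x} {b, c}) ∨
      ∃ x, {c, x} ∈ T.arcs ∧ ¬NonCrossing {c, x} {a, b} := by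
  obtain ⟨ε, v, n, b, c, hv, rfl, rfl, rfl, hb0, hbc, hn⟩ :=
    P.exists_labelling_of_ne (T.left_mem hac) hb (T.right_mem hac) hab (T.ne_of_mem hac) hbc
  have hT := hv.isTri_labelRel T
  obtain ⟨x, hx0, hxc, hcr, h1, h2⟩ :=
    hT.exists_triangle (u := 0) (v := c) (y := b) ⟨by omega, hn, hac⟩ (by omega) (by omega)
      (by omega)
  have hxn := h1.2.1
  rcases lt_trichotomy x b with h | rfl | h
  · refine .inr (.inr ⟨v x, h2.2.2, ?_⟩)
    exact hv.not_nonCrossing hn hxn (by omega) (by omega) (by unfold Crosses; omega)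
  · exact .inl ⟨h1.2.2, (hT.symm h2).2.2⟩
  · refine .inr (.inl ⟨v x, h1.2.2, ?_⟩)
    refine hv.not_nonCrossing (by omega) hxn (by omega) hn ?_
    unfold Crosses at hcr ⊢; omega

namespace IsGeoSeq

variable {k : ℕ} {U : ℕ → P.Triangulation} {a b c x : Plane} {t₁ t₂ t₃ : ℕ}

/-- Consider the last time, before one of them leaves, at which `ab` and `ac` are both present.
Either `abc` is a triangle then, or an arc from `a` crosses `bc` and protects both from the next
flip. -/
theorem exists_triangle_of_fan (h : IsGeoSeq k U) (h12 : t₁ ≤ t₂) (h23 : t₂ ≤ t₃) (h3 : t₃ ≤ k)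
    (h₁ : {a, b} ∈ (U t₁).arcs) (h₂ : {a, c} ∈ (U t₂).arcs) (h₃ : {b, c} ∈ (U t₃).arcs)
    (hx : {a, x} ∈ (U t₂).arcs) (hcr : ¬NonCrossing {a, x} {b, c}) :
    ∃ t ≤ k, {a, b} ∈ (U t).arcs ∧ {a, c} ∈ (U t).arcs ∧ {b, c} ∈ (U t).arcs := by
  by_contra! hno
  have hb := h.left_of_fan h12 h23 h3 h₁ h₂ hx hcr h₃
  obtain ⟨t, ht2, ht3, ⟨hb', hc'⟩, hnot⟩ := exists_last
    (Q := fun t => {a, b} ∈ (U t).arcs ∧ {a, c} ∈ (U t).arcs) h23 ⟨hb, h₂⟩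
    fun hq => hno t₃ h3 hq.1 hq.2 h₃
  rcases (U t).exists_apex hc' ((U t).right_mem hb') ((U t).ne_of_mem hb')
    ((U t₃).ne_of_mem h₃) with ⟨_, hq⟩ | ⟨y, hy, hycr⟩ | ⟨y, hy, hycr⟩
  · exact hno t (by omega) hb' hc' hq
  -- The hypotheses are symmetric in `b` and `c`, so the same lemma protects `ac`.
  · refine hnot ⟨h.left_succ_of_fan ht3 h3 hb' hc' hy hycr h₃,
      h.left_succ_of_fan ht3 h3 hc' hb' hy ?_ ?_⟩
    · rwa [Set.pair_comm c b]
    · rwa [Set.pair_comm c b]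
  · exact hycr ((U t).nonCrossing _ hy _ hb')

theorem exists_triangle_of_le (h : IsGeoSeq k U) (h12 : t₁ ≤ t₂) (h23 : t₂ ≤ t₃) (h3 : t₃ ≤ k)
    (h₁ : {a, b} ∈ (U t₁).arcs) (h₂ : {a, c} ∈ (U t₂).arcs) (h₃ : {b, c} ∈ (U t₃).arcs) :
    ∃ t ≤ k, {a, b} ∈ (U t).arcs ∧ {a, c} ∈ (U t).arcs ∧ {b, c} ∈ (U t).arcs := by
  rcases (U t₂).exists_apex h₂ ((U t₁).right_mem h₁) ((U t₁).ne_of_mem h₁)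
    ((U t₃).ne_of_mem h₃) with hq | ⟨y, hy, hcr⟩ | ⟨y, hy, hcr⟩
  · exact ⟨t₂, by omega, hq.1, h₂, hq.2⟩
  · exact h.exists_triangle_of_fan h12 h23 h3 h₁ h₂ h₃ hy hcr
  -- The crossing arc starts at `c`: along the reversed path, `c` and `a` exchange roles and `bc`
  -- becomes the earliest arc.
  · have e : ∀ t ≤ k, k - (k - t) = t := fun t ht => by omega
    obtain ⟨t, ht, hq1, hq2, hq3⟩ := h.reverse.exists_triangle_of_fan (a := c) (b := b) (c := a)
      (x := y) (t₁ := k - t₃) (t₂ := k - t₂) (t₃ := k - t₁) (by omega) (by omega) (by omega)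
      (by rwa [e t₃ h3, Set.pair_comm]) (by rwa [e t₂ (by omega), Set.pair_comm])
      (by rwa [e t₁ (by omega), Set.pair_comm]) (by rwa [e t₂ (by omega)])
      (by rwa [Set.pair_comm b a])
    exact ⟨k - t, by omega, by rwa [Set.pair_comm], by rwa [Set.pair_comm], by rwa [Set.pair_comm]⟩

/-- When three arcs that join three vertices pairwise appear along a geodesic path, they appear
together in a triangulation of the path. -/
theorem exists_triangle (h : IsGeoSeq k U) (h1 : t₁ ≤ k) (h2 : t₂ ≤ k) (h3 : t₃ ≤ k)
    (h₁ : {a, b} ∈ (U t₁).arcs) (h₂ : {b, c} ∈ (U t₂).arcs) (h₃ : {c, a} ∈ (U t₃).arcs) :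
    ∃ t ≤ k, {a, b} ∈ (U t).arcs ∧ {b, c} ∈ (U t).arcs ∧ {c, a} ∈ (U t).arcs := by
  have comm : ∀ t (x y : Plane), {x, y} ∈ (U t).arcs → {y, x} ∈ (U t).arcs := fun t x y h => by
    rwa [Set.pair_comm]
  have key : ∀ {x y z t₁ t₂ t₃}, t₁ ≤ t₂ → t₂ ≤ t₃ → t₃ ≤ k → {x, y} ∈ (U t₁).arcs →
      {x, z} ∈ (U t₂).arcs → {y, z} ∈ (U t₃).arcs → ∃ t ≤ k, {x, y} ∈ (U t).arcs ∧
        {x, z} ∈ (U t).arcs ∧ {y, z} ∈ (U t).arcs :=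
    fun h1 h2 h3 h4 h5 h6 => h.exists_triangle_of_le h1 h2 h3 h4 h5 h6
  have h₁' := comm _ _ _ h₁
  have h₂' := comm _ _ _ h₂
  have h₃' := comm _ _ _ h₃
  have fin : ∀ {x y z : Plane}, (∃ t ≤ k, {x, y} ∈ (U t).arcs ∧
        {x, z} ∈ (U t).arcs ∧ {y, z} ∈ (U t).arcs) → ∃ t ≤ k, ∀ u w, (u = x ∨ u = y ∨ u = z) →
        (w = x ∨ w = y ∨ w = z) → u ≠ w → {u, w} ∈ (U t).arcs := by
    rintro x y z ⟨t, ht, h1, h2, h3⟩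
    refine ⟨t, ht, ?_⟩
    rintro u w (rfl | rfl | rfl) (rfl | rfl | rfl) hne <;>
      first | exact absurd rfl hne | assumption | exact comm _ _ _ ‹_›
  have hab := (U t₁).ne_of_mem h₁
  have hbc := (U t₂).ne_of_mem h₂
  have hca := (U t₃).ne_of_mem h₃
  rcases le_total t₁ t₂ with h12 | h12 <;> rcases le_total t₂ t₃ with h23 | h23 <;>
    rcases le_total t₁ t₃ with h13 | h13
  · obtain ⟨t, ht, hq⟩ := fin (key h12 h23 h3 h₁' h₂ h₃')
    exact ⟨t, ht, hq _ _ (by simp) (by simp) hab, hq _ _ (by simp) (by simp) hbc,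
      hq _ _ (by simp) (by simp) hca⟩
  · obtain ⟨t, ht, hq⟩ := fin (key h12 h23 h3 h₁' h₂ h₃')
    exact ⟨t, ht, hq _ _ (by simp) (by simp) hab, hq _ _ (by simp) (by simp) hbc,
      hq _ _ (by simp) (by simp) hca⟩
  · obtain ⟨t, ht, hq⟩ := fin (key h13 h23 h2 h₁ h₃' h₂)
    exact ⟨t, ht, hq _ _ (by simp) (by simp) hab, hq _ _ (by simp) (by simp) hbc,
      hq _ _ (by simp) (by simp) hca⟩
  · obtain ⟨t, ht, hq⟩ := fin (key h13 h12 h2 h₃' h₁ h₂')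
    exact ⟨t, ht, hq _ _ (by simp) (by simp) hab, hq _ _ (by simp) (by simp) hbc,
      hq _ _ (by simp) (by simp) hca⟩
  · obtain ⟨t, ht, hq⟩ := fin (key h12 h13 h3 h₂ h₁' h₃)
    exact ⟨t, ht, hq _ _ (by simp) (by simp) hab, hq _ _ (by simp) (by simp) hbc,
      hq _ _ (by simp) (by simp) hca⟩
  · obtain ⟨t, ht, hq⟩ := fin (key h23 h13 h1 h₂' h₃ h₁')
    exact ⟨t, ht, hq _ _ (by simp) (by simp) hab, hq _ _ (by simp) (by simp) hbc,
      hq _ _ (by simp) (by simp) hca⟩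
  · obtain ⟨t, ht, hq⟩ := fin (key h23 h12 h1 h₃ h₂' h₁)
    exact ⟨t, ht, hq _ _ (by simp) (by simp) hab, hq _ _ (by simp) (by simp) hbc,
      hq _ _ (by simp) (by simp) hca⟩
  · obtain ⟨t, ht, hq⟩ := fin (key h23 h12 h1 h₃ h₂' h₁)
    exact ⟨t, ht, hq _ _ (by simp) (by simp) hab, hq _ _ (by simp) (by simp) hbc,
      hq _ _ (by simp) (by simp) hca⟩

end IsGeoSeq
end FlipGraph

/-! ### The quadrilateral of a flip -/

namespace FlipGraph

open ConvexPolygon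

/-- A chord that crosses neither diagonal is cut off by a single side of the quadrilateral. -/
theorem pair_side {p q r s a b : ℕ} (h1 : p < q) (h2 : q < r) (h3 : r < s)
    (hpr : ¬Crosses a b p r) (hqs : ¬Crosses a b q s) :
    ((p ≤ a ∧ a ≤ q) ∧ p ≤ b ∧ b ≤ q) ∨ ((q ≤ a ∧ a ≤ r) ∧ q ≤ b ∧ b ≤ r) ∨
      ((r ≤ a ∧ a ≤ s) ∧ r ≤ b ∧ b ≤ s) ∨ ((a ≤ p ∨ s ≤ a) ∧ (b ≤ p ∨ s ≤ b)) := by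
  unfold Crosses at hpr hqs
  grind

variable {P : ConvexPolygon} {n : ℕ} {ε : ℝ} {v : ℕ → Plane}

/-- A triangle whose edges cross neither diagonal of a quadrilateral does not meet the interior of
the quadrilateral. -/
theorem IsLabelling.disjoint_interior_of_lt (hv : IsLabelling P n ε v) {p q r s a b c : ℕ}
    (h1 : p < q) (h2 : q < r) (h3 : r < s) (hs : s < n) (ha : a < n) (hb : b < n) (hc : c < n)
    (h : ∀ x y, (x = a ∨ x = b ∨ x = c) → (y = a ∨ y = b ∨ y = c) →
      ¬Crosses x y p r ∧ ¬Crosses x y q s) :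
    Disjoint (convexHull ℝ (v '' {a, b, c})) (interior (convexHull ℝ (v '' {p, q, r, s}))) := by
  have key := fun x y hx hy => pair_side h1 h2 h3 (h x y hx hy).1 (h x y hx hy).2
  have kab := key a b (by simp) (by simp)
  have kbc := key b c (by simp) (by simp)
  have kca := key c a (by simp) (by simp)
  have hA : ∀ x ∈ ({a, b, c} : Set ℕ), x < n := by rintro x (rfl | rfl | rfl) <;> assumption
  have hB : ∀ x ∈ ({p, q, r, s} : Set ℕ), x < n := by rintro x (rfl | rfl | rfl | rfl) <;> omega
  -- The edges of the triangle share endpoints, so one side of the quadrilateral cuts off all three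
  -- vertices.
  have : ((p ≤ a ∧ a ≤ q) ∧ (p ≤ b ∧ b ≤ q) ∧ p ≤ c ∧ c ≤ q) ∨
      ((q ≤ a ∧ a ≤ r) ∧ (q ≤ b ∧ b ≤ r) ∧ q ≤ c ∧ c ≤ r) ∨
      ((r ≤ a ∧ a ≤ s) ∧ (r ≤ b ∧ b ≤ s) ∧ r ≤ c ∧ c ≤ s) ∨
      ((a ≤ p ∨ s ≤ a) ∧ (b ≤ p ∨ s ≤ b) ∧ (c ≤ p ∨ s ≤ c)) := by
    rcases kab with k | k | k | k <;> rcases kbc with k' | k' | k' | k' <;> omega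
  rcases this with h | h | h | h
  · refine hv.disjoint_interior h1 (by omega) hA hB (.inl ⟨?_, ?_⟩)
    · rintro x (rfl | rfl | rfl) <;> omega
    · rintro x (rfl | rfl | rfl | rfl) <;> omega
  · refine hv.disjoint_interior h2 (by omega) hA hB (.inl ⟨?_, ?_⟩)
    · rintro x (rfl | rfl | rfl) <;> omega
    · rintro x (rfl | rfl | rfl | rfl) <;> omega
  · refine hv.disjoint_interior h3 (by omega) hA hB (.inl ⟨?_, ?_⟩)
    · rintro x (rfl | rfl | rfl) <;> omega
    · rintro x (rfl | rfl | rfl | rfl) <;> omega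
  · refine hv.disjoint_interior (u := p) (w := s) (by omega) (by omega) hA hB (.inr ⟨?_, ?_⟩)
    · rintro x (rfl | rfl | rfl | rfl) <;> omega
    · rintro x (rfl | rfl | rfl) <;> omega

theorem IsLabelling.disjoint_interior_of_crosses (hv : IsLabelling P n ε v) {p q r s a b c : ℕ}
    (hcr : Crosses p r q s) (hp : p < n) (hq : q < n) (hr : r < n) (hs : s < n) (ha : a < n)
    (hb : b < n) (hc : c < n)
    (h : ∀ x y, (x = a ∨ x = b ∨ x = c) → (y = a ∨ y = b ∨ y = c) →
      ¬Crosses x y p r ∧ ¬Crosses x y q s) :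
    Disjoint (convexHull ℝ (v '' {a, b, c})) (interior (convexHull ℝ (v '' {p, q, r, s}))) := by
  have cr : ∀ {x y z w : ℕ}, Crosses x y z w → Crosses x y w z := fun h => h.comm_right
  have key : ∀ p' q' r' s' : ℕ, p' < q' → q' < r' → r' < s' → s' < n →
      ({p, q, r, s} : Set ℕ) = {p', q', r', s'} →
      ((p' = p ∧ r' = r) ∨ (p' = r ∧ r' = p)) ∧ ((q' = q ∧ s' = s) ∨ (q' = s ∧ s' = q)) ∨
      ((p' = q ∧ r' = s) ∨ (p' = s ∧ r' = q)) ∧ ((q' = p ∧ s' = r) ∨ (q' = r ∧ s' = p)) →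
      Disjoint (convexHull ℝ (v '' {a, b, c})) (interior (convexHull ℝ (v '' {p, q, r, s}))) := by
    intro p' q' r' s' h1 h2 h3 h4 he hor
    rw [he]
    refine hv.disjoint_interior_of_lt h1 h2 h3 h4 ha hb hc fun x y hx hy => ?_
    obtain ⟨k1, k2⟩ := h x y hx hy
    have c1 : ¬Crosses x y r p := fun hc => k1 hc.comm_right
    have c2 : ¬Crosses x y s q := fun hc => k2 hc.comm_right
    clear he h
    rcases hor with ⟨⟨rfl, rfl⟩ | ⟨rfl, rfl⟩, ⟨rfl, rfl⟩ | ⟨rfl, rfl⟩⟩ |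
      ⟨⟨rfl, rfl⟩ | ⟨rfl, rfl⟩, ⟨rfl, rfl⟩ | ⟨rfl, rfl⟩⟩ <;>
      exact ⟨by assumption, by assumption⟩
  have hset : ∀ {p' q' r' s' : ℕ}, (∀ x, (x = p ∨ x = q ∨ x = r ∨ x = s) ↔
      (x = p' ∨ x = q' ∨ x = r' ∨ x = s')) → ({p, q, r, s} : Set ℕ) = {p', q', r', s'} :=
    fun h => Set.ext fun x => h x
  rcases hcr with ⟨h1, h2, h3 | h3⟩ | ⟨h1, h2, h3 | h3⟩ | ⟨h1, h2, h3 | h3⟩ | ⟨h1, h2, h3 | h3⟩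
  · exact key s p q r h3 h1 h2 hr (hset fun x => by omega) (by omega)
  · exact key p q r s h1 h2 h3 hs (hset fun x => by omega) (by omega)
  · exact key q p s r h3 h1 h2 hr (hset fun x => by omega) (by omega)
  · exact key p s r q h1 h2 h3 hq (hset fun x => by omega) (by omega)
  · exact key s r q p h3 h1 h2 hp (hset fun x => by omega) (by omega)
  · exact key r q p s h1 h2 h3 hs (hset fun x => by omega) (by omega)
  · exact key q r s p h3 h1 h2 hp (hset fun x => by omega) (by omega)
  · exact key r s p q h1 h2 h3 hq (hset fun x => by omega) (by omega)

/-- The elements of `s` are vertices of the polygon, pairwise joined by arcs of `T`. -/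
def Spans (T : P.Triangulation) (s : Set Plane) : Prop :=
  s ⊆ P.vertices ∧ ∀ x ∈ s, ∀ y ∈ s, x ≠ y → {x, y} ∈ T.arcs

theorem Spans.mono {T : P.Triangulation} {s s' : Set Plane} (h : Spans T s) (hs : s' ⊆ s) :
    Spans T s' :=
  ⟨hs.trans h.1, fun x hx y hy => h.2 x (hs hx) y (hs hy)⟩

theorem ConvexPolygon.vertices_nonempty (P : ConvexPolygon) : P.vertices.Nonempty := by
  rw [Set.nonempty_iff_ne_empty]
  intro h
  have := P.three_le_ncard
  simp [h] at this

/-- The quadrilateral of the flip between `T` and `T'`, given by its vertices. -/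
structure IsFlipQuad (T T' : P.Triangulation) (p q r s : Plane) : Prop where
  quad : flipQuad T T' = convexHull ℝ {p, q, r, s}
  sub : {p, q, r, s} ⊆ P.vertices
  diag : {p, r} ∈ T.arcs
  diag_not : {p, r} ∉ T'.arcs
  diag' : {q, s} ∈ T'.arcs
  diag_not' : {q, s} ∉ T.arcs
  left : ∀ e ∈ T.arcs, e ∉ T'.arcs → e = {p, r}
  right : ∀ e ∈ T'.arcs, e ∉ T.arcs → e = {q, s}
  spans : ∀ t ⊆ {p, q, r, s}, ¬(q ∈ t ∧ s ∈ t) → Spans T t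
  spans' : ∀ t ⊆ {p, q, r, s}, ¬(p ∈ t ∧ r ∈ t) → Spans T' t
  ncard : ({p, q, r, s} : Set Plane).ncard = 4
  disjoint : ∀ {a b c}, Spans T {a, b, c} → Spans T' {a, b, c} →
    Disjoint (convexHull ℝ {a, b, c}) (interior (flipQuad T T'))
  diag_interior : ∀ x ∈ convexHull ℝ {p, r}, x ∉ P.vertices → x ∈ interior (flipQuad T T')

theorem exists_isFlipQuad {T T' : P.Triangulation} (h : P.flipGraph.Adj T T') :
    ∃ p q r s, IsFlipQuad T T' p q r s := by
  obtain ⟨a, ha⟩ := P.vertices_nonempty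
  obtain ⟨v, n, hv, -, -⟩ := P.exists_labelling one_ne_zero ha
  obtain ⟨p, q, r, s, hf, he, he'⟩ := hv.exists_isFlip h
  have hp := hf.diag.1
  have hr := hf.diag.2.1
  have hq := hf.diag'.1
  have hs := hf.diag'.2.1
  have hd : {v p, v r} ∈ T.arcs \ T'.arcs := by rw [he]; rfl
  have hd' : {v q, v s} ∈ T'.arcs \ T.arcs := by rw [he']; rfl
  have hquad : flipQuad T T' = convexHull ℝ {v p, v q, v r, v s} := by
    unfold flipQuad
    rw [he, he']
    congr 1
    ext x
    simp only [Set.singleton_union, Set.sUnion_insert, Set.sUnion_singleton, Set.mem_union,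
      Set.mem_insert_iff, Set.mem_singleton_iff]
    tauto
  have hcrs := hf.crosses
  have hne : p ≠ q ∧ p ≠ r ∧ p ≠ s ∧ q ≠ r ∧ q ≠ s ∧ r ≠ s := by
    unfold Crosses at hcrs; omega
  have hinj : ∀ {i j}, i < n → j < n → i ≠ j → v i ≠ v j := fun hi hj hij h => hij (hv.inj _ hi _ hj h)
  have comm : ∀ {T : P.Triangulation} {x y : Plane}, {x, y} ∈ T.arcs → {y, x} ∈ T.arcs :=
    fun h => by rwa [Set.pair_comm]
  have hsub : ({v p, v q, v r, v s} : Set Plane) ⊆ P.vertices := by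
    rintro x (rfl | rfl | rfl | rfl) <;> exact hv.mem _ ‹_›
  refine ⟨v p, v q, v r, v s, hquad, hsub, hd.1, hd.2, hd'.1, hd'.2, ?_, ?_, ?_, ?_, ?_, ?_, ?_⟩
  · intro e h1 h2
    have : e ∈ T.arcs \ T'.arcs := ⟨h1, h2⟩
    rwa [he] at this
  · intro e h1 h2
    have : e ∈ T'.arcs \ T.arcs := ⟨h1, h2⟩
    rwa [he'] at this
  · intro t ht hqs
    refine ⟨ht.trans hsub, fun x hx y hy hxy => ?_⟩
    have h1 := hf.side₁.1.2.2
    have h2 := hf.side₂.1.2.2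
    have h3 := hf.side₃.1.2.2
    have h4 := hf.side₄.1.2.2
    rcases ht hx with rfl | rfl | rfl | rfl <;> rcases ht hy with rfl | rfl | rfl | rfl <;>
      first
      | exact absurd rfl hxy
      | assumption
      | exact comm ‹_›
      | exact hd.1
      | exact comm hd.1
      | exact absurd (And.intro hx hy) hqs
      | exact absurd (And.intro hy hx) hqs
  · intro t ht hpr
    refine ⟨ht.trans hsub, fun x hx y hy hxy => ?_⟩
    have h1 := hf.side₁.2.2.2
    have h2 := hf.side₂.2.2.2
    have h3 := hf.side₃.2.2.2
    have h4 := hf.side₄.2.2.2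
    rcases ht hx with rfl | rfl | rfl | rfl <;> rcases ht hy with rfl | rfl | rfl | rfl <;>
      first
      | exact absurd rfl hxy
      | assumption
      | exact comm ‹_›
      | exact hd'.1
      | exact comm hd'.1
      | exact absurd (And.intro hx hy) hpr
      | exact absurd (And.intro hy hx) hpr
  · have h1 := hinj hp hq hne.1
    have h2 := hinj hp hr hne.2.1
    have h3 := hinj hp hs hne.2.2.1
    have h4 := hinj hq hr hne.2.2.2.1
    have h5 := hinj hq hs hne.2.2.2.2.1
    have h6 := hinj hr hs hne.2.2.2.2.2
    rw [Set.ncard_insert_of_notMem (by simp [h1, h2, h3]), Set.ncard_insert_of_notMem (by simp [h4, h5]),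
      Set.ncard_pair h6]
  · intro a b c hT hT'
    obtain ⟨a, ha, rfl⟩ := hv.surj a (hT.1 (by simp))
    obtain ⟨b, hb, rfl⟩ := hv.surj b (hT.1 (by simp))
    obtain ⟨c, hc, rfl⟩ := hv.surj c (hT.1 (by simp))
    have := hv.disjoint_interior_of_crosses hcrs hp hq hr hs ha hb hc fun x y hx hy => ?_
    · rw [hquad]
      simpa only [Set.image_insert_eq, Set.image_singleton] using this
    have hxn : x < n := by rcases hx with rfl | rfl | rfl <;> assumption
    have hyn : y < n := by rcases hy with rfl | rfl | rfl <;> assumption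
    have hxm : v x ∈ ({v a, v b, v c} : Set Plane) := by rcases hx with rfl | rfl | rfl <;> simp
    have hym : v y ∈ ({v a, v b, v c} : Set Plane) := by rcases hy with rfl | rfl | rfl <;> simp
    by_cases hxy : x = y
    · subst hxy
      unfold Crosses; omega
    have hR : labelRel n v T x y := ⟨hxn, hyn, hT.2 _ hxm _ hym (hinj hxn hyn hxy)⟩
    have hS : labelRel n v T' x y := ⟨hxn, hyn, hT'.2 _ hxm _ hym (hinj hxn hyn hxy)⟩
    exact ⟨(hv.isTri_labelRel T).noncross hR hf.diag,
      (hv.isTri_labelRel T').noncross hS hf.diag'⟩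
  · intro x hx hxv
    rw [hquad]
    exact hv.mem_interior_quad hp hq hr hs hcrs hx (by rintro rfl; exact hxv (hv.mem p hp))
      (by rintro rfl; exact hxv (hv.mem r hr))

theorem IsFlipQuad.subset_region {T T' : P.Triangulation} {p q r s : Plane}
    (h : IsFlipQuad T T' p q r s) : flipQuad T T' ⊆ P.region := by
  rw [h.quad]; exact convexHull_mono h.sub

theorem IsFlipQuad.pair {T T' : P.Triangulation} {p q r s : Plane} (h : IsFlipQuad T T' p q r s)
    {x y : Plane} (hx : x ∈ ({p, q, r, s} : Set Plane)) (hy : y ∈ ({p, q, r, s} : Set Plane))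
    (hxy : x ≠ y) : {x, y} ∈ T.arcs ∨ {x, y} ∈ T'.arcs := by
  have hsub : ({x, y} : Set Plane) ⊆ {p, q, r, s} := by rintro z (rfl | rfl) <;> assumption
  by_cases hqs : q ∈ ({x, y} : Set Plane) ∧ s ∈ ({x, y} : Set Plane)
  · right
    have hne := T'.ne_of_mem h.diag'
    have : ({x, y} : Set Plane) = {q, s} := by
      rcases hqs with ⟨rfl | rfl, rfl | rfl⟩
      · exact absurd rfl hne
      · rfl
      · exact Set.pair_comm _ _
      · exact absurd rfl hne
    rw [this]; exact h.diag'
  · exact .inl ((h.spans _ hsub hqs).2 x (by simp) y (by simp) hxy)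

/-- Repetitions are allowed, so statements about `{x, y, z}` cover vertices, arcs and triangles
together. -/
theorem exists_triple {α : Type*} {s : Set α} (hne : s.Nonempty) (hf : s.Finite) (h : s.ncard ≤ 3) :
    ∃ x y z, s = {x, y, z} := by
  have hpos := (Set.ncard_pos hf).2 hne
  interval_cases hc : s.ncard
  · obtain ⟨x, rfl⟩ := Set.ncard_eq_one.1 hc
    exact ⟨x, x, x, by simp⟩
  · obtain ⟨x, y, _, rfl⟩ := Set.ncard_eq_two.1 hc
    exact ⟨x, y, y, by simp⟩
  · obtain ⟨x, y, z, _, _, _, rfl⟩ := Set.ncard_eq_three.1 hc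
    exact ⟨x, y, z, rfl⟩

theorem ncard_triple_le {α : Type*} (x y z : α) : ({x, y, z} : Set α).ncard ≤ 3 := by
  classical
  have : ({x, y, z} : Set α) = (({x, y, z} : Finset α) : Set α) := by simp
  rw [this, Set.ncard_coe_finset]
  exact Finset.card_le_three

end FlipGraph

/-! ### The disks above common simplices, and the abstract simplicial complex -/

namespace FlipGraph

open ConvexPolygon

section Lift

variable {f g : Plane → ℝ} {A B : Set Plane} {x : Plane}

theorem lift_singleton_subset_iff : lift f {x} ⊆ lift g A ↔ x ∈ A ∧ f x = g x := by
  constructor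
  · intro h
    exact @h (x, f x) ⟨rfl, rfl⟩
  · rintro ⟨h1, h2⟩ ⟨y, t⟩ ⟨hy, ht⟩
    obtain rfl : y = x := hy
    exact ⟨h1, ht.trans h2⟩

theorem lift_congr (h : Set.EqOn f g A) : lift f A = lift g A := by
  ext ⟨y, t⟩
  exact and_congr_right fun hy => by rw [h hy]

theorem lift_mono (h : A ⊆ B) : lift f A ⊆ lift f B := fun _ hx => ⟨h hx.1, hx.2⟩

theorem lift_subset_between (h : A ⊆ B) (hfg : ∀ x ∈ A, f x ≤ g x) :
    lift f A ⊆ between f g B :=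
  fun _ hx => ⟨h hx.1, hx.2.ge, hx.2.le.trans (hfg _ hx.1)⟩

theorem lift_subset_between' (h : A ⊆ B) (hfg : ∀ x ∈ A, f x ≤ g x) :
    lift g A ⊆ between f g B :=
  fun _ hx => ⟨h hx.1, (hfg _ hx.1).trans hx.2.ge, hx.2.le⟩

theorem fst_image_lift (f : Plane → ℝ) (A : Set Plane) : Prod.fst '' lift f A = A := by
  ext y
  constructor
  · rintro ⟨z, hz, rfl⟩
    exact hz.1
  · exact fun hy => ⟨(y, f y), ⟨hy, rfl⟩, rfl⟩

end Lift

variable {P : ConvexPolygon}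

/-- A vertex, an arc, or a triangle of a triangulation. -/
structure IsSimplex (T : P.Triangulation) (s : Set Plane) : Prop where
  spans : Spans T s
  nonempty : s.Nonempty
  ncard_le : s.ncard ≤ 3

namespace IsSimplex

variable {T : P.Triangulation} {s s' : Set Plane}

theorem finite (h : IsSimplex T s) : s.Finite := P.finite_vertices.subset h.spans.1

theorem mono (h : IsSimplex T s) (hs : s' ⊆ s) (hne : s'.Nonempty) : IsSimplex T s' :=
  ⟨h.spans.mono hs, hne, (Set.ncard_le_ncard hs h.finite).trans h.ncard_le⟩

theorem exists_triple (h : IsSimplex T s) : ∃ x y z, s = {x, y, z} :=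
  FlipGraph.exists_triple h.nonempty h.finite h.ncard_le

theorem singleton (T : P.Triangulation) {x : Plane} (hx : x ∈ P.vertices) : IsSimplex T {x} where
  spans := ⟨by simpa using hx, by rintro y rfl z rfl h; exact absurd rfl h⟩
  nonempty := Set.singleton_nonempty x
  ncard_le := by simp

theorem of_arc {e : Set Plane} (he : e ∈ T.arcs) : IsSimplex T e where
  spans := by
    refine ⟨(T.isArc e he).1, fun x hx y hy hxy => ?_⟩
    obtain ⟨a, b, hab, rfl⟩ := Set.ncard_eq_two.1 (T.isArc e he).2
    rcases hx with rfl | rfl <;> rcases hy with rfl | rfl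
    · exact absurd rfl hxy
    · exact he
    · rwa [Set.pair_comm]
    · exact absurd rfl hxy
  nonempty := Set.nonempty_of_ncard_ne_zero (by rw [(T.isArc e he).2]; decide)
  ncard_le := by rw [(T.isArc e he).2]; decide

theorem triple {a b c : Plane} (hab : {a, b} ∈ T.arcs) (hbc : {b, c} ∈ T.arcs)
    (hca : {c, a} ∈ T.arcs) : IsSimplex T {a, b, c} where
  spans := by
    have comm : ∀ {x y : Plane}, {x, y} ∈ T.arcs → {y, x} ∈ T.arcs :=
      fun h => by rwa [Set.pair_comm]
    refine ⟨?_, ?_⟩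
    · rintro x (rfl | rfl | rfl)
      · exact T.left_mem hab
      · exact T.left_mem hbc
      · exact T.left_mem hca
    · rintro x (rfl | rfl | rfl) y (rfl | rfl | rfl) hxy <;>
        first | exact absurd rfl hxy | assumption | exact comm ‹_›
  nonempty := Set.insert_nonempty _ _
  ncard_le := ncard_triple_le _ _ _

theorem subset_region (h : IsSimplex T s) : convexHull ℝ s ⊆ P.region := convexHull_mono h.spans.1

end IsSimplex

theorem IsGeoSeq.spans {k : ℕ} {U : ℕ → P.Triangulation} (h : IsGeoSeq k U) {i m j : ℕ}
    (him : i ≤ m) (hmj : m ≤ j) (hj : j ≤ k) {s : Set Plane} (hi : Spans (U i) s)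
    (hj' : Spans (U j) s) : Spans (U m) s :=
  ⟨hi.1, fun x hx y hy hxy => h.convex him hmj hj (hi.2 x hx y hy hxy) (hj'.2 x hx y hy hxy)⟩

variable {T T' : P.Triangulation} {p : P.flipGraph.Walk T T'} {f : ℕ → Plane → ℝ}

namespace ConvexPolygon.IsDiskSequence

theorem le_succ (hf : IsDiskSequence p f) {t : ℕ} (ht : t < p.length) {x : Plane}
    (hx : x ∈ P.region) : f t x ≤ f (t + 1) x := by
  by_cases h : x ∈ interior (flipQuad (p.getVert t) (p.getVert (t + 1)))
  · exact (hf.lt_inside t ht x h).le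
  · exact (hf.eq_outside t ht x ⟨hx, h⟩).ge

theorem le_of_le (hf : IsDiskSequence p f) {i j : ℕ} (hij : i ≤ j) (hj : j ≤ p.length) {x : Plane}
    (hx : x ∈ P.region) : f i x ≤ f j x := by
  induction j, hij using Nat.le_induction with
  | base => exact le_rfl
  | succ j hij ih => exact (ih (by omega)).trans (hf.le_succ (by omega) hx)

/-- A simplex that survives the flip avoids the interior of its quadrilateral, where alone the disks
differ. -/
theorem eqOn_succ (hf : IsDiskSequence p f) {t : ℕ} (ht : t < p.length) {s : Set Plane}
    (h : IsSimplex (p.getVert t) s) (h' : Spans (p.getVert (t + 1)) s) :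
    Set.EqOn (f t) (f (t + 1)) (convexHull ℝ s) := by
  obtain ⟨_, _, _, _, hq⟩ := exists_isFlipQuad (p.adj_getVert_succ ht)
  have hsub := h.subset_region
  have hs := h.spans
  obtain ⟨x, y, z, rfl⟩ := h.exists_triple
  exact fun w hw => (hf.eq_outside t ht w
    ⟨hsub hw, Set.disjoint_left.1 (hq.disjoint hs h') hw⟩).symm

/-- By convexity the simplex belongs to every triangulation in between, so the disks agree step by
step. -/
theorem eqOn_of_le (hf : IsDiskSequence p f) (hp : IsGeodesic p) {i j : ℕ} (hij : i ≤ j)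
    (hj : j ≤ p.length) {s : Set Plane} (h : IsSimplex (p.getVert i) s)
    (h' : Spans (p.getVert j) s) : Set.EqOn (f i) (f j) (convexHull ℝ s) := by
  induction j, hij using Nat.le_induction with
  | base => exact fun _ _ => rfl
  | succ j hij ih =>
    have hs := hp.isGeoSeq.spans hij (Nat.le_succ j) hj h.spans h'
    exact (ih (by omega) hs).trans
      (hf.eqOn_succ (by omega) ⟨hs, h.nonempty, h.ncard_le⟩ h')

/-- The disks coincide above a common simplex of the corresponding triangulations. -/
theorem eqOn (hf : IsDiskSequence p f) (hp : IsGeodesic p) {i j : ℕ} (hi : i ≤ p.length)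
    (hj : j ≤ p.length) {s : Set Plane} (h : IsSimplex (p.getVert i) s)
    (h' : IsSimplex (p.getVert j) s) : Set.EqOn (f i) (f j) (convexHull ℝ s) := by
  rcases le_total i j with hij | hij
  · exact hf.eqOn_of_le hp hij hj h h'.spans
  · exact (hf.eqOn_of_le hp hij hi h' h.spans).symm

theorem eq_zero (hf : IsDiskSequence p f) (hp : IsGeodesic p) {i : ℕ} (hi : i ≤ p.length)
    {x : Plane} (hx : x ∈ P.vertices) : f i x = f 0 x :=
  hf.eqOn hp hi (Nat.zero_le _) (IsSimplex.singleton _ hx) (IsSimplex.singleton _ hx)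
    (by simp)

end ConvexPolygon.IsDiskSequence

/-- The vertex of the blow-up triangulation above a vertex of the polygon. -/
def vertexAbove (f : ℕ → Plane → ℝ) (x : Plane) : Set Space := lift (f 0) {x}

theorem vertexAbove_injective (f : ℕ → Plane → ℝ) : Function.Injective (vertexAbove f) := by
  intro x y h
  exact (lift_singleton_subset_iff.1 h.subset).1

theorem blowUp_vertices (hp : IsGeodesic p) (hf : IsDiskSequence p f) :
    (blowUp p f).vertices = vertexAbove f '' P.vertices := by
  ext σ
  constructor
  · rintro ⟨i, hi, x, hx, rfl⟩
    refine ⟨x, hx, lift_congr ?_⟩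
    rintro y rfl
    exact (hf.eq_zero hp hi hx).symm
  · rintro ⟨x, hx, rfl⟩
    exact ⟨0, Nat.zero_le _, x, hx, rfl⟩

theorem mem_faces_iff {σ : Set Space} : σ ∈ (blowUp p f).faces ↔
    (∃ i ≤ p.length, ∃ s, IsSimplex (p.getVert i) s ∧ σ = lift (f i) (convexHull ℝ s)) ∨
      σ ∈ (blowUp p f).tetrahedra := by
  constructor
  · rintro (((⟨i, hi, x, hx, rfl⟩ | ⟨i, hi, e, he, rfl⟩) | ⟨i, hi, t, ht, rfl⟩) | h)
    · exact .inl ⟨i, hi, {x}, IsSimplex.singleton _ hx, by rw [convexHull_singleton]⟩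
    · exact .inl ⟨i, hi, e, IsSimplex.of_arc he, rfl⟩
    · obtain ⟨a, b, c, rfl, hab, hbc, hca⟩ := ht
      exact .inl ⟨i, hi, _, IsSimplex.triple hab hbc hca, rfl⟩
    · exact .inr h
  · rintro (⟨i, hi, s, hs, rfl⟩ | h)
    · left
      have hpos := (Set.ncard_pos hs.finite).2 hs.nonempty
      have hle := hs.ncard_le
      have hsp := hs.spans
      interval_cases hc : s.ncard
      · obtain ⟨x, rfl⟩ := Set.ncard_eq_one.1 hc
        exact .inl (.inl ⟨i, hi, x, hsp.1 rfl, by rw [convexHull_singleton]⟩)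
      · obtain ⟨x, y, hxy, rfl⟩ := Set.ncard_eq_two.1 hc
        exact .inl (.inr ⟨i, hi, _, hsp.2 x (by simp) y (by simp) hxy, rfl⟩)
      · obtain ⟨x, y, z, hxy, hxz, hyz, rfl⟩ := Set.ncard_eq_three.1 hc
        exact .inr ⟨i, hi, _, ⟨x, y, z, rfl, hsp.2 x (by simp) y (by simp) hxy,
          hsp.2 y (by simp) z (by simp) hyz, hsp.2 z (by simp) x (by simp) hxz.symm⟩, rfl⟩
    · exact .inr h

theorem vertexSet_lift (hp : IsGeodesic p) (hf : IsDiskSequence p f) {i : ℕ} (hi : i ≤ p.length)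
    {s : Set Plane} (hs : s ⊆ P.vertices) :
    (blowUp p f).vertexSet (lift (f i) (convexHull ℝ s)) = vertexAbove f '' s := by
  ext σ
  unfold Complex3.vertexSet
  rw [blowUp_vertices hp hf]
  constructor
  · rintro ⟨⟨x, hx, rfl⟩, h⟩
    exact ⟨x, P.mem_of_mem_convexHull hx hs (lift_singleton_subset_iff.1 h).1, rfl⟩
  · rintro ⟨x, hx, rfl⟩
    exact ⟨⟨x, hs hx, rfl⟩, lift_singleton_subset_iff.2
      ⟨subset_convexHull ℝ s hx, (hf.eq_zero hp hi (hs hx)).symm⟩⟩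

theorem vertexSet_between (hp : IsGeodesic p) (hf : IsDiskSequence p f) {i : ℕ}
    (hi : i < p.length) {a b c d : Plane}
    (h : IsFlipQuad (p.getVert i) (p.getVert (i + 1)) a b c d) :
    (blowUp p f).vertexSet
      (between (f i) (f (i + 1)) (flipQuad (p.getVert i) (p.getVert (i + 1)))) =
        vertexAbove f '' {a, b, c, d} := by
  ext σ
  unfold Complex3.vertexSet
  rw [blowUp_vertices hp hf]
  constructor
  · rintro ⟨⟨x, hx, rfl⟩, hsub⟩
    refine ⟨x, P.mem_of_mem_convexHull hx h.sub ?_, rfl⟩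
    rw [← h.quad]
    exact (@hsub (x, f 0 x) ⟨rfl, rfl⟩).1
  · rintro ⟨x, hx, rfl⟩
    refine ⟨⟨x, h.sub hx, rfl⟩, ?_⟩
    rintro ⟨y, t⟩ ⟨hy, ht⟩
    obtain rfl : y = x := hy
    obtain rfl : t = f 0 y := ht
    refine ⟨by rw [h.quad]; exact subset_convexHull ℝ _ hx, ?_, ?_⟩
    · exact (hf.eq_zero hp hi.le (h.sub hx)).le
    · exact (hf.eq_zero hp (i := i + 1) hi (h.sub hx)).ge

/-- Each vertex of the polygon has a single vertex above it, so vertex sets can be compared in the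
plane. -/
theorem isAbstractSimplicialComplex (hp : IsGeodesic p) (hf : IsDiskSequence p f) :
    (blowUp p f).IsAbstractSimplicialComplex := by
  have hU := hp.isGeoSeq
  have himg : ∀ {s s' : Set Plane}, vertexAbove f '' s = vertexAbove f '' s' → s = s' :=
    fun h => (vertexAbove_injective f).image_injective h
  have hno : ∀ {i j : ℕ}, i ≤ p.length → ∀ {s : Set Plane}, IsSimplex (p.getVert i) s →
      j < p.length → (blowUp p f).vertexSet (lift (f i) (convexHull ℝ s)) ≠
        (blowUp p f).vertexSet
          (between (f j) (f (j + 1)) (flipQuad (p.getVert j) (p.getVert (j + 1)))) := by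
    intro i j hi s hs hj heq
    obtain ⟨a, b, c, d, hq⟩ := exists_isFlipQuad (hU.adj j hj)
    rw [vertexSet_lift hp hf hi hs.spans.1, vertexSet_between hp hf hj hq] at heq
    have := hs.ncard_le
    rw [himg heq, hq.ncard] at this
    omega
  have htet : ∀ {i j : ℕ}, i < j → j < p.length → (blowUp p f).vertexSet
      (between (f i) (f (i + 1)) (flipQuad (p.getVert i) (p.getVert (i + 1)))) ≠
        (blowUp p f).vertexSet
          (between (f j) (f (j + 1)) (flipQuad (p.getVert j) (p.getVert (j + 1)))) := by
    intro i j hij hj heq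
    obtain ⟨a, b, c, d, hq⟩ := exists_isFlipQuad (hU.adj i (hij.trans hj))
    obtain ⟨a', b', c', d', hq'⟩ := exists_isFlipQuad (hU.adj j hj)
    rw [vertexSet_between hp hf (hij.trans hj) hq, vertexSet_between hp hf hj hq'] at heq
    have heq := himg heq
    have ha : a ∈ ({a', b', c', d'} : Set Plane) := heq ▸ (by simp)
    have hc : c ∈ ({a', b', c', d'} : Set Plane) := heq ▸ (by simp)
    -- The diagonal `ac` removed by flip `i` would be an arc again at time `j` or `j + 1`, against
    -- convexity.
    rcases hq'.pair ha hc ((p.getVert i).ne_of_mem hq.diag) with h | h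
    · exact hq.diag_not (hU.convex (Nat.le_succ i) hij hj.le hq.diag h)
    · exact hq.diag_not (hU.convex (Nat.le_succ i) (by omega) hj hq.diag h)
  refine ⟨?_, ?_⟩
  · intro σ hσ τ hτ heq
    rcases mem_faces_iff.1 hσ with ⟨i, hi, s, hs, rfl⟩ | ⟨i, hi, rfl⟩ <;>
      rcases mem_faces_iff.1 hτ with ⟨j, hj, s', hs', rfl⟩ | ⟨j, hj, rfl⟩
    · rw [vertexSet_lift hp hf hi hs.spans.1, vertexSet_lift hp hf hj hs'.spans.1] at heq
      obtain rfl := himg heq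
      exact lift_congr (hf.eqOn hp hi hj hs hs')
    · exact absurd heq (hno hi hs hj)
    · exact absurd heq.symm (hno hj hs' hi)
    · rcases lt_trichotomy i j with h | rfl | h
      · exact absurd heq (htet h hj)
      · rfl
      · exact absurd heq.symm (htet h hi)
  · intro σ hσ
    rcases mem_faces_iff.1 hσ with ⟨i, hi, s, hs, rfl⟩ | ⟨i, hi, rfl⟩
    · rw [vertexSet_lift hp hf hi hs.spans.1]
      refine ⟨hs.nonempty.image _, hs.finite.image _, fun t ht hne => ?_⟩
      obtain ⟨t, hts, rfl⟩ := Set.subset_image_iff.1 ht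
      refine ⟨lift (f i) (convexHull ℝ t), mem_faces_iff.2
        (.inl ⟨i, hi, t, hs.mono hts (Set.image_nonempty.1 hne), rfl⟩),
        lift_mono (convexHull_mono hts), vertexSet_lift hp hf hi (hts.trans hs.spans.1)⟩
    · obtain ⟨a, b, c, d, hq⟩ := exists_isFlipQuad (hU.adj i hi)
      have hfin : ({a, b, c, d} : Set Plane).Finite := P.finite_vertices.subset hq.sub
      have hvs := vertexSet_between hp hf hi hq
      rw [hvs]
      refine ⟨(Set.insert_nonempty _ _).image _, hfin.image _, fun t ht hne => ?_⟩
      obtain ⟨t, hts, rfl⟩ := Set.subset_image_iff.1 ht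
      have hne := Set.image_nonempty.1 hne
      have hle := Set.ncard_le_ncard hts hfin
      rw [hq.ncard] at hle
      have hconv : convexHull ℝ t ⊆ flipQuad (p.getVert i) (p.getVert (i + 1)) := by
        rw [hq.quad]; exact convexHull_mono hts
      have hmon : ∀ x ∈ convexHull ℝ t, f i x ≤ f (i + 1) x := fun x hx =>
        hf.le_succ hi (hq.subset_region (hconv hx))
      rcases hle.lt_or_eq with hlt | heq
      -- A proper subset of the four vertices misses an end of one diagonal: it spans a simplex of
      -- the lower disk, or of the upper disk if it contains both `b` and `d`.
      · by_cases hbd : b ∈ t ∧ d ∈ t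
        · have hac : ¬(a ∈ t ∧ c ∈ t) := by
            intro hac
            have : ({a, b, c, d} : Set Plane) ⊆ t := by
              rintro x (rfl | rfl | rfl | rfl)
              exacts [hac.1, hbd.1, hac.2, hbd.2]
            have := Set.ncard_le_ncard this (hfin.subset hts)
            rw [hq.ncard] at this
            omega
          have hs : IsSimplex (p.getVert (i + 1)) t := ⟨hq.spans' t hts hac, hne, by omega⟩
          exact ⟨lift (f (i + 1)) (convexHull ℝ t), mem_faces_iff.2 (.inl ⟨i + 1, hi, t, hs, rfl⟩),
            lift_subset_between' hconv hmon, vertexSet_lift hp hf hi hs.spans.1⟩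
        · have hs : IsSimplex (p.getVert i) t := ⟨hq.spans t hts hbd, hne, by omega⟩
          exact ⟨lift (f i) (convexHull ℝ t), mem_faces_iff.2 (.inl ⟨i, hi.le, t, hs, rfl⟩),
            lift_subset_between hconv hmon, vertexSet_lift hp hf hi.le hs.spans.1⟩
      · obtain rfl := Set.eq_of_subset_of_ncard_le hts (by rw [hq.ncard, heq]) hfin
        exact ⟨_, hσ, subset_rfl, hvs⟩

end FlipGraph

/-! ### Flagness: cliques of three, four and five vertices -/

namespace FlipGraph

open ConvexPolygon

theorem eq_diagonal_of_crosses {a b c d x y : ℕ} (h : Crosses a c b d) (hbd : Crosses b d x y)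
    (h1 : ¬Crosses a b x y) (h2 : ¬Crosses b c x y) (h3 : ¬Crosses c d x y)
    (h4 : ¬Crosses d a x y) : (x = a ∧ y = c) ∨ (x = c ∧ y = a) := by
  unfold Crosses at *
  grind (splits := 40)

variable {P : ConvexPolygon}

/-- With the four sides present, the only arc that could prevent `bd` is `ac`. -/
theorem ConvexPolygon.Triangulation.mem_of_sides (T : P.Triangulation) {a b c d : Plane}
    (hcr : ¬NonCrossing {a, c} {b, d}) (hab : {a, b} ∈ T.arcs) (hbc : {b, c} ∈ T.arcs)
    (hcd : {c, d} ∈ T.arcs) (hda : {d, a} ∈ T.arcs) (hac : {a, c} ∉ T.arcs) (hne : a ≠ c)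
    (hne' : b ≠ d) : {b, d} ∈ T.arcs := by
  obtain ⟨v, n, hv, -, -⟩ := P.exists_labelling one_ne_zero (T.left_mem hab)
  obtain ⟨a, ha, rfl⟩ := hv.surj a (T.left_mem hab)
  obtain ⟨b, hb, rfl⟩ := hv.surj b (T.left_mem hbc)
  obtain ⟨c, hc, rfl⟩ := hv.surj c (T.left_mem hcd)
  obtain ⟨d, hd, rfl⟩ := hv.surj d (T.left_mem hda)
  have hne : a ≠ c := fun h => hne (by rw [h])
  have hne' : b ≠ d := fun h => hne' (by rw [h])
  have hT := hv.isTri_labelRel T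
  rw [hv.nonCrossing_iff ha hc hb hd hne, not_not] at hcr
  refine (hT.maximal hb hd hne' fun x y hxy hcon => ?_).2.2
  rcases eq_diagonal_of_crosses hcr hcon (hT.noncross ⟨ha, hb, hab⟩ hxy)
    (hT.noncross ⟨hb, hc, hbc⟩ hxy) (hT.noncross ⟨hc, hd, hcd⟩ hxy)
    (hT.noncross ⟨hd, ha, hda⟩ hxy) with ⟨rfl, rfl⟩ | ⟨rfl, rfl⟩
  · exact hac hxy.2.2
  · exact hac (hT.symm hxy).2.2

namespace IsGeoSeq

variable {k : ℕ} {U : ℕ → P.Triangulation}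

/-- Crossing arcs appear along a geodesic path one after the other. -/
theorem separated (h : IsGeoSeq k U) {e e' : Set Plane} (hcr : ¬NonCrossing e e')
    {s s' t t' : ℕ} (hs : s ≤ k) (hs' : s' ≤ k) (ht : t ≤ k) (ht' : t' ≤ k)
    (h1 : e ∈ (U s).arcs) (h2 : e ∈ (U s').arcs) (h3 : e' ∈ (U t).arcs) (h4 : e' ∈ (U t').arcs) :
    (s < t ∧ s < t' ∧ s' < t ∧ s' < t') ∨ (t < s ∧ t < s' ∧ t' < s ∧ t' < s') := by
  have no : ∀ m, e ∈ (U m).arcs → e' ∉ (U m).arcs := fun m he he' =>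
    hcr ((U m).nonCrossing e he e' he')
  have key : ∀ x y z, x ≤ y → y ≤ z → z ≤ k → e ∈ (U x).arcs → e ∈ (U z).arcs → e' ∉ (U y).arcs :=
    fun x y z hxy hyz hz hx hz' => no y (h.convex hxy hyz hz hx hz')
  have key' : ∀ x y z, x ≤ y → y ≤ z → z ≤ k → e' ∈ (U x).arcs → e' ∈ (U z).arcs →
      e ∉ (U y).arcs :=
    fun x y z hxy hyz hz hx hz' he => no y he (h.convex hxy hyz hz hx hz')
  have a1 : ¬(s ≤ t ∧ t ≤ s') := fun h => key s t s' h.1 h.2 hs' h1 h2 h3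
  have a2 : ¬(s' ≤ t ∧ t ≤ s) := fun h => key s' t s h.1 h.2 hs h2 h1 h3
  have a3 : ¬(s ≤ t' ∧ t' ≤ s') := fun h => key s t' s' h.1 h.2 hs' h1 h2 h4
  have a4 : ¬(s' ≤ t' ∧ t' ≤ s) := fun h => key s' t' s h.1 h.2 hs h2 h1 h4
  have b1 : ¬(t ≤ s ∧ s ≤ t') := fun h => key' t s t' h.1 h.2 ht' h3 h4 h1
  have b2 : ¬(t' ≤ s ∧ s ≤ t) := fun h => key' t' s t h.1 h.2 ht h4 h3 h1
  have b3 : ¬(t ≤ s' ∧ s' ≤ t') := fun h => key' t s' t' h.1 h.2 ht' h3 h4 h2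
  have b4 : ¬(t' ≤ s' ∧ s' ≤ t) := fun h => key' t' s' t h.1 h.2 ht h4 h3 h2
  clear key key' no
  omega

theorem exists_isSimplex (h : IsGeoSeq k U) {s : Set Plane} (hs : s ⊆ P.vertices)
    (hne : s.Nonempty) (hcard : s.ncard ≤ 3)
    (hJ : ∀ x ∈ s, ∀ y ∈ s, x ≠ y → ∃ t ≤ k, {x, y} ∈ (U t).arcs) :
    ∃ t ≤ k, IsSimplex (U t) s := by
  have hpos := (Set.ncard_pos (P.finite_vertices.subset hs)).2 hne
  interval_cases hc : s.ncard
  · obtain ⟨x, rfl⟩ := Set.ncard_eq_one.1 hc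
    exact ⟨0, Nat.zero_le k, IsSimplex.singleton _ (hs rfl)⟩
  · obtain ⟨x, y, hxy, rfl⟩ := Set.ncard_eq_two.1 hc
    obtain ⟨t, ht, hmem⟩ := hJ x (by simp) y (by simp) hxy
    exact ⟨t, ht, IsSimplex.of_arc hmem⟩
  · obtain ⟨x, y, z, hxy, hxz, hyz, rfl⟩ := Set.ncard_eq_three.1 hc
    obtain ⟨t₁, h1, h1'⟩ := hJ x (by simp) y (by simp) hxy
    obtain ⟨t₂, h2, h2'⟩ := hJ y (by simp) z (by simp) hyz
    obtain ⟨t₃, h3, h3'⟩ := hJ z (by simp) x (by simp) hxz.symm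
    obtain ⟨t, ht, ha, hb, hc⟩ := h.exists_triangle h1 h2 h3 h1' h2' h3'
    exact ⟨t, ht, IsSimplex.triple ha hb hc⟩

/-- The times at which `ac` occurs precede those at which `bd` occurs. When `ac` leaves, convexity
keeps the four sides, so `bd` enters at the same flip. -/
theorem exists_isFlipQuad_of_lt (h : IsGeoSeq k U) {a b c d : Plane}
    (hcr : ¬NonCrossing {a, c} {b, d}) (hne : a ≠ c) (hne' : b ≠ d) (hab : a ≠ b) (hbc : b ≠ c)
    (hcd : c ≠ d) (hda : d ≠ a) {t₁ t₂ t₃ t₄ : ℕ} (h1 : t₁ ≤ k) (h2 : t₂ ≤ k)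
    (h3 : t₃ ≤ k) (h4 : t₄ ≤ k) (h1' : Spans (U t₁) {a, b, c}) (h2' : Spans (U t₂) {a, c, d})
    (h3' : Spans (U t₃) {a, b, d}) (h4' : Spans (U t₄) {b, c, d}) (hlt : t₁ < t₃) :
    ∃ t < k, ∃ p q r s, IsFlipQuad (U t) (U (t + 1)) p q r s ∧
      ({a, b, c, d} : Set Plane) = {p, q, r, s} := by
  have hsep := h.separated hcr h1 h2 h3 h4 (h1'.2 a (by simp) c (by simp) hne)
    (h2'.2 a (by simp) c (by simp) hne) (h3'.2 b (by simp) d (by simp) hne')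
    (h4'.2 b (by simp) d (by simp) hne')
  have hac : {a, c} ∈ (U (max t₁ t₂)).arcs := by
    rcases le_total t₁ t₂ with hle | hle
    · rw [max_eq_right hle]; exact h2'.2 a (by simp) c (by simp) hne
    · rw [max_eq_left hle]; exact h1'.2 a (by simp) c (by simp) hne
  have hbd : {b, d} ∈ (U (min t₃ t₄)).arcs := by
    rcases le_total t₃ t₄ with hle | hle
    · rw [min_eq_left hle]; exact h3'.2 b (by simp) d (by simp) hne'
    · rw [min_eq_right hle]; exact h4'.2 b (by simp) d (by simp) hne'
  obtain ⟨t, ht, ht', hacm, hacm'⟩ := exists_last (Q := fun t => {a, c} ∈ (U t).arcs)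
    (show max t₁ t₂ ≤ min t₃ t₄ by omega) hac
    fun hq => hcr ((U _).nonCrossing _ hq _ hbd)
  have hbdm : {b, d} ∈ (U (t + 1)).arcs := by
    refine (U (t + 1)).mem_of_sides hcr ?_ ?_ ?_ ?_ hacm' hne hne'
    · exact h.convex (i := t₁) (j := t₃) (by omega) (by omega) h3
        (h1'.2 a (by simp) b (by simp) hab) (h3'.2 a (by simp) b (by simp) hab)
    · exact h.convex (i := t₁) (j := t₄) (by omega) (by omega) h4
        (h1'.2 b (by simp) c (by simp) hbc) (h4'.2 b (by simp) c (by simp) hbc)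
    · exact h.convex (i := t₂) (j := t₄) (by omega) (by omega) h4
        (h2'.2 c (by simp) d (by simp) hcd) (h4'.2 c (by simp) d (by simp) hcd)
    · exact h.convex (i := t₂) (j := t₃) (by omega) (by omega) h3
        (h2'.2 d (by simp) a (by simp) hda) (h3'.2 d (by simp) a (by simp) hda)
  have htk : t < k := by omega
  obtain ⟨p, q, r, s, hq⟩ := exists_isFlipQuad (h.adj t htk)
  refine ⟨t, htk, p, q, r, s, hq, ?_⟩
  have e1 := hq.left _ hacm hacm'
  have e2 := hq.right _ hbdm fun hm => hcr ((U t).nonCrossing _ hacm _ hm)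
  have e : ∀ x y z w : Plane, ({x, y, z, w} : Set Plane) = {x, z} ∪ {y, w} := by
    intro x y z w
    ext u
    simp only [Set.mem_insert_iff, Set.mem_singleton_iff, Set.mem_union]
    tauto
  rw [e, e p, e1, e2]

theorem exists_isFlipQuad_of_crosses (h : IsGeoSeq k U) {a b c d : Plane}
    (hs : {a, b, c, d} ⊆ P.vertices)
    (hcr : ¬NonCrossing {a, c} {b, d}) (hne : a ≠ c) (hne' : b ≠ d) (hab : a ≠ b) (hbc : b ≠ c)
    (hcd : c ≠ d) (hda : d ≠ a) (hJ : ∀ x ∈ ({a, b, c, d} : Set Plane),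
      ∀ y ∈ ({a, b, c, d} : Set Plane), x ≠ y → ∃ t ≤ k, {x, y} ∈ (U t).arcs) :
    ∃ t < k, ∃ p q r s, IsFlipQuad (U t) (U (t + 1)) p q r s ∧
      ({a, b, c, d} : Set Plane) = {p, q, r, s} := by
  have key : ∀ {x y z : Plane}, ({x, y, z} : Set Plane) ⊆ {a, b, c, d} →
      ∃ t ≤ k, Spans (U t) {x, y, z} := by
    intro x y z hsub
    obtain ⟨t, ht, hspan⟩ := h.exists_isSimplex (hsub.trans hs) (Set.insert_nonempty _ _)
      (ncard_triple_le x y z) fun x hx y hy => hJ x (hsub hx) y (hsub hy)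
    exact ⟨t, ht, hspan.spans⟩
  obtain ⟨t₁, h1, h1'⟩ := @key a b c (by grind)
  obtain ⟨t₂, h2, h2'⟩ := @key a c d (by grind)
  obtain ⟨t₃, h3, h3'⟩ := @key a b d (by grind)
  obtain ⟨t₄, h4, h4'⟩ := @key b c d (by grind)
  rcases lt_trichotomy t₁ t₃ with hlt | heq | hlt
  · exact h.exists_isFlipQuad_of_lt hcr hne hne' hab hbc hcd hda h1 h2 h3 h4 h1' h2' h3' h4' hlt
  · subst heq
    exact absurd ((U t₁).nonCrossing _ (h1'.2 a (by simp) c (by simp) hne) _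
      (h3'.2 b (by simp) d (by simp) hne')) hcr
  -- Here `bd` occurs first; a cyclic shift of the four vertices exchanges the diagonals.
  · have hsep := h.separated hcr h1 h2 h3 h4 (h1'.2 a (by simp) c (by simp) hne)
      (h2'.2 a (by simp) c (by simp) hne) (h3'.2 b (by simp) d (by simp) hne')
      (h4'.2 b (by simp) d (by simp) hne')
    have hcr' : ¬NonCrossing {b, d} {c, a} := by
      intro hcon
      apply hcr
      unfold NonCrossing at hcon ⊢
      rwa [Set.inter_comm, Set.inter_comm {a, c}, Set.pair_comm a c]
    have e1 : ({b, d, a} : Set Plane) = {a, b, d} := by grind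
    have e2 : ({b, c, a} : Set Plane) = {a, b, c} := by grind
    have e3 : ({c, d, a} : Set Plane) = {a, c, d} := by grind
    have e4 : ({a, b, c, d} : Set Plane) = {b, c, d, a} := by grind
    rw [e4]
    exact h.exists_isFlipQuad_of_lt hcr' hne' hne.symm hbc hcd hda hab h4 h3 h1 h2 h4'
      (e1 ▸ h3') (e2 ▸ h1') (e3 ▸ h2') (by omega)

end IsGeoSeq

theorem IsLabelling.exists_strictMono {n : ℕ} {ε : ℝ} {v : ℕ → Plane} (hv : IsLabelling P n ε v)
    {s : Set Plane} (hs : s ⊆ P.vertices) {m : ℕ} (hm : m ≤ s.ncard) :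
    ∃ g : Fin m → ℕ, StrictMono g ∧ ∀ i, g i < n ∧ v (g i) ∈ s := by
  classical
  let I : Finset ℕ := (Finset.range n).filter fun i => v i ∈ s
  have himg : v '' (I : Set ℕ) = s := by
    ext x
    constructor
    · rintro ⟨i, hi, rfl⟩
      exact (Finset.mem_filter.1 hi).2
    · intro hx
      obtain ⟨i, hi, rfl⟩ := hv.surj x (hs hx)
      exact ⟨i, Finset.mem_filter.2 ⟨Finset.mem_range.2 hi, hx⟩, rfl⟩
  have hcard : m ≤ I.card := by
    rw [← Set.ncard_coe_finset]
    refine hm.trans ?_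
    rw [← himg]
    exact Set.ncard_image_le I.finite_toSet
  refine ⟨fun i => I.orderEmbOfFin rfl (Fin.castLE hcard i), fun i j hij =>
    (I.orderEmbOfFin rfl).strictMono (by simpa using hij), fun i => ?_⟩
  have := Finset.mem_filter.1 (I.orderEmbOfFin_mem rfl (Fin.castLE hcard i))
  exact ⟨Finset.mem_range.1 this.1, this.2⟩

theorem IsGeoSeq.exists_face {k : ℕ} {U : ℕ → P.Triangulation} (h : IsGeoSeq k U) {s : Set Plane}
    (hs : s ⊆ P.vertices) (hne : s.Nonempty)
    (hJ : ∀ x ∈ s, ∀ y ∈ s, x ≠ y → ∃ t ≤ k, {x, y} ∈ (U t).arcs) :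
    (∃ t ≤ k, IsSimplex (U t) s) ∨
      ∃ t < k, ∃ a b c d, IsFlipQuad (U t) (U (t + 1)) a b c d ∧ s = {a, b, c, d} := by
  rcases le_or_gt s.ncard 3 with h3 | h3
  · exact .inl (h.exists_isSimplex hs hne h3 hJ)
  right
  obtain ⟨x, hx⟩ := hne
  obtain ⟨v, n, hv, -, -⟩ := P.exists_labelling one_ne_zero (hs hx)
  have hinj : ∀ {i j : ℕ}, i < n → j < n → i ≠ j → v i ≠ v j :=
    fun hi hj hij hcon => hij (hv.inj _ hi _ hj hcon)
  rcases (show 4 ≤ s.ncard from h3).eq_or_lt with h4 | h5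
  · obtain ⟨g, hg, hg'⟩ := hv.exists_strictMono hs h4.le
    have h01 : g 0 < g 1 := hg (by decide)
    have h12 : g 1 < g 2 := hg (by decide)
    have h23 : g 2 < g 3 := hg (by decide)
    have hsub : ({v (g 0), v (g 1), v (g 2), v (g 3)} : Set Plane) ⊆ s := by
      rintro y (rfl | rfl | rfl | rfl) <;> exact (hg' _).2
    have n01 := hinj (hg' 0).1 (hg' 1).1 (by omega)
    have n02 := hinj (hg' 0).1 (hg' 2).1 (by omega)
    have n03 := hinj (hg' 0).1 (hg' 3).1 (by omega)
    have n12 := hinj (hg' 1).1 (hg' 2).1 (by omega)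
    have n13 := hinj (hg' 1).1 (hg' 3).1 (by omega)
    have n23 := hinj (hg' 2).1 (hg' 3).1 (by omega)
    have heq : ({v (g 0), v (g 1), v (g 2), v (g 3)} : Set Plane) = s := by
      refine Set.eq_of_subset_of_ncard_le hsub ?_ (P.finite_vertices.subset hs)
      rw [Set.ncard_insert_of_notMem (by simp [n01, n02, n03]),
        Set.ncard_insert_of_notMem (by simp [n12, n13]), Set.ncard_pair n23, ← h4]
    rw [← heq] at hs hJ ⊢
    exact h.exists_isFlipQuad_of_crosses hs (hv.not_nonCrossing (hg' 0).1 (hg' 2).1 (hg' 1).1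
      (hg' 3).1 (by unfold Crosses; omega)) n02 n13 n01 n12 n23 n03.symm hJ
  · exfalso
    obtain ⟨g, hg, hg'⟩ := hv.exists_strictMono hs (show 5 ≤ s.ncard from h5)
    have h01 : g 0 < g 1 := hg (by decide)
    have h12 : g 1 < g 2 := hg (by decide)
    have h23 : g 2 < g 3 := hg (by decide)
    have h34 : g 3 < g 4 := hg (by decide)
    have hmem : ∀ i j, g i ≠ g j → ∃ t ≤ k, {v (g i), v (g j)} ∈ (U t).arcs := fun i j hij =>
      hJ _ (hg' i).2 _ (hg' j).2 (hinj (hg' i).1 (hg' j).1 hij)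
    have tri : ∀ i j l, g i < g j → g j < g l → ∃ t ≤ k, {v (g i), v (g j)} ∈ (U t).arcs ∧
        {v (g j), v (g l)} ∈ (U t).arcs ∧ {v (g i), v (g l)} ∈ (U t).arcs := by
      intro i j l hij hjl
      obtain ⟨t₁, h1, h1'⟩ := hmem i j hij.ne
      obtain ⟨t₂, h2, h2'⟩ := hmem j l hjl.ne
      obtain ⟨t₃, h3, h3'⟩ := hmem l i (hij.trans hjl).ne'
      obtain ⟨t, ht, ha, hb, hc⟩ := h.exists_triangle h1 h2 h3 h1' h2' h3'
      exact ⟨t, ht, ha, hb, by rwa [Set.pair_comm]⟩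
    have cr : ∀ i j l m, Crosses (g i) (g j) (g l) (g m) →
        ¬NonCrossing {v (g i), v (g j)} {v (g l), v (g m)} := fun i j l m hc =>
      hv.not_nonCrossing (hg' i).1 (hg' j).1 (hg' l).1 (hg' m).1 hc
    -- Five triangles of the pentagon `01234`, each with one or two diagonals recorded, so that each
    -- diagonal used is dated by one or two of them.
    obtain ⟨a, ha, a02, a24, -⟩ := tri 0 2 4 (by omega) (by omega)
    obtain ⟨b, hb, -, b13, b03⟩ := tri 0 1 3 (by omega) (by omega)
    obtain ⟨c, hc, -, c24, c14⟩ := tri 1 2 4 (by omega) (by omega)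
    obtain ⟨d, hd, d02, -, d03⟩ := tri 0 2 3 (by omega) (by omega)
    obtain ⟨e, he, e13, -, e14⟩ := tri 1 3 4 (by omega) (by omega)
    -- Each pair of crossing diagonals is ordered in time, and shared triangles propagate the order.
    -- If `a < b`, then `c1` gives `d < e`, while `c2`, `c3`, `c4` give in turn `c < b`, `{a, c} <
    -- {b, d}` and `e < d`. The other case is symmetric.
    have c1 := h.separated (cr 0 2 1 3 (by unfold Crosses; omega)) ha hd hb he a02 d02 b13 e13
    have c2 := h.separated (cr 1 3 2 4 (by unfold Crosses; omega)) hb he ha hc b13 e13 a24 c24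
    have c3 := h.separated (cr 2 4 0 3 (by unfold Crosses; omega)) ha hc hb hd a24 c24 b03 d03
    have c4 := h.separated (cr 0 3 1 4 (by unfold Crosses; omega)) hb hd hc he b03 d03 c14 e14
    clear hmem tri cr hg hg' hinj
    omega

end FlipGraph

/-! ### Circles made of three arcs, and boundaries of triangles -/

namespace FlipGraph

open ConvexPolygon

section Topology

/-- It is the image of the interval `(0, 2π)` by the exponential, rotated by `w`. -/
theorem isPreconnected_compl_singleton_circle (w : Circle) :
    IsPreconnected ({w}ᶜ : Set Circle) := by
  have h : ({w}ᶜ : Set Circle) = (fun t : ℝ => w * Circle.exp t) '' Set.Ioo 0 (2 * Real.pi) := by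
    ext u
    constructor
    · intro hu
      have hexp : w * Circle.exp (Complex.arg (w⁻¹ * u : Circle)) = u := by
        rw [Circle.exp_arg, mul_inv_cancel_left]
      have hle := Complex.arg_le_pi (w⁻¹ * u : Circle)
      have hlt := Complex.neg_pi_lt_arg (w⁻¹ * u : Circle)
      have hpi := Real.pi_pos
      rcases lt_trichotomy (Complex.arg (w⁻¹ * u : Circle)) 0 with hneg | hzero | hpos
      · refine ⟨Complex.arg (w⁻¹ * u : Circle) + 2 * Real.pi, ⟨by linarith, by linarith⟩, ?_⟩
        simp only [Circle.exp_add, Circle.exp_two_pi, mul_one]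
        exact hexp
      · rw [hzero, Circle.exp_zero, mul_one] at hexp
        exact absurd hexp.symm hu
      · exact ⟨_, ⟨hpos, by linarith⟩, hexp⟩
    · rintro ⟨t, ⟨h0, h1⟩, rfl⟩ hw
      have : Circle.exp t = 1 := mul_eq_left.1 hw
      obtain ⟨m, rfl⟩ := Circle.exp_eq_one.1 this
      have hpi := Real.pi_pos
      have h0' : (0 : ℝ) < m := by
        by_contra! hcon
        nlinarith
      have h1' : (m : ℝ) < 1 := by
        by_contra! hcon
        nlinarith
      have a0 : 0 < m := by exact_mod_cast h0'
      have a1 : m < 1 := by exact_mod_cast h1'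
      omega
  rw [h]
  exact isPreconnected_Ioo.image _ (by fun_prop)

theorem IsTopologicalCircle.isPreconnected_sdiff_singleton {C : Set Space}
    (h : IsTopologicalCircle C) {x : Space} (hx : x ∈ C) : IsPreconnected (C \ {x}) := by
  obtain ⟨φ⟩ := h
  have heq : C \ {x} = (fun w => ((φ.symm w : C) : Space)) '' {φ ⟨x, hx⟩}ᶜ := by
    ext y
    constructor
    · rintro ⟨hy, hne⟩
      refine ⟨φ ⟨y, hy⟩, fun hw => hne ?_, by simp⟩
      exact congrArg Subtype.val (φ.injective hw)
    · rintro ⟨w, hw, rfl⟩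
      refine ⟨(φ.symm w).2, fun hcon => hw ?_⟩
      have : φ.symm w = ⟨x, hx⟩ := Subtype.ext hcon
      rw [← this, φ.apply_symm_apply]
      rfl
  rw [heq]
  exact (isPreconnected_compl_singleton_circle _).image _ (by fun_prop)

/-- A topological circle has no free end. -/
theorem not_isTopologicalCircle_of_end {g : Plane → ℝ} {a b : Plane} {B : Set Space}
    (hg : ContinuousOn g (convexHull ℝ {a, b})) (hab : a ≠ b) (hB : IsClosed B)
    (hAB : ∀ x ∈ lift g (convexHull ℝ {a, b}), x ∈ B → x.1 = b) :
    ¬IsTopologicalCircle (lift g (convexHull ℝ {a, b}) ∪ B) := by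
  intro hC
  let l : ℝ → Plane := AffineMap.lineMap a b
  have hl : Function.Injective l := AffineMap.lineMap_injective ℝ hab
  have hseg : convexHull ℝ {a, b} = l '' Set.Icc 0 1 := by
    rw [convexHull_pair, segment_eq_image_lineMap]
  let φ : ℝ → Space := fun t => (l t, g (l t))
  have hφ : Function.Injective φ := fun s t h => hl (congrArg Prod.fst h)
  have hlc : Continuous l := AffineMap.lineMap_continuous
  have hcont : ContinuousOn φ (Set.Icc 0 1) := by
    refine hlc.continuousOn.prodMk (hg.comp hlc.continuousOn fun t ht => ?_)
    rw [hseg]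
    exact ⟨t, ht, rfl⟩
  have hlift : lift g (convexHull ℝ {a, b}) = φ '' Set.Icc 0 1 := by
    ext ⟨x, s⟩
    constructor
    · rintro ⟨hx, hs⟩
      obtain ⟨t, ht, rfl⟩ := hseg ▸ hx
      exact ⟨t, ht, Prod.ext rfl hs.symm⟩
    · rintro ⟨t, ht, h⟩
      cases h
      exact ⟨hseg ▸ ⟨t, ht, rfl⟩, rfl⟩
  rw [hlift] at hC hAB
  -- Removing the midpoint leaves two closed pieces, the half-arc at `a` and the rest. They are
  -- disjoint because `B` meets the arc only above `b`.
  have hmid : φ (1 / 2) ∈ φ '' Set.Icc 0 1 ∪ B := .inl ⟨1 / 2, by norm_num, rfl⟩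
  have hpre := hC.isPreconnected_sdiff_singleton hmid
  have hclosed : ∀ s t : ℝ, 0 ≤ s → t ≤ 1 → IsClosed (φ '' Set.Icc s t) := fun s t hs ht =>
    (isCompact_Icc.image_of_continuousOn (hcont.mono (Set.Icc_subset_Icc hs ht))).isClosed
  have hcover : (φ '' Set.Icc 0 1 ∪ B) \ {φ (1 / 2)} ⊆
      φ '' Set.Icc 0 (1 / 2) ∪ (φ '' Set.Icc (1 / 2) 1 ∪ B) := by
    rintro x ⟨⟨t, ht, rfl⟩ | hx, -⟩
    · rcases le_total t (1 / 2) with h | h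
      · exact .inl ⟨t, ⟨ht.1, h⟩, rfl⟩
      · exact .inr (.inl ⟨t, ⟨h, ht.2⟩, rfl⟩)
    · exact .inr (.inr hx)
  obtain ⟨x, ⟨-, hne⟩, ⟨t, ht, rfl⟩, hx⟩ := isPreconnected_closed_iff.1 hpre _ _
    (hclosed 0 (1 / 2) le_rfl (by norm_num)) ((hclosed (1 / 2) 1 (by norm_num) le_rfl).union hB)
    hcover
    ⟨φ 0, ⟨.inl ⟨0, by norm_num, rfl⟩, fun h => absurd (hφ h) (by norm_num)⟩, 0, by norm_num, rfl⟩
    ⟨φ 1, ⟨.inl ⟨1, by norm_num, rfl⟩, fun h => absurd (hφ h) (by norm_num)⟩,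
      .inl ⟨1, by norm_num, rfl⟩⟩
  rcases hx with ⟨s, hs, hst⟩ | hx
  · obtain rfl := hφ hst
    exact hne (congrArg φ (le_antisymm ht.2 hs.1))
  · have h1 : l t = b := hAB _ ⟨t, ⟨ht.1, by linarith [ht.2]⟩, rfl⟩ hx
    have h2 : l 1 = b := AffineMap.lineMap_apply_one a b
    have h3 := hl (h1.trans h2.symm)
    have := ht.2
    rw [h3] at this
    norm_num at this

end Topology

section Frontier

variable {ε : ℝ} {p q r x : Plane}

theorem mem_convexHull_pair_of_area (h1 : area ε p q x = 0)
    (h2 : 0 ≤ area ε q r x) (h3 : 0 ≤ area ε r p x) (h : 0 < area ε p q r) :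
    x ∈ convexHull ℝ {p, q} := by
  have hadd := area_add ε p q r x
  rw [← Set.pair_eq_singleton q]
  refine mem_convexHull_triple (α := area ε q r x) (β := area ε r p x) (γ := 0) h2 h3 le_rfl
    (by linarith) fun i => ?_
  rw [show area ε q r x + area ε r p x + 0 = area ε p q r by linarith]
  have : area ε q r x * p i + area ε r p x * q i + area ε p q x * r i = area ε p q r * x i := by
    unfold area
    fin_cases i <;> simp <;> ring
  rw [← this, h1]
  ring

/-- A point of the triangle off its sides has positive areas with respect to all three, an open
condition; conversely each side lies on a line bounding the triangle. -/
theorem frontier_convexHull_triple (hε : ε ≠ 0) (h : 0 < area ε p q r) :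
    frontier (convexHull ℝ {p, q, r}) =
      convexHull ℝ {p, q} ∪ convexHull ℝ {q, r} ∪ convexHull ℝ {r, p} := by
  have hq : 0 < area ε q r p := by rwa [area_rotate]
  have hr : 0 < area ε r p q := by rwa [area_rotate]
  have hclosed : IsClosed (convexHull ℝ ({p, q, r} : Set Plane)) :=
    (Set.toFinite _).isClosed_convexHull _
  rw [hclosed.frontier_eq]
  have hside : ∀ {p q r : Plane}, 0 < area ε p q r →
      Disjoint (convexHull ℝ {p, q}) (interior (convexHull ℝ {p, q, r})) := by
    intro p q r h
    refine disjoint_interior_of_area hε ?_ ?_ ?_ (p := p) (q := q)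
    · rintro rfl
      simp at h
    · rintro x (rfl | rfl) <;> simp
    · rintro x (rfl | rfl | rfl)
      · simp
      · simp
      · exact h.le
  have hsubset : ∀ {s t : Set Plane}, s ⊆ t → convexHull ℝ s ⊆ convexHull ℝ t := convexHull_mono
  ext x
  constructor
  · rintro ⟨hx, hint⟩
    have hnonneg : ∀ {y z : Plane}, (∀ w ∈ ({p, q, r} : Set Plane), 0 ≤ area ε y z w) →
        0 ≤ area ε y z x := fun hw => convexHull_min hw (convex_area_nonneg ε _ _) hx
    have h1 : 0 ≤ area ε p q x := hnonneg (by rintro w (rfl | rfl | rfl) <;> simp [h.le])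
    have h2 : 0 ≤ area ε q r x := hnonneg (by rintro w (rfl | rfl | rfl) <;> simp [hq.le])
    have h3 : 0 ≤ area ε r p x := hnonneg (by rintro w (rfl | rfl | rfl) <;> simp [hr.le])
    by_contra hcon
    simp only [Set.mem_union, not_or] at hcon
    have h1' := h1.lt_of_ne' fun h0 => hcon.1.1 (mem_convexHull_pair_of_area h0 h2 h3 h)
    have h2' := h2.lt_of_ne' fun h0 => hcon.1.2 (mem_convexHull_pair_of_area h0 h3 h1 hq)
    have h3' := h3.lt_of_ne' fun h0 => hcon.2 (mem_convexHull_pair_of_area h0 h1 h2 hr)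
    refine hint (mem_interior.2 ⟨{y | 0 < area ε p q y} ∩ {y | 0 < area ε q r y} ∩
      {y | 0 < area ε r p y}, ?_, ?_, ⟨⟨h1', h2'⟩, h3'⟩⟩)
    · rintro y ⟨⟨hy1, hy2⟩, hy3⟩
      exact mem_convexHull_of_area (le_of_lt hy1) (le_of_lt hy2) (le_of_lt hy3) h
    · have ho : ∀ p q, IsOpen {y | 0 < area ε p q y} := fun p q =>
        isOpen_lt continuous_const (continuous_area ε p q)
      exact ((ho _ _).inter (ho _ _)).inter (ho _ _)
  · have e1 : ({q, r, p} : Set Plane) = {p, q, r} := by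
      ext w; simp only [Set.mem_insert_iff, Set.mem_singleton_iff]; tauto
    have e2 : ({r, p, q} : Set Plane) = {p, q, r} := by
      ext w; simp only [Set.mem_insert_iff, Set.mem_singleton_iff]; tauto
    rintro ((hx | hx) | hx)
    · exact ⟨hsubset (by rintro w (rfl | rfl) <;> simp) hx, Set.disjoint_left.1 (hside h) hx⟩
    · exact ⟨hsubset (by rintro w (rfl | rfl) <;> simp) hx, e1 ▸ Set.disjoint_left.1 (hside hq) hx⟩
    · exact ⟨hsubset (by rintro w (rfl | rfl) <;> simp) hx, e2 ▸ Set.disjoint_left.1 (hside hr) hx⟩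

end Frontier

variable {P : ConvexPolygon}

theorem ConvexPolygon.frontier_triangle (P : ConvexPolygon) {a b c : Plane} (ha : a ∈ P.vertices)
    (hb : b ∈ P.vertices) (hc : c ∈ P.vertices) (hab : a ≠ b) (hbc : b ≠ c) (hca : c ≠ a) :
    frontier (convexHull ℝ {a, b, c}) =
      convexHull ℝ {a, b} ∪ convexHull ℝ {b, c} ∪ convexHull ℝ {c, a} := by
  have h1 := P.area_ne_zero one_ne_zero ha hb hc hab hca.symm hbc
  refine frontier_convexHull_triple (ε := area 1 a b c) h1 ?_
  have : area (area 1 a b c) a b c = area 1 a b c * area 1 a b c := by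
    unfold area; ring
  rw [this]
  exact mul_self_pos.2 h1

variable {T T' : P.Triangulation} {p : P.flipGraph.Walk T T'} {f : ℕ → Plane → ℝ}

theorem isFlag (hp : IsGeodesic p) (hf : IsDiskSequence p f) : (blowUp p f).IsFlag := by
  intro s hs hne hJ
  rw [blowUp_vertices hp hf] at hs
  obtain ⟨s, hsv, rfl⟩ := Set.subset_image_iff.1 hs
  have hJ' : ∀ x ∈ s, ∀ y ∈ s, x ≠ y → ∃ t ≤ p.length, {x, y} ∈ (p.getVert t).arcs := by
    intro x hx y hy hxy
    obtain ⟨_, ⟨t, ht, e, he, rfl⟩, hxe, hye⟩ := hJ _ ⟨x, hx, rfl⟩ _ ⟨y, hy, rfl⟩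
      ((vertexAbove_injective f).ne hxy)
    have hsub := ((p.getVert t).isArc e he).1
    have hx' := P.mem_of_mem_convexHull (hsv hx) hsub (lift_singleton_subset_iff.1 hxe).1
    have hy' := P.mem_of_mem_convexHull (hsv hy) hsub (lift_singleton_subset_iff.1 hye).1
    have heq : ({x, y} : Set Plane) = e := by
      refine Set.eq_of_subset_of_ncard_le ?_ ?_ (P.finite_vertices.subset hsub)
      · rintro z (rfl | rfl) <;> assumption
      · rw [((p.getVert t).isArc e he).2, Set.ncard_pair hxy]
    exact ⟨t, ht, heq ▸ he⟩
  rcases hp.isGeoSeq.exists_face hsv (Set.image_nonempty.1 hne) hJ' with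
    ⟨t, ht, h⟩ | ⟨t, ht, a, b, c, d, hq, rfl⟩
  · exact ⟨_, mem_faces_iff.2 (.inl ⟨t, ht, s, h, rfl⟩), vertexSet_lift hp hf ht hsv⟩
  · exact ⟨_, mem_faces_iff.2 (.inr ⟨t, ht, rfl⟩), vertexSet_between hp hf ht hq⟩

namespace ConvexPolygon.IsDiskSequence

/-- Two distinct arcs of the blow-up triangulation meet at most at their endpoints. -/
theorem mem_inter_of_mem (hf : IsDiskSequence p f) {i j : ℕ}
    (hi : i ≤ p.length) (hj : j ≤ p.length) {e e' : Set Plane} (he : e ∈ (p.getVert i).arcs)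
    (he' : e' ∈ (p.getVert j).arcs) (hne : e ≠ e') {x : Space}
    (hx : x ∈ lift (f i) (convexHull ℝ e)) (hx' : x ∈ lift (f j) (convexHull ℝ e')) :
    x.1 ∈ e ∩ e' := by
  wlog hij : i ≤ j generalizing i j e e'
  · exact (this hj hi he' he hne.symm hx' hx (le_of_not_ge hij)).symm
  have hsub := ((p.getVert i).isArc e he).1
  have hsub' := ((p.getVert j).isArc e' he').1
  by_cases hxv : x.1 ∈ P.vertices
  · exact ⟨P.mem_of_mem_convexHull hxv hsub hx.1, P.mem_of_mem_convexHull hxv hsub' hx'.1⟩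
  exfalso
  -- Within one triangulation, distinct arcs meet at most in a common endpoint.
  have hcr : e ∉ (p.getVert j).arcs := by
    intro hej
    have hmem := (p.getVert j).nonCrossing e hej e' he' ⟨hx.1, hx'.1⟩
    have hss : e ∩ e' ⊂ e := by
      refine ⟨Set.inter_subset_left, fun hcon => hne ?_⟩
      refine Set.eq_of_subset_of_ncard_le (fun y hy => (hcon hy).2) ?_
        (P.finite_vertices.subset hsub')
      rw [((p.getVert i).isArc e he).2, ((p.getVert j).isArc e' he').2]
    have hlt := Set.ncard_lt_ncard hss (P.finite_vertices.subset hsub)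
    rw [((p.getVert i).isArc e he).2] at hlt
    have hle : (e ∩ e').ncard ≤ 1 := by omega
    rcases (Set.ncard_le_one_iff_eq
      ((P.finite_vertices.subset hsub).subset Set.inter_subset_left)).1 hle with h0 | ⟨y, hy⟩
    · simp [h0] at hmem
    · rw [hy, convexHull_singleton] at hmem
      have hye : y ∈ e ∩ e' := hy ▸ rfl
      rw [Set.mem_singleton_iff] at hmem
      exact hxv (hmem ▸ hsub hye.1)
  -- At the flip that removes `e`, the point is inside the quadrilateral, so the disk rises strictly
  -- there. Disks never descend, so the point cannot be on disk `j`.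
  obtain ⟨m, him, hmj, hm, hm'⟩ := exists_last (Q := fun t => e ∈ (p.getVert t).arcs) hij he hcr
  have hml : m < p.length := by omega
  obtain ⟨a, b, c, d, hq⟩ := exists_isFlipQuad (p.adj_getVert_succ hml)
  have hreg : x.1 ∈ P.region := convexHull_mono hsub hx.1
  have hint := hq.diag_interior x.1 (hq.left e hm hm' ▸ hx.1) hxv
  have h1 := hf.le_of_le him hml.le hreg
  have h2 := hf.lt_inside m hml x.1 hint
  have h3 := hf.le_of_le (show m + 1 ≤ j from hmj) hj hreg
  have h4 := hx.2
  have h5 := hx'.2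
  linarith

theorem isClosed_lift (hf : IsDiskSequence p f) {i : ℕ} (hi : i ≤ p.length) {e : Set Plane}
    (he : e ⊆ P.vertices) : IsClosed (lift (f i) (convexHull ℝ e)) := by
  have hcomp : IsCompact (convexHull ℝ e) :=
    (P.finite_vertices.subset he).isCompact_convexHull _
  have hc := (hf.continuousOn i hi).mono (convexHull_mono he)
  have heq : lift (f i) (convexHull ℝ e) = (fun x => (x, f i x)) '' convexHull ℝ e := by
    ext ⟨x, t⟩
    constructor
    · rintro ⟨hx, ht⟩
      exact ⟨x, hx, Prod.ext rfl ht.symm⟩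
    · rintro ⟨y, hy, h⟩
      cases h
      exact ⟨hy, rfl⟩
  rw [heq]
  exact (hcomp.image_of_continuousOn (continuousOn_id.prodMk hc)).isClosed

/-- Otherwise the vertex above `a` would be a free end of the circle. -/
theorem mem_other_arc (hf : IsDiskSequence p f) (hp : IsGeodesic p) {i₁ i₂ i₃ : ℕ}
    (h1 : i₁ ≤ p.length) (h2 : i₂ ≤ p.length) (h3 : i₃ ≤ p.length) {e₁ e₂ e₃ : Set Plane}
    (he1 : e₁ ∈ (p.getVert i₁).arcs) (he2 : e₂ ∈ (p.getVert i₂).arcs)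
    (he3 : e₃ ∈ (p.getVert i₃).arcs)
    (hC : IsTopologicalCircle (lift (f i₁) (convexHull ℝ e₁) ∪ lift (f i₂) (convexHull ℝ e₂) ∪
      lift (f i₃) (convexHull ℝ e₃))) {a : Plane} (ha : a ∈ e₁) :
    (a ∈ e₂ ∧ e₂ ≠ e₁) ∨ (a ∈ e₃ ∧ e₃ ≠ e₁) := by
  by_contra hcon
  rw [not_or, not_and_not_right, not_and_not_right] at hcon
  obtain ⟨b, hab, rfl⟩ : ∃ b, a ≠ b ∧ e₁ = {a, b} := by
    obtain ⟨x, y, hxy, rfl⟩ := Set.ncard_eq_two.1 ((p.getVert i₁).isArc e₁ he1).2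
    rcases ha with rfl | rfl
    · exact ⟨y, hxy, rfl⟩
    · exact ⟨x, hxy.symm, Set.pair_comm _ _⟩
  have hsub := ((p.getVert i₁).isArc _ he1).1
  -- Arcs with the endpoints of `e₁` are left out: they coincide with the first arc, as the disks
  -- agree above it.
  let B : Set Space := ⋃₀ {σ | (σ = lift (f i₂) (convexHull ℝ e₂) ∧ e₂ ≠ {a, b}) ∨
    (σ = lift (f i₃) (convexHull ℝ e₃) ∧ e₃ ≠ {a, b})}
  have hB : IsClosed B := by
    rw [show B = _ from Set.sUnion_eq_biUnion]
    refine Set.Finite.isClosed_biUnion ?_ ?_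
    · refine (Set.toFinite {lift (f i₂) (convexHull ℝ e₂), lift (f i₃) (convexHull ℝ e₃)}).subset ?_
      rintro σ (⟨rfl, -⟩ | ⟨rfl, -⟩) <;> simp
    · rintro σ (⟨rfl, -⟩ | ⟨rfl, -⟩)
      · exact hf.isClosed_lift h2 ((p.getVert i₂).isArc _ he2).1
      · exact hf.isClosed_lift h3 ((p.getVert i₃).isArc _ he3).1
  refine not_isTopologicalCircle_of_end (g := f i₁) (a := a) (b := b) (B := B)
    ((hf.continuousOn _ h1).mono (convexHull_mono hsub)) hab hB ?_ ?_
  · rintro x hx ⟨σ, ⟨rfl, hne⟩ | ⟨rfl, hne⟩, hxσ⟩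
    · obtain ⟨hx1 | hx1, hx2⟩ := hf.mem_inter_of_mem h1 h2 he1 he2 hne.symm hx hxσ
      · exact absurd (hcon.1 (hx1 ▸ hx2)) hne
      · exact hx1
    · obtain ⟨hx1 | hx1, hx2⟩ := hf.mem_inter_of_mem h1 h3 he1 he3 hne.symm hx hxσ
      · exact absurd (hcon.2 (hx1 ▸ hx2)) hne
      · exact hx1
  · convert hC using 1
    have hsame : ∀ {j : ℕ}, j ≤ p.length → {a, b} ∈ (p.getVert j).arcs →
        lift (f j) (convexHull ℝ {a, b}) = lift (f i₁) (convexHull ℝ {a, b}) := fun hj hmem =>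
      lift_congr (hf.eqOn hp hj h1 (IsSimplex.of_arc hmem) (IsSimplex.of_arc he1))
    ext x
    constructor
    · rintro (hx | ⟨σ, ⟨rfl, -⟩ | ⟨rfl, -⟩, hxσ⟩)
      · exact .inl (.inl hx)
      · exact .inl (.inr hxσ)
      · exact .inr hxσ
    · rintro ((hx | hx) | hx)
      · exact .inl hx
      · by_cases h : e₂ = {a, b}
        · subst h
          exact .inl (hsame h2 he2 ▸ hx)
        · exact .inr ⟨_, .inl ⟨rfl, h⟩, hx⟩
      · by_cases h : e₃ = {a, b}
        · subst h
          exact .inl (hsame h3 he3 ▸ hx)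
        · exact .inr ⟨_, .inr ⟨rfl, h⟩, hx⟩

theorem exists_triangle (hf : IsDiskSequence p f) (hp : IsGeodesic p) {i₁ i₂ i₃ : ℕ}
    (h1 : i₁ ≤ p.length) (h2 : i₂ ≤ p.length) (h3 : i₃ ≤ p.length) {a b c : Plane}
    (hab : {a, b} ∈ (p.getVert i₁).arcs) (hbc : {b, c} ∈ (p.getVert i₂).arcs)
    (hca : {c, a} ∈ (p.getVert i₃).arcs) :
    ∃ τ ∈ (blowUp p f).triangles, diskBoundary τ =
      lift (f i₁) (convexHull ℝ {a, b}) ∪ lift (f i₂) (convexHull ℝ {b, c}) ∪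
        lift (f i₃) (convexHull ℝ {c, a}) := by
  obtain ⟨t, ht, hab', hbc', hca'⟩ := hp.isGeoSeq.exists_triangle h1 h2 h3 hab hbc hca
  have hsame : ∀ {j : ℕ} {e : Set Plane}, j ≤ p.length → e ∈ (p.getVert j).arcs →
      e ∈ (p.getVert t).arcs → lift (f j) (convexHull ℝ e) = lift (f t) (convexHull ℝ e) :=
    fun hj hmem hmem' =>
      lift_congr (hf.eqOn hp hj ht (IsSimplex.of_arc hmem) (IsSimplex.of_arc hmem'))
  refine ⟨lift (f t) (convexHull ℝ {a, b, c}), ⟨t, ht, _, ⟨a, b, c, rfl, hab', hbc', hca'⟩, rfl⟩, ?_⟩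
  rw [hsame h1 hab hab', hsame h2 hbc hbc', hsame h3 hca hca']
  unfold diskBoundary
  rw [fst_image_lift, P.frontier_triangle ((p.getVert i₁).left_mem hab)
    ((p.getVert i₂).left_mem hbc) ((p.getVert i₃).left_mem hca) ((p.getVert i₁).ne_of_mem hab)
    ((p.getVert i₂).ne_of_mem hbc) ((p.getVert i₃).ne_of_mem hca)]
  ext x
  constructor
  · rintro ⟨⟨-, hx⟩, (h | h) | h⟩
    · exact .inl (.inl ⟨h, hx⟩)
    · exact .inl (.inr ⟨h, hx⟩)
    · exact .inr ⟨h, hx⟩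
  · rintro ((⟨h, hx⟩ | ⟨h, hx⟩) | ⟨h, hx⟩)
    · exact ⟨⟨convexHull_mono (by rintro w (rfl | rfl) <;> simp) h, hx⟩, .inl (.inl h)⟩
    · exact ⟨⟨convexHull_mono (by rintro w (rfl | rfl) <;> simp) h, hx⟩, .inl (.inr h)⟩
    · exact ⟨⟨convexHull_mono (by rintro w (rfl | rfl) <;> simp) h, hx⟩, .inr h⟩

theorem exists_triangle_of_circle (hf : IsDiskSequence p f) (hp : IsGeodesic p) {α β γ : Set Space}
    (hα : α ∈ (blowUp p f).arcs) (hβ : β ∈ (blowUp p f).arcs) (hγ : γ ∈ (blowUp p f).arcs)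
    (hC : IsTopologicalCircle (α ∪ β ∪ γ)) :
    ∃ τ ∈ (blowUp p f).triangles, diskBoundary τ = α ∪ β ∪ γ := by
  obtain ⟨i₁, h1, e₁, he1, rfl⟩ := hα
  obtain ⟨i₂, h2, e₂, he2, rfl⟩ := hβ
  obtain ⟨i₃, h3, e₃, he3, rfl⟩ := hγ
  have pair : ∀ {j : ℕ} {e : Set Plane} {x : Plane}, e ∈ (p.getVert j).arcs → x ∈ e →
      ∃ y, x ≠ y ∧ e = {x, y} := by
    intro j e x he hx
    obtain ⟨y, z, hyz, rfl⟩ := Set.ncard_eq_two.1 ((p.getVert j).isArc e he).2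
    rcases hx with rfl | rfl
    · exact ⟨z, hyz, rfl⟩
    · exact ⟨y, hyz.symm, Set.pair_comm _ _⟩
  have two : ∀ {j : ℕ} {e : Set Plane} {x y : Plane}, e ∈ (p.getVert j).arcs → x ∈ e → y ∈ e →
      x ≠ y → e = {x, y} := by
    intro j e x y he hx hy hxy
    obtain ⟨z, hxz, rfl⟩ := pair he hx
    rcases hy with rfl | rfl
    · exact absurd rfl hxy
    · rfl
  have main : ∀ {a b : Plane} {i₁ i₂ i₃ : ℕ} {e₂ e₃ : Set Plane}, i₁ ≤ p.length → i₂ ≤ p.length →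
      i₃ ≤ p.length → {a, b} ∈ (p.getVert i₁).arcs → e₂ ∈ (p.getVert i₂).arcs →
      e₃ ∈ (p.getVert i₃).arcs → IsTopologicalCircle (lift (f i₁) (convexHull ℝ {a, b}) ∪
        lift (f i₂) (convexHull ℝ e₂) ∪ lift (f i₃) (convexHull ℝ e₃)) →
      b ∈ e₂ → e₂ ≠ {a, b} → a ∈ e₃ → e₃ ≠ {a, b} →
      ∃ τ ∈ (blowUp p f).triangles, diskBoundary τ = lift (f i₁) (convexHull ℝ {a, b}) ∪
        lift (f i₂) (convexHull ℝ e₂) ∪ lift (f i₃) (convexHull ℝ e₃) := by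
    intro a b i₁ i₂ i₃ e₂ e₃ h1 h2 h3 he1 he2 he3 hC hb hne2 ha hne3
    obtain ⟨c, hbc, rfl⟩ := pair he2 hb
    have hca : c ≠ a := by
      rintro rfl
      exact hne2 (Set.pair_comm _ _)
    -- The end `c` of the second arc is shared too, and not with `ab`, so the third arc closes the
    -- triangle.
    have hc : c ∈ e₃ := by
      rw [Set.union_comm (lift (f i₁) _)] at hC
      rcases hf.mem_other_arc hp h2 h1 h3 he2 he1 he3 hC (a := c) (by simp) with h | h
      · rcases h.1 with rfl | rfl
        · exact absurd rfl hca
        · exact absurd rfl hbc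
      · exact h.1
    obtain rfl := two he3 hc ha hca
    exact hf.exists_triangle hp h1 h2 h3 he1 he2 he3
  obtain ⟨a, b, hab, rfl⟩ := Set.ncard_eq_two.1 ((p.getVert i₁).isArc e₁ he1).2
  rcases hf.mem_other_arc hp h1 h2 h3 he1 he2 he3 hC (a := a) (by simp) with ha | ha <;>
    rcases hf.mem_other_arc hp h1 h2 h3 he1 he2 he3 hC (a := b) (by simp) with hb | hb
  · exact absurd (two he2 ha.1 hb.1 hab) ha.2
  · rw [Set.union_right_comm] at hC ⊢
    exact main h1 h3 h2 he1 he3 he2 hC hb.1 hb.2 ha.1 ha.2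
  · exact main h1 h2 h3 he1 he2 he3 hC hb.1 hb.2 ha.1 ha.2
  · exact absurd (two he3 ha.1 hb.1 hab) ha.2

end ConvexPolygon.IsDiskSequence

end FlipGraph

theorem mainTheorem2 (P : FlipGraph.ConvexPolygon) (K : FlipGraph.Complex3)
    (hK : ∃ (T T' : P.Triangulation) (p : P.flipGraph.Walk T T'),
      FlipGraph.ConvexPolygon.IsGeodesic p ∧ K.IsAssociatedWith p) :
    K.IsAbstractSimplicialComplex ∧ K.IsFlag ∧
      ∀ α ∈ K.arcs, ∀ β ∈ K.arcs, ∀ γ ∈ K.arcs,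
        FlipGraph.IsTopologicalCircle (α ∪ β ∪ γ) →
          ∃ τ ∈ K.triangles, FlipGraph.diskBoundary τ = α ∪ β ∪ γ := by
  obtain ⟨T, T', p, hp, f, hf, rfl⟩ := hK
  exact ⟨FlipGraph.isAbstractSimplicialComplex hp hf, FlipGraph.isFlag hp hf,
    fun α hα β hβ γ hγ hC => hf.exists_triangle_of_circle hp hα hβ hγ hC⟩
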